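/- **PageRank.** Let $G=(V,E)$ be a finite simple undirected graph with $n=|V|$, let $0<\alpha<1$, and let $q$ be a probability distribution on $V$. The $\alpha$-random walk on $G$ moves, at each step, with probability $\alpha$ to a vertex drawn from $q$, and with probability $1-\alpha$ to a uniformly chosen neighbour of the current vertex (at a vertex without neighbours it stays where it is). The PageRank $\pi_v^G$ of $v$ is the value at $v$ of the stationary distribution of this walk. **Add-delete-model.** The players are the vertices. A strategy of $v$ in $G$ consists of a set of neighbours of $v$ to which the edges are retained (the other edges at $v$ are deleted) and, optionally, one non-neighbour $u\neq v$ to which an edge $uv$ is added; at least one edge at $v$ must be retained or added. If an edge $uv$ is added, the strategy is admissible only if $\pi_u^{G'}>\pi_u^{G}$, where $G'$ is the graph resulting from all the deletions and the addition. An admissible strategy of $v$ is improving if $\pi_v^{G'}>\pi_v^{G}$. The triple $(G,\alpha,q)$ is a Nash equilibrium if no player has an improving strategy. **Parameter.** If $G$ is a tree, put $k(G)=1$; otherwise let $k(G)$ be the maximum, over all biconnected components $B$ of $G$ (maximal connected subgraphs without a cut vertex of their own; bridges included) and all vertices $v$ of $B$, of the degree of $v$ in $B$. **Theorem 5.1.**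 There is an algorithm which, given $G$ with $k=k(G)$, $\alpha$ and $q$, determines in $O(2^{2k}n^5)$ time whether $(G,\alpha,q)$ is a Nash equilibrium in the add-delete-model and, if it is not, outputs a player $v$ together with an improving strategy of $v$. Here an algorithm is a single program (independent of the input) for a random access machine with real-number registers: the input is $n$, the adjacency matrix of $G$, $\alpha$ and $q$; memory accesses, comparisons, additions and truncated subtractions of natural numbers (indices and counters), and comparisons and the four arithmetic operations on real numbers cost one time unit each. The constant in $O(\cdot)$ is absolute, i.e. the same for all $n$, $G$, $k$, $\alpha$ and $q$. -/

import Mathlib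

namespace PageRankGame

/-! ### PageRank of an undirected graph -/

section PageRank

variable {V : Type*} [Fintype V]

open Classical in
/-- One step of the simple random walk: from `u` move to a uniformly chosen neighbour.
From a vertex without neighbours the walk does not move. -/
noncomputable def walk (G : SimpleGraph V) (u w : V) : ℝ :=
  if G.degree u = 0 then (if u = w then 1 else 0)
  else if G.Adj u w then 1 / (G.degree u : ℝ) else 0

/-- `q` is a probability distribution on `V`. -/
def IsDistribution (q : V → ℝ) : Prop := (∀ u, 0 ≤ q u) ∧ ∑ u, q u = 1

/-- Transition probabilities of the `α`-random walk: with probability `α` a random jump to a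
vertex drawn from `q`, otherwise a step of the random walk. -/
noncomputable def transition (G : SimpleGraph V) (α : ℝ) (q : V → ℝ) (u w : V) : ℝ :=
  α * q w + (1 - α) * walk G u w

/-- `π` is a stationary distribution of the `α`-random walk. -/
def IsStationary (G : SimpleGraph V) (α : ℝ) (q π : V → ℝ) : Prop :=
  IsDistribution π ∧ ∀ w, ∑ u, π u * transition G α q u w = π w

/-- The PageRank vector: the stationary distribution of the `α`-random walk (it exists and is
unique, see `existsUnique_isStationary`). -/
noncomputable def pageRank (G : SimpleGraph V) (α : ℝ) (q : V → ℝ) : V → ℝ :=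
  Classical.epsilon (IsStationary G α q)

theorem walk_nonneg (G : SimpleGraph V) (u w : V) : 0 ≤ walk G u w := by
  unfold walk
  split_ifs <;> positivity

theorem sum_walk (G : SimpleGraph V) (u : V) : ∑ w, walk G u w = 1 := by
  classical
  unfold walk
  by_cases h : G.degree u = 0
  · simp [h]
  · have h' : (G.degree u : ℝ) ≠ 0 := by exact_mod_cast h
    simp only [h, if_false]
    rw [← Finset.sum_filter, Finset.sum_const, nsmul_eq_mul, ← SimpleGraph.neighborFinset_eq_filter,
      SimpleGraph.card_neighborFinset_eq_degree]
    field_simp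

theorem sum_sum_walk (G : SimpleGraph V) (x : V → ℝ) : ∑ w, ∑ u, x u * walk G u w = ∑ u, x u := by
  rw [Finset.sum_comm]
  simp [← Finset.mul_sum, sum_walk]

theorem existsUnique_isStationary (G : SimpleGraph V) {α : ℝ} (h0 : 0 < α) (h1 : α < 1)
    {q : V → ℝ} (hq : IsDistribution q) : ∃! π, IsStationary G α q π := by
  classical
  have key : ∀ π : V → ℝ, ∑ u, π u = 1 →
      ((∀ w, ∑ u, π u * transition G α q u w = π w) ↔
        ∀ w, π w = α * q w + (1 - α) * ∑ u, π u * walk G u w) := by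
    intro π hπ
    refine forall_congr' fun w => ?_
    have : ∑ u, π u * transition G α q u w = α * q w + (1 - α) * ∑ u, π u * walk G u w := by
      have e : ∀ u, π u * transition G α q u w
          = π u * (α * q w) + (1 - α) * (π u * walk G u w) := fun u => by
        unfold transition; ring
      simp_rw [e]
      rw [Finset.sum_add_distrib, ← Finset.sum_mul, ← Finset.mul_sum, hπ, one_mul]
    rw [this, eq_comm]
  have absle : ∀ (x b : V → ℝ), (∀ w, x w = b w + (1 - α) * ∑ u, x u * walk G u w) →
      α * ∑ w, |x w| ≤ ∑ w, |b w| := by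
    intro x b hx
    have h2 : ∑ w, |x w| ≤ ∑ w, (|b w| + (1 - α) * ∑ u, |x u| * walk G u w) := by
      refine Finset.sum_le_sum fun w _ => ?_
      conv_lhs => rw [hx w]
      refine (abs_add_le _ _).trans ?_
      rw [abs_mul, abs_of_pos (sub_pos.2 h1)]
      have := Finset.abs_sum_le_sum_abs (fun u => x u * walk G u w) Finset.univ
      simp only [abs_mul, abs_of_nonneg (walk_nonneg G _ _)] at this
      have h3 : 0 ≤ 1 - α := by linarith
      gcongr
    rw [Finset.sum_add_distrib, ← Finset.mul_sum, sum_sum_walk G (fun u => |x u|)] at h2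
    linarith
  let L : (V → ℝ) →ₗ[ℝ] (V → ℝ) :=
    { toFun := fun x w => x w - (1 - α) * ∑ u, x u * walk G u w
      map_add' := fun x y => by
        funext w
        simp only [Pi.add_apply, add_mul, Finset.sum_add_distrib]
        ring
      map_smul' := fun c x => by
        funext w
        simp only [Pi.smul_apply, smul_eq_mul, RingHom.id_apply, mul_assoc, ← Finset.mul_sum]
        ring }
  have Linj : Function.Injective L := by
    rw [injective_iff_map_eq_zero]
    intro x hx
    have hx' : ∀ w, x w = 0 + (1 - α) * ∑ u, x u * walk G u w := fun w => by
      have := congrFun hx w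
      simp only [L, LinearMap.coe_mk, AddHom.coe_mk, Pi.zero_apply] at this
      linarith
    have h2 := absle x (fun _ => 0) hx'
    simp only [abs_zero, Finset.sum_const_zero] at h2
    have h3 : ∑ w, |x w| ≤ 0 := by
      by_contra hc
      push Not at hc
      nlinarith
    have h4 := (Finset.sum_eq_zero_iff_of_nonneg (fun w _ => abs_nonneg (x w))).1
      (le_antisymm h3 (Finset.sum_nonneg fun w _ => abs_nonneg (x w)))
    funext w
    exact abs_eq_zero.1 (h4 w (Finset.mem_univ w))
  obtain ⟨π, hπ⟩ := LinearMap.injective_iff_surjective.1 Linj (fun w => α * q w)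
  have hfix : ∀ w, π w = α * q w + (1 - α) * ∑ u, π u * walk G u w := fun w => by
    have := congrFun hπ w
    simp only [L, LinearMap.coe_mk, AddHom.coe_mk] at this
    linarith
  have hsum : ∑ w, π w = 1 := by
    have h2 : ∑ w, π w = ∑ w, (α * q w + (1 - α) * ∑ u, π u * walk G u w) :=
      Finset.sum_congr rfl fun w _ => hfix w
    rw [Finset.sum_add_distrib, ← Finset.mul_sum, ← Finset.mul_sum, sum_sum_walk, hq.2] at h2
    have : α * (∑ w, π w - 1) = 0 := by linarith
    rcases mul_eq_zero.1 this with h | h <;> linarith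
  have habs : ∑ w, |π w| ≤ 1 := by
    have h2 := absle π (fun w => α * q w) hfix
    simp only [abs_mul, abs_of_pos h0, abs_of_nonneg (hq.1 _)] at h2
    rw [← Finset.mul_sum, hq.2] at h2
    exact le_of_mul_le_mul_left h2 h0
  have hnn : ∀ w, 0 ≤ π w := by
    have h3 : ∑ w, (|π w| - π w) = 0 := by
      refine le_antisymm ?_ (Finset.sum_nonneg fun w _ => sub_nonneg.2 (le_abs_self _))
      rw [Finset.sum_sub_distrib, hsum]
      linarith
    intro w
    have := (Finset.sum_eq_zero_iff_of_nonneg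
      (fun w _ => sub_nonneg.2 (le_abs_self (π w)))).1 h3 w (Finset.mem_univ w)
    have h5 := abs_nonneg (π w)
    linarith
  refine ⟨π, ⟨⟨hnn, hsum⟩, (key π hsum).2 hfix⟩, fun ρ hρ => ?_⟩
  have hρ' := (key ρ hρ.1.2).1 hρ.2
  refine Linj ?_
  rw [hπ]
  funext w
  simp only [L, LinearMap.coe_mk, AddHom.coe_mk]
  linarith [hρ' w]

theorem pageRank_isStationary (G : SimpleGraph V) {α : ℝ} (h0 : 0 < α) (h1 : α < 1)
    {q : V → ℝ} (hq : IsDistribution q) : IsStationary G α q (pageRank G α q) :=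
  Classical.epsilon_spec (existsUnique_isStationary G h0 h1 hq).exists

end PageRank

/-! ### The parameter `k(G)` -/

section Blocks

variable {V : Type*} [Fintype V]

/-- The subgraph induced on `B` is connected and has no cut vertex. -/
def IsNonseparable (G : SimpleGraph V) (B : Finset V) : Prop :=
  (G.induce (B : Set V)).Connected ∧ ∀ v ∈ B, (G.induce ((B : Set V) \ {v})).Preconnected

/-- Vertex sets of biconnected components (blocks): the maximal vertex sets inducing a connected
subgraph without a cut vertex. A bridge forms a block with two vertices. -/
def IsBlock (G : SimpleGraph V) (B : Finset V) : Prop :=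
  Maximal (IsNonseparable G) B

open Classical in
/-- `k(G) = 1` if `G` is a tree; otherwise the maximum, over the biconnected components of `G`, of
the degree of a vertex inside the component. -/
noncomputable def param (G : SimpleGraph V) : ℕ :=
  if G.IsTree then 1
  else (Finset.univ.filter fun B : Finset V => IsBlock G B).sup fun B =>
    B.sup fun v => (B.filter fun w => G.Adj v w).card

end Blocks

/-! ### The add-delete-model -/

section Game

variable {V : Type*} [Fintype V]

/-- A strategy of a player: the neighbours whose edges are retained, and at most one vertex to
which an edge is added. -/
structure Strategy (V : Type*) where
  keep : Finset V
  add : Option V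

/-- The graph that results when `v` plays `s`: edges from `v` to vertices outside `s.keep` are
deleted, and the edge from `v` to `s.add`, if any, is added. -/
def outcome (G : SimpleGraph V) (v : V) (s : Strategy V) : SimpleGraph V :=
  G.deleteEdges {e | ∃ w, w ∉ s.keep ∧ e = s(v, w)} ⊔
    SimpleGraph.fromEdgeSet {e | ∃ u, s.add = some u ∧ e = s(v, u)}

/-- `s` is a strategy available to `v`: a set of neighbours is retained, and at most one edge to a
non-neighbour `u ≠ v` is added, which must strictly increase the PageRank of `u`. As PageRank is
defined through out-neighbours, `v` has to be left with at least one edge. -/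
def IsAvailable (G : SimpleGraph V) (α : ℝ) (q : V → ℝ) (v : V) (s : Strategy V) : Prop :=
  (∀ w ∈ s.keep, G.Adj v w) ∧
  (s.keep.Nonempty ∨ s.add.isSome) ∧
  ∀ u, s.add = some u →
    u ≠ v ∧ ¬ G.Adj v u ∧ pageRank G α q u < pageRank (outcome G v s) α q u

/-- `s` is available to `v` and strictly increases the PageRank of `v`. -/
def IsImproving (G : SimpleGraph V) (α : ℝ) (q : V → ℝ) (v : V) (s : Strategy V) : Prop :=
  IsAvailable G α q v s ∧ pageRank G α q v < pageRank (outcome G v s) α q v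

/-- Every player is in best response. -/
def IsNash (G : SimpleGraph V) (α : ℝ) (q : V → ℝ) : Prop :=
  ∀ v s, IsAvailable G α q v s → pageRank (outcome G v s) α q v ≤ pageRank G α q v

end Game

/-! ### A real random access machine

A structured programming language over a memory of natural numbers (used for indices and counters)
and real numbers. A program is a finite piece of code without access to `n`; its only constants
are natural numbers. Each memory access, arithmetic operation, comparison and assignment costs one
unit. On natural numbers only addition and truncated subtraction are provided, on real
numbers the four field operations and comparison (no rounding). -/

/-- Memory: two-dimensional arrays of naturals and of reals, the arrays being numbered. -/
structure Memory where
  nat : ℕ → ℕ → ℕ → ℕ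
  real : ℕ → ℕ → ℕ → ℝ

inductive NatExpr where
  | lit (c : ℕ)
  | read (a : ℕ) (i j : NatExpr)
  | add (e f : NatExpr)
  | sub (e f : NatExpr)

inductive RealExpr where
  | ofNat (e : NatExpr)
  | read (a : ℕ) (i j : NatExpr)
  | add (x y : RealExpr)
  | sub (x y : RealExpr)
  | mul (x y : RealExpr)
  | div (x y : RealExpr)

inductive Test where
  | natEq (e f : NatExpr)
  | natLt (e f : NatExpr)
  | realLt (x y : RealExpr)
  | not (b : Test)
  | and (b c : Test)

inductive Program where
  | skip
  | setNat (a : ℕ) (i j e : NatExpr)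
  | setReal (a : ℕ) (i j : NatExpr) (x : RealExpr)
  | seq (p r : Program)
  | ite (b : Test) (p r : Program)
  | loop (b : Test) (p : Program)

namespace NatExpr

def eval (m : Memory) : NatExpr → ℕ
  | lit c => c
  | read a i j => m.nat a (i.eval m) (j.eval m)
  | add e f => e.eval m + f.eval m
  | sub e f => e.eval m - f.eval m

def cost : NatExpr → ℕ
  | lit _ => 1
  | read _ i j => i.cost + j.cost + 1
  | add e f => e.cost + f.cost + 1
  | sub e f => e.cost + f.cost + 1

end NatExpr

namespace RealExpr

noncomputable def eval (m : Memory) : RealExpr → ℝ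
  | ofNat e => (e.eval m : ℝ)
  | read a i j => m.real a (i.eval m) (j.eval m)
  | add x y => x.eval m + y.eval m
  | sub x y => x.eval m - y.eval m
  | mul x y => x.eval m * y.eval m
  | div x y => x.eval m / y.eval m

def cost : RealExpr → ℕ
  | ofNat e => e.cost + 1
  | read _ i j => i.cost + j.cost + 1
  | add x y => x.cost + y.cost + 1
  | sub x y => x.cost + y.cost + 1
  | mul x y => x.cost + y.cost + 1
  | div x y => x.cost + y.cost + 1

end RealExpr

namespace Test

def Holds (m : Memory) : Test → Prop
  | natEq e f => e.eval m = f.eval m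
  | natLt e f => e.eval m < f.eval m
  | realLt x y => x.eval m < y.eval m
  | not b => ¬ b.Holds m
  | and b c => b.Holds m ∧ c.Holds m

def cost : Test → ℕ
  | natEq e f => e.cost + f.cost + 1
  | natLt e f => e.cost + f.cost + 1
  | realLt x y => x.cost + y.cost + 1
  | not b => b.cost + 1
  | and b c => b.cost + c.cost + 1

end Test

namespace Memory

/-- Overwrite entry `(i, j)` of the natural-number array `a`. -/
def setNat (m : Memory) (a i j e : ℕ) : Memory :=
  { m with nat := fun a' i' j' => if a' = a ∧ i' = i ∧ j' = j then e else m.nat a' i' j' }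

/-- Overwrite entry `(i, j)` of the real array `a`. -/
noncomputable def setReal (m : Memory) (a i j : ℕ) (x : ℝ) : Memory :=
  { m with real := fun a' i' j' => if a' = a ∧ i' = i ∧ j' = j then x else m.real a' i' j' }

end Memory

/-- `Runs p m m' t`: started in memory `m`, the program `p` halts in memory `m'` after `t` steps. -/
inductive Runs : Program → Memory → Memory → ℕ → Prop
  | skip (m : Memory) : Runs .skip m m 1
  | setNat (m : Memory) (a : ℕ) (i j e : NatExpr) :
      Runs (.setNat a i j e) m (m.setNat a (i.eval m) (j.eval m) (e.eval m))
        (i.cost + j.cost + e.cost + 1)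
  | setReal (m : Memory) (a : ℕ) (i j : NatExpr) (x : RealExpr) :
      Runs (.setReal a i j x) m (m.setReal a (i.eval m) (j.eval m) (x.eval m))
        (i.cost + j.cost + x.cost + 1)
  | seq {p r : Program} {m m' m'' : Memory} {t t' : ℕ} :
      Runs p m m' t → Runs r m' m'' t' → Runs (.seq p r) m m'' (t + t')
  | ite_true {b : Test} {p r : Program} {m m' : Memory} {t : ℕ} :
      b.Holds m → Runs p m m' t → Runs (.ite b p r) m m' (b.cost + t + 1)
  | ite_false {b : Test} {p r : Program} {m m' : Memory} {t : ℕ} :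
      ¬ b.Holds m → Runs r m m' t → Runs (.ite b p r) m m' (b.cost + t + 1)
  | loop_done {b : Test} {p : Program} {m : Memory} :
      ¬ b.Holds m → Runs (.loop b p) m m (b.cost + 1)
  | loop_step {b : Test} {p : Program} {m m' m'' : Memory} {t t' : ℕ} :
      b.Holds m → Runs p m m' t → Runs (.loop b p) m' m'' t' →
        Runs (.loop b p) m m'' (b.cost + t + t' + 1)

/-! ### Encoding of inputs and outputs -/

open Classical in
/-- Input `(G, α, q)`: entry `(0, 0)` of natural-number array `0` holds `n`, natural-number array
`1` holds the adjacency matrix, entry `(0, 0)` of real array `0` holds `α`, column `0` of real array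
`1` holds `q`. Everything else is `0`. -/
noncomputable def input {n : ℕ} (G : SimpleGraph (Fin n)) (α : ℝ) (q : Fin n → ℝ) : Memory where
  nat a i j :=
    if a = 0 ∧ i = 0 ∧ j = 0 then n
    else if a = 1 ∧ ∃ (hi : i < n) (hj : j < n), G.Adj ⟨i, hi⟩ ⟨j, hj⟩ then 1
    else 0
  real a i j :=
    if a = 0 ∧ i = 0 ∧ j = 0 then α
    else if h : a = 1 ∧ i < n ∧ j = 0 then q ⟨i, h.2.1⟩
    else 0

/-- Natural-number array `2` holds the answer: the yes/no answer in entry `(0, 0)`. -/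
def Memory.verdict (m : Memory) : ℕ := m.nat 2 0 0

/-- The memory reports the player `v` with strategy `s`: entry `(0, 1)` of natural-number array `2`
is `v`; entry `(0, 2)` is `0` if no edge is added and `u + 1` if the edge to `u` is
added; row `0` of natural-number array `3` is the `0/1` indicator vector of the retained
neighbours. -/
def Memory.Reports {n : ℕ} (m : Memory) (v : Fin n) (s : Strategy (Fin n)) : Prop :=
  m.nat 2 0 1 = v ∧
  m.nat 2 0 2 = s.add.elim 0 (fun u => (u : ℕ) + 1) ∧
  ∀ w : Fin n, m.nat 3 0 w = if w ∈ s.keep then 1 else 0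

end PageRankGame

/-! Fix a player `v` and let `R` be its neighbourhood after a move, so that the new graph is `graft
G v R`. Stop the walk whenever it reaches `v`. The new PageRank `x` then splits as `x = a + (x_v /
|R|) b`, where `a` (`fromJump`) is the mass that starts from the random jumps and `b` (`fromStart`)
is the mass sent out of `v` along the edges to `R` (`pageRank_graft`). At `v` one has `b_v < |R|`,
hence `x_v > T` if and only if `0 < |R| (a_v - T) + T b_v`. At a new neighbour `u` one has `b_u >
0`, so the demand that `u` gains reads `x_v > |R| (π_u - a_u) / b_u`. Both requirements on an
admissible improving move are therefore one inequality `x_v > T`, with `T` the larger of two numbers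
(`threshold`).

The stopped walk cannot pass between components of `G - v`. Hence `a_v - α q_v` and `b_v` are sums
of contributions of the components, each depending only on the part of `R` in that component, and
`a_u`, `b_u` depend only on the part in the component of `u` (`sol_killed_graft`). Once `u`, the
retained neighbours `S` in the component of `u`, and the number `d = |R|` are fixed, `T` is a
constant and the criterion becomes positivity of a sum over components (`isImproving_iff`).
Maximising that sum over all choices with exactly `d` edges is a knapsack problem, solved by dynamic
programming over components and sizes (`choice_ends`). Every strategy arises from such a choice and
conversely (`choice_strategy`, `exists_choice`).

A component offers few options: neighbours of `v` that are connected off `v` lie in a common block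
with `v`, because adding an ear keeps a set nonseparable (`IsNonseparable.union_path`). So there are
at most `k` of them, and at most `2 ^ k` subsets (`card_le_param`).

The values `a` and `b` come from Gaussian elimination without pivoting; the matrices have
nonnegative entries and row sums below one, and elimination preserves this, so no pivot vanishes
(`elims_invariant`). The tables for all players take `n · n · 2 ^ k` systems of cost `n ^ 3`. The
search takes `n` players, `n` vertices `u`, `2 ^ k` sets `S`, `n` sizes `d`, and a dynamic program
of `n · n · 2 ^ k` steps, in all `2 ^ (2 k) n ^ 5`.

Correctness and running time are proved together through `Ends`, a total-correctness judgement with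
a time bound; loops are handled by invariants (`Ends.forTo_mul`), and what a piece of code leaves
untouched is read off from its syntax (`Runs.same`). -/

namespace PageRankGame

/-! ### Running programs -/

namespace Program

/-- Whether the program assigns to natural-number array `a`. -/
def writesNat (a : ℕ) : Program → Bool
  | skip => false
  | setNat b _ _ _ => b == a
  | setReal _ _ _ _ => false
  | seq p r => p.writesNat a || r.writesNat a
  | ite _ p r => p.writesNat a || r.writesNat a
  | loop _ p => p.writesNat a

/-- Whether the program assigns to real array `a`. -/
def writesReal (a : ℕ) : Program → Bool
  | skip => false
  | setNat _ _ _ _ => false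
  | setReal b _ _ _ => b == a
  | seq p r => p.writesReal a || r.writesReal a
  | ite _ p r => p.writesReal a || r.writesReal a
  | loop _ p => p.writesReal a

/-- Whether the program is free of loops. -/
def flat : Program → Bool
  | skip => true
  | setNat _ _ _ _ => true
  | setReal _ _ _ _ => true
  | seq p r => p.flat && r.flat
  | ite _ p r => p.flat && r.flat
  | loop _ _ => false

open Classical in
/-- The effect of a program without loops. -/
noncomputable def exec : Program → Memory → Memory
  | skip, m => m
  | setNat a i j e, m => m.setNat a (i.eval m) (j.eval m) (e.eval m)
  | setReal a i j x, m => m.setReal a (i.eval m) (j.eval m) (x.eval m)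
  | seq p r, m => r.exec (p.exec m)
  | ite b p r, m => if b.Holds m then p.exec m else r.exec m
  | loop _ _, m => m

/-- A bound for the running time of a program without loops. -/
def span : Program → ℕ
  | skip => 1
  | setNat _ i j e => i.cost + j.cost + e.cost + 1
  | setReal _ i j x => i.cost + j.cost + x.cost + 1
  | seq p r => p.span + r.span
  | ite b p r => b.cost + (p.span + r.span) + 1
  | loop _ _ => 0

end Program

/-- `m` and `m'` agree on all arrays to which `p` does not assign. -/
structure Same (p : Program) (m m' : Memory) : Prop where
  nat : ∀ a, p.writesNat a = false → m'.nat a = m.nat a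
  real : ∀ a, p.writesReal a = false → m'.real a = m.real a

theorem Same.refl (p : Program) (m : Memory) : Same p m m := ⟨fun _ _ => rfl, fun _ _ => rfl⟩

theorem Same.trans {p r s : Program} {m m' m'' : Memory} (h : Same p m m') (h' : Same r m' m'')
    (hn : ∀ a, s.writesNat a = false → p.writesNat a = false ∧ r.writesNat a = false)
    (hr : ∀ a, s.writesReal a = false → p.writesReal a = false ∧ r.writesReal a = false) :
    Same s m m'' :=
  ⟨fun a ha => (h'.nat a (hn a ha).2).trans (h.nat a (hn a ha).1),
    fun a ha => (h'.real a (hr a ha).2).trans (h.real a (hr a ha).1)⟩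

/-- The frame rule. On a concrete program `writesNat` and `writesReal` compute, so its side
conditions are proved by `rfl`, and specifications need to mention only the arrays that change. -/
theorem Runs.same {p : Program} {m m' : Memory} {t : ℕ} (h : Runs p m m' t) : Same p m m' := by
  induction h with
  | skip m => exact Same.refl _ _
  | setNat m a i j e =>
    refine ⟨fun b hb => ?_, fun _ _ => rfl⟩
    have : b ≠ a := by rintro rfl; simp [Program.writesNat] at hb
    funext x y
    simp [Memory.setNat, this]
  | setReal m a i j e =>
    refine ⟨fun _ _ => rfl, fun b hb => ?_⟩
    have : b ≠ a := by rintro rfl; simp [Program.writesReal] at hb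
    funext x y
    simp [Memory.setReal, this]
  | seq _ _ h1 h2 =>
    exact h1.trans h2 (by simp [Program.writesNat]) (by simp [Program.writesReal])
  | ite_true _ _ h1 =>
    exact h1.trans (Same.refl .skip _) (by simp +contextual [Program.writesNat])
      (by simp +contextual [Program.writesReal])
  | ite_false _ _ h1 =>
    exact h1.trans (Same.refl .skip _) (by simp +contextual [Program.writesNat])
      (by simp +contextual [Program.writesReal])
  | loop_done _ => exact Same.refl _ _
  | loop_step _ _ _ h1 h2 =>
    exact h1.trans h2 (by simp [Program.writesNat]) (by simp [Program.writesReal])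

/-- Started in `m`, the program `p` halts within `T` steps in a memory satisfying `Q`. -/
def Ends (p : Program) (m : Memory) (T : ℕ) (Q : Memory → Prop) : Prop :=
  ∃ m' t, Runs p m m' t ∧ t ≤ T ∧ Q m'

namespace Ends

variable {p r : Program} {m : Memory} {T T' : ℕ} {Q Q' : Memory → Prop}

theorem mono (h : Ends p m T Q) (hT : T ≤ T') (hQ : ∀ m', Same p m m' → Q m' → Q' m') :
    Ends p m T' Q' :=
  let ⟨m', t, h1, h2, h3⟩ := h
  ⟨m', t, h1, h2.trans hT, hQ m' h1.same h3⟩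

theorem le (h : Ends p m T Q) (hT : T ≤ T') : Ends p m T' Q := h.mono hT fun _ _ => id

theorem seq (h : Ends p m T Q) (h' : ∀ m', Same p m m' → Q m' → Ends r m' T' Q') :
    Ends (.seq p r) m (T + T') Q' := by
  obtain ⟨m1, t1, h1, h2, h3⟩ := h
  obtain ⟨m2, t2, h4, h5, h6⟩ := h' m1 h1.same h3
  exact ⟨m2, _, .seq h1 h4, by omega, h6⟩

theorem ite {b : Test} (h1 : b.Holds m → Ends p m T Q) (h2 : ¬ b.Holds m → Ends r m T Q) :
    Ends (.ite b p r) m (b.cost + T + 1) Q := by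
  by_cases hb : b.Holds m
  · obtain ⟨m1, t1, h3, h4, h5⟩ := h1 hb
    exact ⟨m1, _, .ite_true hb h3, by omega, h5⟩
  · obtain ⟨m1, t1, h3, h4, h5⟩ := h2 hb
    exact ⟨m1, _, .ite_false hb h3, by omega, h5⟩

theorem skip (h : Q m) : Ends .skip m 1 Q := ⟨m, 1, .skip m, le_rfl, h⟩

/-- Loop-free code is verified by evaluating `exec` with `simp`. Both branches of a conditional are
charged in `span`, which makes the time bound a numeral independent of the memory. -/
theorem of_flat {p : Program} {m : Memory} {Q : Memory → Prop} (hp : p.flat = true)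
    (h : Q (p.exec m)) : Ends p m p.span Q := by
  suffices ∃ t, Runs p m (p.exec m) t ∧ t ≤ p.span by
    obtain ⟨t, h1, h2⟩ := this
    exact ⟨_, t, h1, h2, h⟩
  clear h
  induction p generalizing m with
  | skip => exact ⟨1, .skip m, le_rfl⟩
  | setNat a i j e => exact ⟨_, .setNat m a i j e, le_rfl⟩
  | setReal a i j x => exact ⟨_, .setReal m a i j x, le_rfl⟩
  | seq p r ihp ihr =>
    simp only [Program.flat, Bool.and_eq_true] at hp
    obtain ⟨t1, h1, h2⟩ := ihp hp.1 (m := m)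
    obtain ⟨t2, h3, h4⟩ := ihr hp.2 (m := p.exec m)
    exact ⟨_, .seq h1 h3, Nat.add_le_add h2 h4⟩
  | ite b p r ihp ihr =>
    simp only [Program.flat, Bool.and_eq_true] at hp
    by_cases hb : b.Holds m
    · obtain ⟨t1, h1, h2⟩ := ihp hp.1 (m := m)
      refine ⟨_, by simpa [Program.exec, hb] using Runs.ite_true hb h1, ?_⟩
      simp only [Program.span]; omega
    · obtain ⟨t1, h1, h2⟩ := ihr hp.2 (m := m)
      refine ⟨_, by simpa [Program.exec, hb] using Runs.ite_false hb h1, ?_⟩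
      simp only [Program.span]; omega
  | loop b p _ => simp [Program.flat] at hp

end Ends

/-- The scalar variable `x`, stored in entry `(0, 0)` of natural-number array `x`. -/
abbrev NatExpr.var (x : ℕ) : NatExpr := .read x (.lit 0) (.lit 0)

/-- The entry `i` of row `0` of natural-number array `a`. -/
abbrev NatExpr.vec (a : ℕ) (i : NatExpr) : NatExpr := .read a (.lit 0) i

/-- Assignment to the scalar variable `x`. -/
abbrev Program.setVar (x : ℕ) (e : NatExpr) : Program := .setNat x (.lit 0) (.lit 0) e

/-- Assignment to the real scalar variable `x`. -/
abbrev Program.setRVar (x : ℕ) (e : RealExpr) : Program := .setReal x (.lit 0) (.lit 0) e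

/-- The real scalar variable `x`. -/
abbrev RealExpr.var (x : ℕ) : RealExpr := .read x (.lit 0) (.lit 0)

/-- Run `body` for `x = 0, …, e - 1`. -/
def Program.forTo (x : ℕ) (e : NatExpr) (body : Program) : Program :=
  .seq (.setVar x (.lit 0))
    (.loop (.natLt (.var x) e) (.seq body (.setVar x (.add (.var x) (.lit 1)))))

/-- The invariant is indexed by the counter and must not depend on the cell that stores it (`hI`),
so that incrementing the counter preserves it. The bound `e` is reevaluated in each round; `he` says
that the loop cannot change it. -/
theorem Ends.forTo {x : ℕ} {e : NatExpr} {body : Program} {m₀ : Memory} {N T : ℕ}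
    (I : ℕ → Memory → Prop)
    (he : ∀ m, Same (.forTo x e body) m₀ m → e.eval m = N)
    (hx : body.writesNat x = false)
    (hI : ∀ i m k, I i m → I i (m.setNat x 0 0 k))
    (h0 : I 0 m₀)
    (hs : ∀ i < N, ∀ m, Same (.forTo x e body) m₀ m → m.nat x 0 0 = i → I i m →
      Ends body m T (I (i + 1))) :
    Ends (.forTo x e body) m₀ ((N + 1) * (T + (e.cost + 13))) (I N) := by
  have set_same : ∀ m k, Same (.forTo x e body) m (m.setNat x 0 0 k) := fun m k => by
    refine ⟨fun b hb => ?_, fun _ _ => rfl⟩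
    have : b ≠ x := by rintro rfl; simp [Program.writesNat, Program.forTo] at hb
    funext x y
    simp [Memory.setNat, this]
  have tr : ∀ {m m' m''}, Same (.forTo x e body) m m' → Same (.forTo x e body) m' m'' →
      Same (.forTo x e body) m m'' := fun h1 h2 => h1.trans h2 (by simp) (by simp)
  have key : ∀ k i, i + k = N → ∀ m, Same (.forTo x e body) m₀ m → m.nat x 0 0 = i → I i m →
      Ends (.loop (.natLt (.var x) e) (.seq body (.setVar x (.add (.var x) (.lit 1))))) m
        -- A round costs the body, `e.cost + 4` for the test, `8` for the increment and `1` for the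
        -- loop; the final failing test costs `e.cost + 5`.
        (k * (T + (e.cost + 13)) + (e.cost + 5)) (I N) := by
    intro k
    induction k with
    | zero =>
      intro i hi m hm hxi hIi
      obtain rfl : i = N := by omega
      refine ⟨m, _, .loop_done ?_, ?_, hIi⟩
      · simp [Test.Holds, NatExpr.eval, hxi, he m hm]
      · simp [Test.cost, NatExpr.cost]; omega
    | succ k ih =>
      intro i hi m hm hxi hIi
      obtain ⟨m1, t1, h1, h2, h3⟩ := hs i (by omega) m hm hxi hIi
      have hm1 : Same (.forTo x e body) m m1 :=
        h1.same.trans (Same.refl .skip _)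
          (by simp +contextual [Program.writesNat, Program.forTo])
          (by simp +contextual [Program.writesReal, Program.forTo])
      have hx1 : m1.nat x 0 0 = i := by rw [h1.same.nat x hx, hxi]
      obtain ⟨m2, t2, h4, h5, h6⟩ := ih (i + 1) (by omega) (m1.setNat x 0 0 (i + 1))
        (tr (tr hm hm1) (set_same _ _)) (by simp [Memory.setNat]) (hI _ _ _ h3)
      have hset := Runs.setNat m1 x (.lit 0) (.lit 0) (.add (.var x) (.lit 1))
      simp only [NatExpr.eval, hx1] at hset
      refine ⟨m2, _, .loop_step ?_ (.seq h1 hset) h4, ?_, h6⟩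
      · simp only [Test.Holds, NatExpr.eval, hxi, he m hm]; omega
      · simp only [Test.cost, NatExpr.cost]
        rw [add_mul]; omega
  have hset := Runs.setNat m₀ x (.lit 0) (.lit 0) (.lit 0)
  simp only [NatExpr.eval] at hset
  obtain ⟨m2, t2, h4, h5, h6⟩ := key N 0 (by omega) (m₀.setNat x 0 0 0) (set_same _ _)
    (by simp [Memory.setNat]) (hI _ _ _ h0)
  refine ⟨m2, _, .seq hset h4, ?_, h6⟩
  simp only [NatExpr.cost]
  rw [add_mul]; omega

namespace Ends

variable {p r body : Program} {m m₀ : Memory} {T N B C F c c' f x : ℕ} {e : NatExpr} {b : Test}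
  {Q Q' : Memory → Prop}

/-! The rules with running times in product form. -/

theorem of_flat_mul (hp : p.flat = true) (hc : p.span ≤ c) (hf : 1 ≤ f) (h : Q (p.exec m)) :
    Ends p m (c * f) Q :=
  (of_flat hp h).le (hc.trans (Nat.le_mul_of_pos_right _ hf))

theorem seq_mul (hC : c + c' ≤ C) (h : Ends p m (c * f) Q)
    (h' : ∀ m', Same p m m' → Q m' → Ends r m' (c' * f) Q') : Ends (.seq p r) m (C * f) Q' :=
  (h.seq h').le (by rw [← add_mul]; exact Nat.mul_le_mul_right f hC)

theorem ite_mul (hC : c + (b.cost + 1) ≤ C) (hf : 1 ≤ f) (h1 : b.Holds m → Ends p m (c * f) Q)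
    (h2 : ¬ b.Holds m → Ends r m (c * f) Q) : Ends (.ite b p r) m (C * f) Q :=
  (ite h1 h2).le <|
    calc b.cost + c * f + 1 ≤ c * f + (b.cost + 1) * f := by nlinarith
      _ ≤ C * f := by rw [← add_mul]; exact Nat.mul_le_mul_right f hC

theorem skip_mul (hc : 1 ≤ c) (hf : 1 ≤ f) (h : Q m) : Ends .skip m (c * f) Q :=
  (skip h).le (Nat.mul_pos hc hf)

/-- Keeping a numeral `c` apart from a symbolic factor `f` lets `decide` check all constants. The
factor `2` pays for `N + 1 ≤ 2 * B`, and `B` is a bound for the number of rounds that may be more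
convenient than `N` itself. -/
theorem forTo_mul (I : ℕ → Memory → Prop) (hC : 2 * (c + (e.cost + 13)) ≤ C) (hB : N ≤ B)
    (hB1 : 1 ≤ B) (hf : 1 ≤ f) (hF : B * f = F)
    (he : ∀ m, Same (.forTo x e body) m₀ m → e.eval m = N)
    (hx : body.writesNat x = false)
    (hI : ∀ i m k, I i m → I i (m.setNat x 0 0 k))
    (h0 : I 0 m₀)
    (hs : ∀ i < N, ∀ m, Same (.forTo x e body) m₀ m → m.nat x 0 0 = i → I i m →
      Ends body m (c * f) (I (i + 1))) :
    Ends (.forTo x e body) m₀ (C * F) (I N) := by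
  subst hF
  refine (Ends.forTo I he hx hI h0 hs).le ?_
  calc (N + 1) * (c * f + (e.cost + 13)) ≤ (2 * B) * (c * f + (e.cost + 13) * f) := by
        gcongr
        · omega
        · exact Nat.le_mul_of_pos_right _ hf
    _ = 2 * (c + (e.cost + 13)) * (B * f) := by ring
    _ ≤ _ := Nat.mul_le_mul_right _ hC

end Ends

/-! ### Linear systems with substochastic matrices -/

section LinearSystem

variable {ι : Type*} [Fintype ι]

/-- `K` is nonnegative with row sums at most `ρ`. -/
structure IsSub (ρ : ℝ) (K : ι → ι → ℝ) : Prop where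
  nonneg : ∀ i j, 0 ≤ K i j
  sum_le : ∀ i, ∑ j, K i j ≤ ρ

/-- `x` solves `x = b + x K`. -/
def IsFix (K : ι → ι → ℝ) (b x : ι → ℝ) : Prop := ∀ j, x j = b j + ∑ i, x i * K i j

/-- Summing over `j` gives `∑ e ≤ ρ ∑ e` with `ρ < 1`. Uniqueness and nonnegativity of solutions
follow by applying this to `|x - y|` and to `|x| - x`. -/
theorem IsSub.eq_zero_of_le {ρ : ℝ} {K : ι → ι → ℝ} (hK : IsSub ρ K) (hρ : ρ < 1) {e : ι → ℝ}
    (he : ∀ i, 0 ≤ e i) (h : ∀ j, e j ≤ ∑ i, e i * K i j) : ∀ i, e i = 0 := by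
  have h1 : ∑ j, e j ≤ ρ * ∑ i, e i :=
    calc ∑ j, e j ≤ ∑ j, ∑ i, e i * K i j := Finset.sum_le_sum fun j _ => h j
      _ = ∑ i, e i * ∑ j, K i j := by rw [Finset.sum_comm]; simp [Finset.mul_sum]
      _ ≤ ∑ i, e i * ρ := Finset.sum_le_sum fun i _ => mul_le_mul_of_nonneg_left (hK.sum_le i) (he i)
      _ = ρ * ∑ i, e i := by rw [← Finset.sum_mul, mul_comm]
  have h2 : 0 ≤ ∑ j, e j := Finset.sum_nonneg fun i _ => he i
  have h3 : ∑ j, e j = 0 := by nlinarith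
  intro i
  exact (Finset.sum_eq_zero_iff_of_nonneg fun i _ => he i).1 h3 i (Finset.mem_univ i)

theorem IsFix.unique {ρ : ℝ} {K : ι → ι → ℝ} (hK : IsSub ρ K) (hρ : ρ < 1) {b x y : ι → ℝ}
    (hx : IsFix K b x) (hy : IsFix K b y) : x = y := by
  have := hK.eq_zero_of_le hρ (e := fun i => |x i - y i|) (fun i => abs_nonneg _) fun j => by
    have : x j - y j = ∑ i, (x i - y i) * K i j := by
      rw [hx j, hy j]; simp [sub_mul]
    rw [this]
    refine (Finset.abs_sum_le_sum_abs _ _).trans_eq (Finset.sum_congr rfl fun i _ => ?_)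
    rw [abs_mul, abs_of_nonneg (hK.nonneg i j)]
  funext i
  have := this i
  simp only [abs_eq_zero] at this
  linarith

/-- Uniqueness makes `x ↦ x - x K` injective, hence surjective in finite dimension. -/
theorem IsSub.exists_isFix {ρ : ℝ} {K : ι → ι → ℝ} (hK : IsSub ρ K) (hρ : ρ < 1) (b : ι → ℝ) :
    ∃ x, IsFix K b x := by
  let L : (ι → ℝ) →ₗ[ℝ] (ι → ℝ) :=
    { toFun := fun x j => x j - ∑ i, x i * K i j
      map_add' := fun x y => by
        funext j
        simp only [Pi.add_apply, add_mul, Finset.sum_add_distrib]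
        ring
      map_smul' := fun c x => by
        funext j
        simp only [Pi.smul_apply, smul_eq_mul, RingHom.id_apply, mul_assoc, ← Finset.mul_sum]
        ring }
  have hL : ∀ x b, L x = b ↔ IsFix K b x := fun x b => by
    refine funext_iff.trans (forall_congr' fun j => ?_)
    simp only [L, LinearMap.coe_mk, AddHom.coe_mk]
    exact sub_eq_iff_eq_add
  have Linj : Function.Injective L := fun x y h =>
    IsFix.unique hK hρ ((hL x _).1 rfl) ((hL y _).1 h.symm)
  obtain ⟨x, hx⟩ := LinearMap.injective_iff_surjective.1 Linj b
  exact ⟨x, (hL x b).1 hx⟩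

theorem IsFix.nonneg {ρ : ℝ} {K : ι → ι → ℝ} (hK : IsSub ρ K) (hρ : ρ < 1) {b x : ι → ℝ}
    (hx : IsFix K b x) (hb : ∀ i, 0 ≤ b i) (i : ι) : 0 ≤ x i := by
  have := hK.eq_zero_of_le hρ (e := fun i => |x i| - x i)
    (fun i => sub_nonneg.2 (le_abs_self _)) fun j => by
    have h1 : |x j| ≤ b j + ∑ i, |x i| * K i j := by
      rw [hx j]
      refine (abs_add_le _ _).trans (add_le_add (abs_of_nonneg (hb j)).le ?_)
      refine (Finset.abs_sum_le_sum_abs _ _).trans_eq (Finset.sum_congr rfl fun i _ => ?_)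
      rw [abs_mul, abs_of_nonneg (hK.nonneg i j)]
    have h2 := hx j
    simp only [sub_mul, Finset.sum_sub_distrib]
    linarith
  have h2 := abs_nonneg (x i)
  linarith [this i]

/-- The solution of `x = b + x K`. -/
noncomputable def sol (K : ι → ι → ℝ) (b : ι → ℝ) : ι → ℝ := Classical.epsilon (IsFix K b)

theorem IsSub.isFix_sol {ρ : ℝ} {K : ι → ι → ℝ} (hK : IsSub ρ K) (hρ : ρ < 1) (b : ι → ℝ) :
    IsFix K b (sol K b) := Classical.epsilon_spec (hK.exists_isFix hρ b)

theorem IsFix.eq_sol {ρ : ℝ} {K : ι → ι → ℝ} (hK : IsSub ρ K) (hρ : ρ < 1) {b x : ι → ℝ}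
    (hx : IsFix K b x) : x = sol K b := hx.unique hK hρ (hK.isFix_sol hρ b)

end LinearSystem

/-! ### Elimination -/

/-- Elimination of the unknown `p` from all rows below row `p`. -/
noncomputable def elim (p : ℕ) (M : ℕ → ℕ → ℝ) : ℕ → ℕ → ℝ :=
  fun i j => if p < i then M i j + M i p * M p j / (1 - M p p) else M i j

/-- Elimination of the unknowns `0, …, p - 1`. -/
noncomputable def elims (M : ℕ → ℕ → ℝ) : ℕ → ℕ → ℕ → ℝ
  | 0 => M
  | p + 1 => elim p (elims M p)

/-- Equation `p` expresses `x p` through the later unknowns, and substituting it changes the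
coefficients of those unknowns (the rows below `p`) and the right-hand side (row `s`). It is
substituted into every equation, including those with `j < p`, so no back substitution remains.
Nonnegativity and row sums below one survive, which keeps the pivots `1 - M p p` positive. -/
theorem elims_invariant {n : ℕ} {M : ℕ → ℕ → ℝ} (h0 : ∀ i < n, ∀ j < n, 0 ≤ M i j)
    (h1 : ∀ i < n, ∑ j ∈ Finset.range n, M i j < 1) {x : ℕ → ℝ} {s : ℕ} (hs : n ≤ s)
    (hx : ∀ j < n, x j = M s j + ∑ i ∈ Finset.range n, x i * M i j) (p : ℕ) (hp : p ≤ n) :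
    (∀ i < n, ∀ j < n, 0 ≤ elims M p i j) ∧
      (∀ i < n, p ≤ i → ∑ j ∈ Finset.Ico p n, elims M p i j < 1) ∧
      ∀ j < n, x j = elims M p s j + ∑ i ∈ Finset.Ico p n, x i * elims M p i j := by
  induction p with
  | zero =>
    refine ⟨h0, fun i hi _ => ?_, fun j hj => ?_⟩
    · simpa [elims] using h1 i hi
    · simpa [elims] using hx j hj
  | succ p ih =>
    obtain ⟨a0, a1, a2⟩ := ih (by omega)
    set E := elims M p with hE
    have hpn : p < n := by omega
    have hIco : ∀ f : ℕ → ℝ, ∑ j ∈ Finset.Ico p n, f j = f p + ∑ j ∈ Finset.Ico (p + 1) n, f j :=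
      fun f => Finset.sum_eq_sum_Ico_succ_bot hpn f
    have hrow := a1 p hpn le_rfl
    rw [hIco] at hrow
    have hrest : 0 ≤ ∑ j ∈ Finset.Ico (p + 1) n, E p j :=
      Finset.sum_nonneg fun j hj => a0 p hpn j (Finset.mem_Ico.1 hj).2
    have hpos : 0 < 1 - E p p := by linarith
    refine ⟨fun i hi j hj => ?_, fun i hi hpi => ?_, fun j hj => ?_⟩
    · simp only [elims, elim, ← hE]
      split_ifs
      · have := a0 i hi j hj
        have := a0 i hi p hpn
        have := a0 p hpn j hj
        positivity
      · exact a0 i hi j hj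
    · have h2 := a1 i hi (by omega)
      rw [hIco] at h2
      have h3 : ∑ j ∈ Finset.Ico (p + 1) n, elims M (p + 1) i j =
          ∑ j ∈ Finset.Ico (p + 1) n, E i j +
            E i p * ((∑ j ∈ Finset.Ico (p + 1) n, E p j) / (1 - E p p)) := by
        rw [Finset.sum_div, Finset.mul_sum, ← Finset.sum_add_distrib]
        refine Finset.sum_congr rfl fun j _ => ?_
        -- The mass in column `p` is redistributed over the later columns with total weight at most
        -- one, by `h4`, so the row sum does not grow.
        simp only [elims, elim, ← hE, if_pos (show p < i by omega)]
        ring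
      have h4 : (∑ j ∈ Finset.Ico (p + 1) n, E p j) / (1 - E p p) ≤ 1 := by
        rw [div_le_one hpos]; linarith
      have h5 := mul_le_mul_of_nonneg_left h4 (a0 i hi p hpn)
      rw [h3]; linarith
    · have hxp := a2 p hpn
      rw [hIco] at hxp
      have hxj := a2 j hj
      rw [hIco] at hxj
      have hsum : ∑ i ∈ Finset.Ico (p + 1) n, x i * elims M (p + 1) i j =
          ∑ i ∈ Finset.Ico (p + 1) n, x i * E i j +
            (∑ i ∈ Finset.Ico (p + 1) n, x i * E i p) * (E p j / (1 - E p p)) := by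
        rw [Finset.sum_mul, ← Finset.sum_add_distrib]
        refine Finset.sum_congr rfl fun i hi => ?_
        simp only [elims, elim, ← hE, if_pos (show p < i from (Finset.mem_Ico.1 hi).1)]
        ring
      have hsj : elims M (p + 1) s j = E s j + E s p * (E p j / (1 - E p p)) := by
        simp only [elims, elim, ← hE, if_pos (show p < s by omega)]
        ring
      rw [hsum, hsj]
      have hxp' : E s p + ∑ i ∈ Finset.Ico (p + 1) n, x i * E i p = x p * (1 - E p p) := by
        linarith
      have : E s p * (E p j / (1 - E p p)) +
          (∑ i ∈ Finset.Ico (p + 1) n, x i * E i p) * (E p j / (1 - E p p)) = x p * E p j := by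
        rw [← add_mul, hxp']
        field_simp
      linarith

/-- After eliminating all unknowns the right-hand side has become the solution. -/
theorem elims_eq_sol {n : ℕ} {ρ : ℝ} {K : Fin n → Fin n → ℝ} (hK : IsSub ρ K) (hρ : ρ < 1)
    {b : Fin n → ℝ} {M : ℕ → ℕ → ℝ} (hM : ∀ i j : Fin n, M i j = K i j) {s : ℕ} (hs : n ≤ s)
    (hb : ∀ j : Fin n, M s j = b j) (j : Fin n) : elims M n s j = sol K b j := by
  have hsol := hK.isFix_sol hρ b
  have key := (elims_invariant (n := n) (M := M)
    (x := fun i => if h : i < n then sol K b ⟨i, h⟩ else 0) (s := s)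
    (fun i hi j hj => by simpa using (hM ⟨i, hi⟩ ⟨j, hj⟩) ▸ hK.nonneg _ _)
    (fun i hi => by
      rw [Finset.sum_range]
      refine lt_of_le_of_lt ?_ hρ
      simpa [← hM] using hK.sum_le ⟨i, hi⟩) hs
    (fun j hj => by
      rw [Finset.sum_range]
      have := hsol ⟨j, hj⟩
      simpa [hj, ← hM, ← hb] using this) n le_rfl).2.2 j j.2
  simpa using key.symm

/-! ### Replacing the neighbourhood of a vertex -/

section Graft

variable {n : ℕ}

/-- The graph obtained from `G` by changing the neighbourhood of `v` to `R`. For `v = n` this is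
`G` itself. -/
def graft (G : SimpleGraph (Fin n)) (v : ℕ) (R : Finset (Fin n)) : SimpleGraph (Fin n) where
  Adj i j := i ≠ j ∧ (if (i : ℕ) = v then j ∈ R else if (j : ℕ) = v then i ∈ R else G.Adj i j)
  symm := ⟨fun i j h => by
    refine ⟨h.1.symm, ?_⟩
    have h1 := h.1
    have h2 := h.2
    split_ifs at h2 ⊢ with h3 h4
    · exact absurd (Fin.ext (h4.trans h3.symm)) h1
    all_goals first | exact h2 | exact h2.symm⟩
  loopless := ⟨fun i h => h.1 rfl⟩

theorem graft_self (G : SimpleGraph (Fin n)) (R : Finset (Fin n)) : graft G n R = G := by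
  ext i j
  simp only [graft, if_neg i.2.ne, if_neg j.2.ne, and_iff_right_iff_imp]
  exact fun h => h.ne

theorem graft_adj_left {G : SimpleGraph (Fin n)} {v : Fin n} {R : Finset (Fin n)} (hR : v ∉ R)
    (j : Fin n) : (graft G v R).Adj v j ↔ j ∈ R := by
  simp only [graft, if_true, and_iff_right_iff_imp]
  rintro h rfl
  exact hR h

theorem graft_adj_right {G : SimpleGraph (Fin n)} {v : Fin n} {R : Finset (Fin n)} (hR : v ∉ R)
    (j : Fin n) : (graft G v R).Adj j v ↔ j ∈ R := by
  rw [SimpleGraph.adj_comm, graft_adj_left hR]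

theorem graft_adj_of_ne {G : SimpleGraph (Fin n)} {v : Fin n} {R : Finset (Fin n)} {i j : Fin n}
    (hi : i ≠ v) (hj : j ≠ v) : (graft G v R).Adj i j ↔ G.Adj i j := by
  simp only [graft, Fin.val_inj, if_neg hi, if_neg hj, and_iff_right_iff_imp]
  exact fun h => h.ne

theorem graft_degree {G : SimpleGraph (Fin n)} {v : Fin n} {R : Finset (Fin n)} (hR : v ∉ R)
    {_ : Fintype ((graft G v R).neighborSet v)} :
    (graft G v R).degree v = R.card := by
  rw [← SimpleGraph.card_neighborFinset_eq_degree]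
  congr 1
  ext j
  simp [graft_adj_left hR]

open Classical in
theorem walk_congr {V : Type*} [Fintype V] {G H : SimpleGraph V} {u : V}
    (h : ∀ w, G.Adj u w ↔ H.Adj u w) (w : V) : walk G u w = walk H u w := by
  have : G.degree u = H.degree u := by
    rw [← SimpleGraph.card_neighborFinset_eq_degree, ← SimpleGraph.card_neighborFinset_eq_degree]
    congr 1
    ext w
    simp [h w]
  unfold walk
  simp only [this, h w]

theorem walk_eq_zero {V : Type*} [Fintype V] {G : SimpleGraph V} {u w : V} (h : u ≠ w)
    (h' : ¬ G.Adj u w) : walk G u w = 0 := by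
  unfold walk
  simp [h, h']

/-- The damped walk, killed at `v`. -/
noncomputable def killed (H : SimpleGraph (Fin n)) (v : ℕ) (α : ℝ) (i j : Fin n) : ℝ :=
  if (i : ℕ) = v then 0 else (1 - α) * walk H i j

theorem isSub_killed (H : SimpleGraph (Fin n)) (v : ℕ) {α : ℝ} (h1 : α < 1) :
    IsSub (1 - α) (killed H v α) where
  nonneg i j := by
    unfold killed
    split_ifs
    · exact le_rfl
    · exact mul_nonneg (by linarith) (walk_nonneg H i j)
  sum_le i := by
    unfold killed
    split_ifs
    · simp; linarith
    · rw [← Finset.mul_sum, sum_walk, mul_one]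

theorem isStationary_iff_isFix (G : SimpleGraph (Fin n)) {α : ℝ} {q x : Fin n → ℝ}
    (hx : IsStationary G α q x) (j : Fin n) :
    x j = α * q j + ∑ i, x i * ((1 - α) * walk G i j) := by
  rw [← hx.2 j]
  simp only [transition, mul_add, Finset.sum_add_distrib]
  rw [← Finset.sum_mul, hx.1.2, one_mul]

theorem pageRank_isFix (G : SimpleGraph (Fin n)) {α : ℝ} (h0 : 0 < α) (h1 : α < 1)
    {q : Fin n → ℝ} (hq : IsDistribution q) (j : Fin n) : pageRank G α q j =
      α * q j + ∑ i, pageRank G α q i * ((1 - α) * walk G i j) :=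
  isStationary_iff_isFix G (pageRank_isStationary G h0 h1 hq) j

/-- The index `n` is no vertex, so nothing is killed; the program for a player thus also computes
the PageRank of the original graph. -/
theorem pageRank_eq_sol (G : SimpleGraph (Fin n)) {α : ℝ} (h0 : 0 < α) (h1 : α < 1)
    {q : Fin n → ℝ} (hq : IsDistribution q) :
    pageRank G α q = sol (killed G n α) fun j => α * q j := by
  refine IsFix.eq_sol (isSub_killed G n h1) (by linarith) fun j => ?_
  rw [pageRank_isFix G h0 h1 hq j]
  simp only [killed, (Fin.is_lt _).ne, if_false]

theorem sum_mul_killed (H : SimpleGraph (Fin n)) (v : Fin n) (α : ℝ) (x : Fin n → ℝ) (j : Fin n) :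
    ∑ i, x i * ((1 - α) * walk H i j) =
      x v * ((1 - α) * walk H v j) + ∑ i, x i * killed H v α i j := by
  rw [← Finset.add_sum_erase _ _ (Finset.mem_univ v), ← Finset.add_sum_erase (a := v) _
    (fun i => x i * killed H v α i j) (Finset.mem_univ v)]
  have : killed H v α v j = 0 := by simp [killed]
  rw [this, mul_zero, zero_add]
  congr 1
  refine Finset.sum_congr rfl fun i hi => ?_
  have : i ≠ v := (Finset.mem_erase.1 hi).1
  simp [killed, Fin.val_inj, this]

/-- Mass that starts from the distribution `α q`, until the first visit of `v`. -/
noncomputable def fromJump (G : SimpleGraph (Fin n)) (α : ℝ) (q : Fin n → ℝ) (v : ℕ)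
    (R : Finset (Fin n)) : Fin n → ℝ :=
  sol (killed (graft G v R) v α) fun j => α * q j

/-- Mass that starts from `v`, with one unit on each edge to `R`, until the first return to `v`. -/
noncomputable def fromStart (G : SimpleGraph (Fin n)) (α : ℝ) (v : ℕ)
    (R : Finset (Fin n)) : Fin n → ℝ :=
  sol (killed (graft G v R) v α) fun j => (1 - α) * if j ∈ R then 1 else 0

theorem fromJump_isFix (G : SimpleGraph (Fin n)) {α : ℝ} (h0 : 0 < α) (h1 : α < 1) (q : Fin n → ℝ)
    (v : ℕ) (R : Finset (Fin n)) :
    IsFix (killed (graft G v R) v α) (fun j => α * q j) (fromJump G α q v R) :=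
  (isSub_killed _ _ h1).isFix_sol (by linarith) _

theorem fromStart_isFix (G : SimpleGraph (Fin n)) {α : ℝ} (h0 : 0 < α) (h1 : α < 1)
    (v : ℕ) (R : Finset (Fin n)) :
    IsFix (killed (graft G v R) v α) (fun j => (1 - α) * if j ∈ R then 1 else 0)
      (fromStart G α v R) :=
  (isSub_killed _ _ h1).isFix_sol (by linarith) _

variable {G : SimpleGraph (Fin n)} {α : ℝ} {q : Fin n → ℝ} {v : Fin n} {R : Finset (Fin n)}

/-- Moving the row of `v` to the right-hand side turns the stationarity equation into one for the
walk killed at `v`, with source `α q` plus `x v / |R|` times the source of `fromStart`. Linearity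
and uniqueness do the rest. -/
theorem pageRank_graft (h0 : 0 < α) (h1 : α < 1) (hq : IsDistribution q) (hv : v ∉ R)
    (hR : R.Nonempty) (j : Fin n) : pageRank (graft G v R) α q j =
      fromJump G α q v R j +
        pageRank (graft G v R) α q v / R.card * fromStart G α v R j := by
  set H := graft G v R with hH
  set x := pageRank H α q with hx
  have hK := isSub_killed H v h1
  have hd : (R.card : ℝ) ≠ 0 := by simpa using hR.ne_empty
  have key : IsFix (killed H v α)
      (fun j => α * q j + x v / R.card * ((1 - α) * if j ∈ R then 1 else 0)) x := fun j => by
    rw [hx, pageRank_isFix H h0 h1 hq j, ← hx, sum_mul_killed H v, ← add_assoc]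
    congr 2
    have : walk H v j = if j ∈ R then 1 / (R.card : ℝ) else 0 := by
      rw [hH, walk, graft_degree hv, if_neg (by simpa using hR.ne_empty)]
      simp only [graft_adj_left hv]
    rw [this]
    split_ifs <;> ring
  have key' : IsFix (killed H v α)
      (fun j => α * q j + x v / R.card * ((1 - α) * if j ∈ R then 1 else 0))
      fun j => fromJump G α q v R j + x v / R.card * fromStart G α v R j := fun j => by
    have e1 := fromJump_isFix G h0 h1 q v R j
    have e2 := fromStart_isFix G h0 h1 v R j
    simp only [add_mul, mul_assoc, Finset.sum_add_distrib, ← Finset.mul_sum]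
    rw [← hH] at e1 e2
    linear_combination e1 + x v / R.card * e2
  exact congrFun (key.unique hK (by linarith) key') j

theorem fromStart_nonneg (h0 : 0 < α) (h1 : α < 1) (j : Fin n) : 0 ≤ fromStart G α v R j := by
  refine (fromStart_isFix G h0 h1 v R).nonneg (isSub_killed _ _ h1) (by linarith) (fun i => ?_) j
  have : 0 ≤ 1 - α := by linarith
  positivity

theorem fromStart_pos (h0 : 0 < α) (h1 : α < 1) {u : Fin n} (hu : u ∈ R) :
    0 < fromStart G α v R u := by
  rw [fromStart_isFix G h0 h1 v R u]
  have h2 : 0 ≤ ∑ i, fromStart G α v R i * killed (graft G v R) v α i u :=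
    Finset.sum_nonneg fun i _ =>
      mul_nonneg (fromStart_nonneg h0 h1 i) ((isSub_killed _ _ h1).nonneg _ _)
  simp only [hu, if_true]
  linarith

/-- Balance of mass: `|R|` units leave `v`, and each step, the first included, loses a share `α`. So
at most `(1 - α) |R|` can return. -/
theorem fromStart_lt (h0 : 0 < α) (h1 : α < 1) (hR : R.Nonempty) :
    fromStart G α v R v < R.card := by
  set y := fromStart G α v R with hy
  have h2 : ∑ j, y j ≤ (1 - α) * R.card + (1 - α) * (∑ j, y j - y v) :=
    calc ∑ j, y j
        = ∑ j, ((1 - α) * if j ∈ R then 1 else 0) +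
            ∑ i, y i * ∑ j, killed (graft G v R) v α i j := by
          simp only [Finset.mul_sum]
          rw [Finset.sum_comm, ← Finset.sum_add_distrib]
          exact Finset.sum_congr rfl fun j _ => by
            simpa using fromStart_isFix G h0 h1 v R j
      _ = (1 - α) * R.card + (1 - α) * (∑ j, y j - y v) := by
          congr 1
          · rw [← Finset.mul_sum]; simp
          · have : ∀ i, y i * ∑ j, killed (graft G v R) v α i j =
                (1 - α) * (y i - if i = v then y v else 0) := fun i => by
              by_cases hi : i = v
              · simp [killed, hi]
              · simp [killed, Fin.val_inj, hi, ← Finset.mul_sum, sum_walk, mul_comm]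
            simp [this, ← Finset.mul_sum]
      _ ≤ _ := le_rfl
  have h3 : y v ≤ ∑ j, y j :=
    Finset.single_le_sum (fun i _ => fromStart_nonneg h0 h1 i) (Finset.mem_univ v)
  have h4 : (0 : ℝ) < R.card := by exact_mod_cast hR.card_pos
  have h5 := fromStart_nonneg (G := G) (v := v) (R := R) h0 h1 v
  nlinarith

/-- Solving `pageRank_graft` at `v` gives a quotient with positive denominator. Clearing it yields a
criterion that, for fixed `T` and `R.card`, is linear in `fromJump` and `fromStart`, hence additive
over components. -/
theorem lt_pageRank_graft_iff (h0 : 0 < α) (h1 : α < 1) (hq : IsDistribution q) (hv : v ∉ R)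
    (hR : R.Nonempty) (T : ℝ) : T < pageRank (graft G v R) α q v ↔
      0 < R.card * (fromJump G α q v R v - T) + T * fromStart G α v R v := by
  have hd : (0 : ℝ) < R.card := by exact_mod_cast hR.card_pos
  have h2 := pageRank_graft (G := G) h0 h1 hq hv hR v
  set x := pageRank (graft G v R) α q v
  have h3 := fromStart_lt (G := G) (v := v) h0 h1 hR
  have h4 : x * (R.card - fromStart G α v R v) = R.card * fromJump G α q v R v := by
    field_simp at h2
    linarith
  rw [← mul_lt_mul_iff_left₀ (sub_pos.2 h3), h4, ← sub_pos]
  ring_nf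

/-- By `pageRank_graft` the PageRank of `u` is an increasing affine function of that of `v`. This
converts the consent of `u` into a lower bound for the PageRank of `v`. -/
theorem lt_pageRank_graft_iff_of_mem (h0 : 0 < α) (h1 : α < 1) (hq : IsDistribution q) (hv : v ∉ R)
    {u : Fin n} (hu : u ∈ R) (T : ℝ) : T < pageRank (graft G v R) α q u ↔
      R.card * (T - fromJump G α q v R u) / fromStart G α v R u <
        pageRank (graft G v R) α q v := by
  have hR : R.Nonempty := ⟨u, hu⟩
  have hd : (0 : ℝ) < R.card := by exact_mod_cast hR.card_pos
  have h2 := pageRank_graft (G := G) h0 h1 hq hv hR u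
  rw [h2, div_lt_iff₀ (fromStart_pos h0 h1 hu), ← sub_lt_iff_lt_add', div_mul_eq_mul_div,
    lt_div_iff₀ hd, mul_comm]

/-! ### Decomposition over the components of `G - v` -/

/-- A step from `w` uses `R` only through the question whether `w ∈ R`. -/
theorem walk_graft_filter {comp : Fin n → ℕ} {w : Fin n} (hw : w ≠ v) (hv : v ∉ R) (j : Fin n) :
    walk (graft G v (R.filter fun x => comp x = comp w)) w j = walk (graft G v R) w j := by
  refine walk_congr (fun x => ?_) j
  by_cases hx : x = v
  · subst hx
    rw [graft_adj_right hv, graft_adj_right (by simp [hv])]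
    simp
  · rw [graft_adj_of_ne hw hx, graft_adj_of_ne hw hx]

/-- Solutions for the walk killed at `v` are glued from the solutions for the components. -/
theorem sol_killed_graft (h0 : 0 < α) (h1 : α < 1) {comp : Fin n → ℕ}
    (hcomp : ∀ x y, G.Adj x y → x ≠ v → y ≠ v → comp x = comp y) (hlt : ∀ x, comp x < n)
    (hv : v ∉ R) {b : Fin n → ℝ} {bc : ℕ → Fin n → ℝ} (hb : ∀ w, w ≠ v → b w = bc (comp w) w) :
    (∀ w, w ≠ v → sol (killed (graft G v R) v α) b w =
      sol (killed (graft G v (R.filter fun x => comp x = comp w)) v α) (bc (comp w)) w) ∧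
    sol (killed (graft G v R) v α) b v = b v + ∑ c ∈ Finset.range n,
      (sol (killed (graft G v (R.filter fun x => comp x = c)) v α) (bc c) v - bc c v) := by
  set Y : ℕ → Fin n → ℝ := fun c =>
    sol (killed (graft G v (R.filter fun x => comp x = c)) v α) (bc c) with hY
  have hYfix : ∀ c j, Y c j = bc c j +
      ∑ i, Y c i * killed (graft G v (R.filter fun x => comp x = c)) v α i j := fun c =>
    (isSub_killed _ _ h1).isFix_sol (by linarith) _
  set z0 : ℝ := b v + ∑ i ∈ Finset.univ.erase v, Y (comp i) i * killed (graft G v R) v α i v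
    with hz0
  -- The glued candidate takes each vertex from the solution for its own component. Its value at `v`
  -- feeds back into no equation, since row `v` of the killed matrix is zero, so `z0` can be defined
  -- by the equation at `v`.
  set z : Fin n → ℝ := fun w => if w = v then z0 else Y (comp w) w with hz
  have hkv : ∀ H j, killed H v α v j = 0 := fun H j => by simp [killed]
  have herase : ∀ (H : SimpleGraph (Fin n)) (x : Fin n → ℝ) j, ∑ i, x i * killed H v α i j =
      ∑ i ∈ Finset.univ.erase v, x i * killed H v α i j := fun H x j => by
    rw [← Finset.add_sum_erase _ _ (Finset.mem_univ v), hkv, mul_zero, zero_add]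
  have hkc : ∀ {i : Fin n}, i ≠ v → ∀ j, killed (graft G v R) v α i j =
      killed (graft G v (R.filter fun x => comp x = comp i)) v α i j := fun {i} hi j => by
    simp only [killed, Fin.val_inj, if_neg hi, walk_graft_filter hi hv]
  have hfix : IsFix (killed (graft G v R) v α) b z := fun j => by
    have e : ∑ i, z i * killed (graft G v R) v α i j =
        ∑ i ∈ Finset.univ.erase v, Y (comp i) i * killed (graft G v R) v α i j := by
      rw [herase]
      refine Finset.sum_congr rfl fun i hi => ?_
      simp only [hz, if_neg (Finset.mem_erase.1 hi).1]
    rw [e]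
    by_cases hj : j = v
    · subst hj
      simp [hz, hz0]
    · simp only [hz, if_neg hj]
      rw [hYfix, herase, hb j hj]
      congr 1
      refine Finset.sum_congr rfl fun i hi => ?_
      have hi' := (Finset.mem_erase.1 hi).1
      by_cases hc : comp i = comp j
      · rw [hkc hi', hc]
      · have hw : ∀ R', killed (graft G v R') v α i j = 0 := fun R' => by
          have : walk (graft G v R') i j = 0 := by
            refine walk_eq_zero (fun h => hc (h ▸ rfl)) fun h => hc ?_
            exact hcomp i j ((graft_adj_of_ne hi' hj).1 h) hi' hj
          simp [killed, this]
        simp [hw]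
  have hzs := hfix.eq_sol (isSub_killed _ _ h1) (by linarith)
  refine ⟨fun w hw => by rw [← hzs]; simp [hz, hw, hY], ?_⟩
  rw [← hzs]
  simp only [hz, if_true, hz0]
  congr 1
  -- In the system for `c` only vertices with label `c` are adjacent to `v`. Mass in other
  -- components may be present, but it cannot reach `v`.
  have hc : ∀ c, Y c v - bc c v = ∑ i ∈ (Finset.univ.erase v).filter (fun i => comp i = c),
      Y (comp i) i * killed (graft G v R) v α i v := fun c => by
    rw [hYfix, herase, add_sub_cancel_left, Finset.sum_filter]
    refine Finset.sum_congr rfl fun i hi => ?_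
    have hi' := (Finset.mem_erase.1 hi).1
    split_ifs with h
    · rw [hkc hi', h]
    · have : walk (graft G v (R.filter fun x => comp x = c)) i v = 0 := by
        refine walk_eq_zero hi' fun h' => h ?_
        rw [graft_adj_right (by simp [hv])] at h'
        exact (Finset.mem_filter.1 h').2
      simp [killed, this]
  rw [Finset.sum_congr rfl fun c _ => hc c]
  exact (Finset.sum_fiberwise_of_maps_to (fun i _ => Finset.mem_range.2 (hlt i)) _).symm

theorem fromJump_eq (h0 : 0 < α) (h1 : α < 1) {comp : Fin n → ℕ}
    (hcomp : ∀ x y, G.Adj x y → x ≠ v → y ≠ v → comp x = comp y) (hlt : ∀ x, comp x < n)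
    (hv : v ∉ R) : fromJump G α q v R v = α * q v + ∑ c ∈ Finset.range n,
      (fromJump G α q v (R.filter fun x => comp x = c) v - α * q v) :=
  (sol_killed_graft (b := fun j => α * q j) (bc := fun _ j => α * q j) h0 h1 hcomp hlt hv
    fun _ _ => rfl).2

theorem fromJump_apply (h0 : 0 < α) (h1 : α < 1) {comp : Fin n → ℕ}
    (hcomp : ∀ x y, G.Adj x y → x ≠ v → y ≠ v → comp x = comp y) (hlt : ∀ x, comp x < n)
    (hv : v ∉ R) {w : Fin n} (hw : w ≠ v) : fromJump G α q v R w =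
      fromJump G α q v (R.filter fun x => comp x = comp w) w :=
  (sol_killed_graft (b := fun j => α * q j) (bc := fun _ j => α * q j) h0 h1 hcomp hlt hv
    fun _ _ => rfl).1 w hw

theorem fromStart_eq (h0 : 0 < α) (h1 : α < 1) {comp : Fin n → ℕ}
    (hcomp : ∀ x y, G.Adj x y → x ≠ v → y ≠ v → comp x = comp y) (hlt : ∀ x, comp x < n)
    (hv : v ∉ R) : fromStart G α v R v = ∑ c ∈ Finset.range n,
      fromStart G α v (R.filter fun x => comp x = c) v := by
  have := (sol_killed_graft (b := fun j => (1 - α) * if j ∈ R then 1 else 0)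
    (bc := fun c j => (1 - α) * if j ∈ R.filter (fun x => comp x = c) then 1 else 0)
    h0 h1 hcomp hlt hv fun w _ => by simp).2
  simpa [hv, fromStart] using this

theorem fromStart_apply (h0 : 0 < α) (h1 : α < 1) {comp : Fin n → ℕ}
    (hcomp : ∀ x y, G.Adj x y → x ≠ v → y ≠ v → comp x = comp y) (hlt : ∀ x, comp x < n)
    (hv : v ∉ R) {w : Fin n} (hw : w ≠ v) : fromStart G α v R w =
      fromStart G α v (R.filter fun x => comp x = comp w) w := by
  have := (sol_killed_graft (b := fun j => (1 - α) * if j ∈ R then 1 else 0)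
    (bc := fun c j => (1 - α) * if j ∈ R.filter (fun x => comp x = c) then 1 else 0)
    h0 h1 hcomp hlt hv fun w _ => by simp).1 w hw
  simpa [fromStart] using this

theorem fromJump_empty (h0 : 0 < α) (h1 : α < 1) : fromJump G α q v ∅ v = α * q v := by
  rw [fromJump_isFix G h0 h1 q v ∅ v]
  simp only [add_eq_left]
  refine Finset.sum_eq_zero fun i _ => ?_
  by_cases h : i = v
  · simp [killed, h]
  · rw [killed, walk_eq_zero h (by simp [graft_adj_right])]
    simp

theorem fromStart_empty (h0 : 0 < α) (h1 : α < 1) (j : Fin n) : fromStart G α v ∅ j = 0 := by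
  have : IsFix (killed (graft G v ∅) v α) (fun j => (1 - α) * if j ∈ (∅ : Finset (Fin n)) then 1 else 0)
      (fun _ => 0) := fun j => by simp
  exact (congrFun (this.eq_sol (isSub_killed _ _ h1) (by linarith)) j).symm

/-! ### Strategies -/

/-- The neighbours of a player that retains `S` and adds an edge to `u`, where `u = v` stands for
no added edge. -/
def ends (v u : Fin n) (S : Finset (Fin n)) : Finset (Fin n) := if u = v then S else insert u S

theorem outcome_eq_graft {s : Strategy (Fin n)} {u : Fin n} (hk : ∀ w ∈ s.keep, G.Adj v w)
    (hs : s.add = if u = v then none else some u) :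
    outcome G v s = graft G v (ends v u s.keep) := by
  have hv : v ∉ ends v u s.keep := by
    unfold ends
    split_ifs with h
    · exact fun h => (hk v h).ne rfl
    · simp only [Finset.mem_insert, not_or]
      exact ⟨Ne.symm h, fun h => (hk v h).ne rfl⟩
  have main : ∀ j, j ≠ v → ((outcome G v s).Adj v j ↔ j ∈ ends v u s.keep) := fun j hj => by
    have e1 : ∀ w, s(v, j) = s(v, w) ↔ j = w := fun w => by
      simp only [Sym2.eq_iff, true_and, or_iff_left_iff_imp]
      exact fun h => absurd h.2 hj
    simp only [outcome, SimpleGraph.sup_adj, SimpleGraph.deleteEdges_adj,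
      SimpleGraph.fromEdgeSet_adj, Set.mem_ofPred_eq, e1, hs, ends]
    by_cases h : u = v
    · simp only [h, if_true]
      simp
      exact fun h => hk j h
    · simp only [h, if_false]
      simp [hj.symm]
      constructor
      · tauto
      · rintro (h | h)
        · exact Or.inr h.symm
        · exact Or.inl ⟨hk j h, h⟩
  ext i j
  by_cases hi : i = v
  · subst hi
    by_cases hj : j = i
    · subst hj; simp
    · rw [main j hj, graft_adj_left hv]
  by_cases hj : j = v
  · subst hj
    rw [SimpleGraph.adj_comm, main i hi, graft_adj_right hv]
  have e : ∀ w, s(i, j) ≠ s(v, w) := fun w => by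
    simp [hi, hj]
  rw [graft_adj_of_ne hi hj]
  simp [outcome, e]

/-- The value that the new PageRank of `v` has to exceed for an improving strategy. -/
noncomputable def threshold (G : SimpleGraph (Fin n)) (α : ℝ) (q : Fin n → ℝ) (v u : Fin n)
    (R : Finset (Fin n)) (d : ℕ) : ℝ :=
  if u = v then pageRank G α q v
  else max (pageRank G α q v)
    (d * (pageRank G α q u - fromJump G α q v R u) / fromStart G α v R u)

/-- The threshold involves `R` only through its part in the component of `u` and its size. With
these two fixed, the right-hand side is a constant plus a sum of independent contributions, the form
needed for dynamic programming. -/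
theorem isImproving_iff (h0 : 0 < α) (h1 : α < 1) (hq : IsDistribution q) {comp : Fin n → ℕ}
    (hcomp : ∀ x y, G.Adj x y → x ≠ v → y ≠ v → comp x = comp y) (hlt : ∀ x, comp x < n)
    {s : Strategy (Fin n)} {u : Fin n} (hk : ∀ w ∈ s.keep, G.Adj v w)
    (hs : s.add = if u = v then none else some u) (hu : ¬ G.Adj v u)
    (hR : R = ends v u s.keep) {T : ℝ}
    (hT : T = threshold G α q v u (R.filter fun x => comp x = comp u) R.card) :
    IsImproving G α q v s ↔ R.Nonempty ∧
      0 < R.card * (α * q v - T) + ∑ c ∈ Finset.range n,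
        (R.card * (fromJump G α q v (R.filter fun x => comp x = c) v - α * q v) +
          T * fromStart G α v (R.filter fun x => comp x = c) v) := by
  have hv : v ∉ R := by
    rw [hR]
    unfold ends
    split_ifs with h
    · exact fun h => (hk v h).ne rfl
    · simp only [Finset.mem_insert, not_or]
      exact ⟨Ne.symm h, fun h => (hk v h).ne rfl⟩
  have hne : (s.keep.Nonempty ∨ s.add.isSome) ↔ R.Nonempty := by
    rw [hs, hR]
    unfold ends
    split_ifs <;> simp
  have hsum : R.card * (α * q v - T) + ∑ c ∈ Finset.range n,
        (R.card * (fromJump G α q v (R.filter fun x => comp x = c) v - α * q v) +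
          T * fromStart G α v (R.filter fun x => comp x = c) v) =
      R.card * (fromJump G α q v R v - T) + T * fromStart G α v R v := by
    rw [fromJump_eq h0 h1 hcomp hlt hv, fromStart_eq h0 h1 hcomp hlt hv, Finset.sum_add_distrib,
      ← Finset.mul_sum, ← Finset.mul_sum]
    ring
  rw [hsum, IsImproving, IsAvailable, hne, outcome_eq_graft hk hs, ← hR]
  constructor
  · rintro ⟨⟨-, hR', h2⟩, h3⟩
    refine ⟨hR', (lt_pageRank_graft_iff h0 h1 hq hv hR' T).1 ?_⟩
    rw [hT, threshold]
    split_ifs with huv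
    · exact h3
    · refine max_lt h3 ?_
      have h4 := (h2 u (by simp [hs, huv])).2.2
      rw [← fromJump_apply h0 h1 hcomp hlt hv huv, ← fromStart_apply h0 h1 hcomp hlt hv huv]
      exact (lt_pageRank_graft_iff_of_mem h0 h1 hq hv (by simp [hR, ends, huv]) _).1 h4
  · rintro ⟨hR', h2⟩
    have h3 := (lt_pageRank_graft_iff h0 h1 hq hv hR' T).2 h2
    rw [hT, threshold] at h3
    split_ifs at h3 with huv
    · refine ⟨⟨hk, hR', fun u' hu' => ?_⟩, h3⟩
      simp [hs, huv] at hu'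
    · refine ⟨⟨hk, hR', fun u' hu' => ?_⟩, (le_max_left _ _).trans_lt h3⟩
      obtain rfl : u = u' := by simpa [hs, huv] using hu'
      refine ⟨huv, hu, ?_⟩
      have h4 := (le_max_right _ _).trans_lt h3
      rw [← fromJump_apply h0 h1 hcomp hlt hv huv, ← fromStart_apply h0 h1 hcomp hlt hv huv] at h4
      exact (lt_pageRank_graft_iff_of_mem h0 h1 hq hv (by simp [hR, ends, huv]) _).2 h4

end Graft

/-! ### Neighbours of a vertex in one component of the rest of the graph -/

section Blocks

variable {V : Type*}

/-- There is a walk from `a` to `b` inside `X`. -/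
def Joined (G : SimpleGraph V) (X : Set V) (a b : V) : Prop :=
  ∃ p : G.Walk a b, ∀ z ∈ p.support, z ∈ X

variable {G : SimpleGraph V} {X Y : Set V} {a b c : V}

theorem Joined.refl (h : a ∈ X) : Joined G X a a := ⟨.nil, by simpa using h⟩

theorem Joined.symm (h : Joined G X a b) : Joined G X b a := by
  obtain ⟨p, hp⟩ := h
  exact ⟨p.reverse, by simpa using hp⟩

theorem Joined.trans (h : Joined G X a b) (h' : Joined G X b c) : Joined G X a c := by
  obtain ⟨p, hp⟩ := h
  obtain ⟨r, hr⟩ := h'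
  refine ⟨p.append r, fun z hz => ?_⟩
  rw [SimpleGraph.Walk.mem_support_append_iff] at hz
  exact hz.elim (hp z) (hr z)

theorem Joined.mono (h : Joined G X a b) (hXY : X ⊆ Y) : Joined G Y a b :=
  let ⟨p, hp⟩ := h
  ⟨p, fun z hz => hXY (hp z hz)⟩

theorem Joined.of_adj (h : G.Adj a b) (ha : a ∈ X) (hb : b ∈ X) : Joined G X a b :=
  ⟨.cons h .nil, by simp [ha, hb]⟩

theorem preconnected_induce_iff :
    (G.induce X).Preconnected ↔ ∀ a ∈ X, ∀ b ∈ X, Joined G X a b := by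
  constructor
  · intro h a ha b hb
    obtain ⟨p⟩ := h ⟨a, ha⟩ ⟨b, hb⟩
    refine ⟨p.map (SimpleGraph.Embedding.induce X).toHom, fun z hz => ?_⟩
    erw [SimpleGraph.Walk.support_map, List.mem_map] at hz
    obtain ⟨y, -, rfl⟩ := hz
    exact y.2
  · rintro h ⟨a, ha⟩ ⟨b, hb⟩
    obtain ⟨p, hp⟩ := h a ha b hb
    exact ⟨p.induce X hp⟩

/-- Deleting a vertex from a path leaves at most two pieces, each containing an end of the path. -/
theorem joined_of_isPath {p : G.Walk a b} (hp : p.IsPath) {x y : V}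
    (hy : y ∈ p.support) (hyx : y ≠ x) :
    Joined G ({z | z ∈ p.support} \ {x}) y a ∨ Joined G ({z | z ∈ p.support} \ {x}) y b := by
  induction p with
  | nil =>
    simp only [SimpleGraph.Walk.support_nil, List.mem_singleton] at hy
    subst hy
    exact Or.inl (Joined.refl (by simpa using hyx))
  | @cons a a' b h p ih =>
    rw [SimpleGraph.Walk.cons_isPath_iff] at hp
    have hsub : ({z | z ∈ p.support} \ {x} : Set V) ⊆
        {z | z ∈ (SimpleGraph.Walk.cons h p).support} \ {x} := by
      rintro z ⟨hz, hz'⟩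
      exact ⟨List.mem_cons_of_mem _ hz, hz'⟩
    rw [SimpleGraph.Walk.support_cons, List.mem_cons] at hy
    rcases hy with rfl | hy
    · exact Or.inl (Joined.refl ⟨by simp, hyx⟩)
    by_cases hx : x = a
    · subst hx
      classical
      refine Or.inr ⟨p.dropUntil y hy, fun z hz => ?_⟩
      have hz' := SimpleGraph.Walk.support_dropUntil_subset_support p hy hz
      refine ⟨by simp [hz'], ?_⟩
      rintro rfl
      exact hp.2 hz'
    · rcases ih hp.1 hy with h1 | h1
      · have ha' : a' ∈ ({z | z ∈ p.support} \ {x} : Set V) := by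
          obtain ⟨r, hr⟩ := h1
          exact hr a' r.end_mem_support
        exact Or.inl ((h1.mono hsub).trans
          (Joined.of_adj h.symm (hsub ha') ⟨by simp, Ne.symm hx⟩))
      · exact Or.inr (h1.mono hsub)

/-- The deleted vertex `x` may here lie outside `B`, where its deletion has no effect; this saves a
case distinction when `B` is enlarged. -/
theorem isNonseparable_iff {B : Finset V} : IsNonseparable G B ↔
    B.Nonempty ∧ (∀ a ∈ B, ∀ b ∈ B, Joined G B a b) ∧
      ∀ x, ∀ a ∈ B, a ≠ x → ∀ b ∈ B, b ≠ x → Joined G (B \ {x}) a b := by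
  have e : (G.induce (B : Set V)).Connected ↔
      B.Nonempty ∧ ∀ a ∈ B, ∀ b ∈ B, Joined G B a b := by
    rw [SimpleGraph.connected_iff, preconnected_induce_iff, and_comm]
    simp [Finset.Nonempty]
  simp only [IsNonseparable, e, preconnected_induce_iff, and_assoc]
  refine and_congr_right fun _ => and_congr_right fun h => ⟨fun h' x a ha hax b hb hbx => ?_,
    fun h' x _ a ha b hb => h' x a ha.1 ha.2 b hb.1 hb.2⟩
  by_cases hx : x ∈ B
  · exact h' x hx a ⟨ha, hax⟩ b ⟨hb, hbx⟩
  · exact (h a ha b hb).mono fun z hz => ⟨hz, fun hzx => hx (hzx ▸ hz)⟩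

theorem IsNonseparable.of_adj [DecidableEq V] (h : G.Adj a b) : IsNonseparable G {a, b} := by
  rw [isNonseparable_iff]
  refine ⟨by simp, fun x hx y hy => ?_, fun z x hx hxz y hy hyz => ?_⟩
  · simp only [Finset.mem_insert, Finset.mem_singleton] at hx hy
    rcases hx with rfl | rfl <;> rcases hy with rfl | rfl
    · exact Joined.refl (by simp)
    · exact Joined.of_adj h (by simp) (by simp)
    · exact Joined.of_adj h.symm (by simp) (by simp)
    · exact Joined.refl (by simp)
  · simp only [Finset.mem_insert, Finset.mem_singleton] at hx hy
    rcases hx with rfl | rfl <;> rcases hy with rfl | rfl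
    · exact Joined.refl (by simp [hxz])
    · exact Joined.of_adj h (by simp [hxz]) (by simp [hyz])
    · exact Joined.of_adj h.symm (by simp [hxz]) (by simp [hyz])
    · exact Joined.refl (by simp [hxz])

/-- The path, closed by the edge from `b` to `v`, is an ear of `B` attached at `a` and `v`. The path
may meet `B` elsewhere. -/
theorem IsNonseparable.union_path [DecidableEq V] {B : Finset V} (hB : IsNonseparable G B)
    {v : V} (hv : v ∈ B) (ha : a ∈ B) {p : G.Walk a b} (hp : p.IsPath) (hvp : v ∉ p.support)
    (hb : G.Adj v b) : IsNonseparable G (B ∪ p.support.toFinset) := by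
  rw [isNonseparable_iff] at hB ⊢
  obtain ⟨hne, h1, h2⟩ := hB
  have hav : a ≠ v := fun h => hvp (h ▸ p.start_mem_support)
  have hfrom : ∀ y ∈ p.support, Joined G {z | z ∈ p.support} a y := fun y hy =>
    ⟨p.takeUntil y hy, fun z hz => SimpleGraph.Walk.support_takeUntil_subset_support p hy hz⟩
  refine ⟨hne.mono Finset.subset_union_left, ?_, ?_⟩
  · suffices ∀ y ∈ B ∪ p.support.toFinset, Joined G ↑(B ∪ p.support.toFinset) a y from
      fun y hy z hz => (this y hy).symm.trans (this z hz)
    intro y hy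
    rw [Finset.mem_union, List.mem_toFinset] at hy
    rcases hy with hy | hy
    · exact (h1 a ha y hy).mono (by simp)
    · exact (hfrom y hy).mono fun z hz => by simp only [Set.mem_ofPred_eq] at hz; simp [hz]
  · intro x
    suffices ∃ o, ∀ y ∈ B ∪ p.support.toFinset, y ≠ x →
        Joined G (↑(B ∪ p.support.toFinset) \ {x}) o y by
      obtain ⟨o, ho⟩ := this
      exact fun y hy hyx z hz hzx => (ho y hy hyx).symm.trans (ho z hz hzx)
    have hBX : (↑B \ {x} : Set V) ⊆ ↑(B ∪ p.support.toFinset) \ {x} :=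
      fun z hz => ⟨by simp [Finset.mem_coe.1 hz.1], hz.2⟩
    have hpX : ({z | z ∈ p.support} \ {x} : Set V) ⊆ ↑(B ∪ p.support.toFinset) \ {x} :=
      fun z hz => ⟨by have := hz.1; simp only [Set.mem_ofPred_eq] at this; simp [this], hz.2⟩
    -- Without `v` the whole path still hangs on `a`. Without another vertex, each remaining path
    -- vertex reaches `a` or `b` along the path, and both lead to `v`: from `a` inside `B`, from `b`
    -- by the edge.
    by_cases hx : x = v
    · subst hx
      refine ⟨a, fun y hy hyx => ?_⟩
      rw [Finset.mem_union, List.mem_toFinset] at hy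
      rcases hy with hy | hy
      · exact (h2 x a ha hav y hy hyx).mono hBX
      · refine (hfrom y hy).mono fun z hz => hpX ⟨hz, ?_⟩
        rintro rfl
        exact hvp hz
    · refine ⟨v, fun y hy hyx => ?_⟩
      rw [Finset.mem_union, List.mem_toFinset] at hy
      rcases hy with hy | hy
      · exact (h2 x v hv (Ne.symm hx) y hy hyx).mono hBX
      · rcases joined_of_isPath hp hy hyx with h | h
        · have hax : a ≠ x := by
            obtain ⟨r, hr⟩ := h
            exact (hr a r.end_mem_support).2
          exact ((h2 x v hv (Ne.symm hx) a ha hax).mono hBX).trans (h.mono hpX).symm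
        · have hbx : b ∈ ({z | z ∈ p.support} \ {x} : Set V) := by
            obtain ⟨r, hr⟩ := h
            exact hr b r.end_mem_support
          exact (Joined.of_adj hb (hBX ⟨hv, Ne.symm hx⟩) (hpX hbx)).trans (h.mono hpX).symm

/-- Neighbours of `v` that are connected to each other in the rest of the graph lie in one block
with `v`. -/
theorem card_le_param [Fintype V] {v : V} {S : Finset V} (hS : ∀ w ∈ S, G.Adj v w)
    (hj : ∀ w ∈ S, ∀ w' ∈ S, Joined G {v}ᶜ w w') : S.card ≤ param G := by
  classical
  obtain rfl | ⟨w, hw⟩ := S.eq_empty_or_nonempty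
  · simp
  have hpath : ∀ w' ∈ S, ∃ p : G.Walk w w', p.IsPath ∧ v ∉ p.support := fun w' hw' => by
    obtain ⟨p, hp⟩ := hj w hw w' hw'
    refine ⟨p.bypass, p.bypass_isPath, fun h => ?_⟩
    exact hp v (SimpleGraph.Walk.support_bypass_subset_support p h) rfl
  unfold param
  split_ifs with hT
  · rw [Finset.card_le_one]
    suffices ∀ w' ∈ S, w' = w from fun x hx y hy => (this x hx).trans (this y hy).symm
    intro w' hw'
    by_contra hne
    obtain ⟨p, hp, hvp⟩ := hpath w' hw'
    -- In a tree the path through `v` is the only one between its two neighbours, which contradicts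
    -- a path avoiding `v`.
    have hr : (SimpleGraph.Walk.cons (hS w hw).symm (.cons (hS w' hw') .nil)).IsPath := by
      simp [SimpleGraph.Walk.cons_isPath_iff, (hS w hw).ne', (hS w' hw').ne, Ne.symm hne]
    have := congrArg Subtype.val ((hT.isAcyclic.subsingleton_path _ _).elim ⟨p, hp⟩ ⟨_, hr⟩)
    simp only at this
    rw [this] at hvp
    simp at hvp
  -- Take a block containing the edge from `v` to `w`. By maximality it absorbs each ear from `w` to
  -- another vertex of `S`, so it contains all of `S`.
  · obtain ⟨B, hwB, hB⟩ := Finite.exists_le_maximal (IsNonseparable.of_adj (hS w hw))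
    have hv : v ∈ B := hwB (by simp)
    have hwB' : w ∈ B := hwB (by simp)
    have hSB : ∀ w' ∈ S, w' ∈ B := fun w' hw' => by
      obtain ⟨p, hp, hvp⟩ := hpath w' hw'
      refine hB.2 (hB.1.union_path hv hwB' hp hvp (hS w' hw')) Finset.subset_union_left ?_
      simp
    calc S.card ≤ (B.filter fun x => G.Adj v x).card :=
          Finset.card_le_card fun x hx => Finset.mem_filter.2 ⟨hSB x hx, hS x hx⟩
      _ ≤ B.sup fun y => (B.filter fun x => G.Adj y x).card :=
          Finset.le_sup (f := fun y => (B.filter fun x => G.Adj y x).card) hv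
      _ ≤ _ := Finset.le_sup (f := fun B : Finset V =>
          B.sup fun y => (B.filter fun x => G.Adj y x).card) (Finset.mem_filter.2 ⟨Finset.mem_univ _, hB⟩)

end Blocks

/-! ### The program -/

open NatExpr (lit var vec)
open Program (setNat setReal setVar setRVar forTo)

/-- Array `4` holds the powers of two. -/
def powProg : Program :=
  .seq (setNat 4 (lit 0) (lit 0) (lit 1)) <| forTo 50 (var 0) <|
    setNat 4 (lit 0) (.add (var 50) (lit 1)) (.add (vec 4 (var 50)) (vec 4 (var 50)))

/-- Row `0` of array `X` becomes the indicator of the set encoded in variable `40`. -/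
def decodeProg (X : ℕ) : Program :=
  forTo 41 (var 0) <| .seq (setVar 42 (.sub (var 0) (.add (var 41) (lit 1)))) <|
    .ite (.natLt (var 40) (vec 4 (var 42)))
      (setNat X (lit 0) (var 42) (lit 0))
      (.seq (setNat X (lit 0) (var 42) (lit 1)) (setVar 40 (.sub (var 40) (vec 4 (var 42)))))

/-- Array `10` becomes the adjacency matrix after the neighbourhood of vertex `20` has been changed
to the set in array `9`, and real array `2` the matrix of the killed walk with two right-hand
sides. -/
def buildProg : Program :=
  forTo 43 (var 0) <|
    .seq (setVar 44 (lit 0)) <|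
    .seq (forTo 45 (var 0) <| .seq
      (.ite (.natEq (var 43) (var 20)) (setVar 46 (vec 9 (var 45)))
        (.ite (.natEq (var 45) (var 20)) (setVar 46 (vec 9 (var 43)))
          (setVar 46 (.read 1 (var 43) (var 45)))))
      (.seq (setNat 10 (var 43) (var 45) (var 46)) (setVar 44 (.add (var 44) (var 46))))) <|
    .seq (forTo 45 (var 0) <|
      .ite (.natEq (var 43) (var 20)) (setReal 2 (var 43) (var 45) (.ofNat (lit 0)))
        (.ite (.natEq (var 44) (lit 0))
          (.ite (.natEq (var 43) (var 45))
            (setReal 2 (var 43) (var 45) (.sub (.ofNat (lit 1)) (.var 0)))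
            (setReal 2 (var 43) (var 45) (.ofNat (lit 0))))
          (setReal 2 (var 43) (var 45) (.mul (.sub (.ofNat (lit 1)) (.var 0))
            (.div (.ofNat (.read 10 (var 43) (var 45))) (.ofNat (var 44))))))) <|
    .seq (setReal 2 (var 0) (var 43) (.mul (.var 0) (.read 1 (var 43) (lit 0)))) <|
    setReal 2 (.add (var 0) (lit 1)) (var 43)
      (.mul (.sub (.ofNat (lit 1)) (.var 0)) (.ofNat (vec 9 (var 43))))

/-- Elimination in real array `2`. -/
def solveProg : Program :=
  forTo 47 (var 0) <| forTo 48 (.add (var 0) (lit 2)) <|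
    .ite (.natLt (var 47) (var 48))
      (.seq (setRVar 10 (.read 2 (var 48) (var 47))) <|
        forTo 49 (var 0) <| setReal 2 (var 48) (var 49) <|
          .add (.read 2 (var 48) (var 49)) <|
            .div (.mul (.var 10) (.read 2 (var 47) (var 49)))
              (.sub (.ofNat (lit 1)) (.read 2 (var 47) (var 47))))
      .skip

/-- Array `5` becomes a labelling of the components of the graph without vertex `20`. -/
def compProg : Program :=
  .seq (forTo 51 (var 0) <| setNat 5 (lit 0) (var 51) (var 51)) <|
  forTo 51 (var 0) <| forTo 52 (var 0) <|
    .ite (.and (.natEq (.read 1 (var 51) (var 52)) (lit 1))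
        (.and (.not (.natEq (var 51) (var 20))) (.not (.natEq (var 52) (var 20)))))
      (.seq (setVar 53 (vec 5 (var 51))) <| .seq (setVar 54 (vec 5 (var 52))) <|
        forTo 55 (var 0) <| .ite (.natEq (vec 5 (var 55)) (var 53))
          (setNat 5 (lit 0) (var 55) (var 54)) .skip)
      .skip

/-- Tables of all sets of neighbours of vertex `20` in each component: array `6` their number,
array `7` the sets, array `8` their sizes. -/
def tableProg : Program :=
  .seq (forTo 56 (var 0) <| .seq (setNat 6 (lit 0) (var 56) (lit 1)) <|
    .seq (setNat 7 (var 56) (lit 0) (lit 0)) (setNat 8 (var 56) (lit 0) (lit 0))) <|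
  forTo 57 (var 0) <| .ite (.natEq (.read 1 (var 20) (var 57)) (lit 1))
    (.seq (setVar 58 (vec 5 (var 57))) <| .seq (setVar 59 (vec 6 (var 58))) <|
      .seq (forTo 60 (var 59) <|
        .seq (setNat 7 (var 58) (.add (var 59) (var 60))
          (.add (.read 7 (var 58) (var 60)) (vec 4 (var 57))))
        (setNat 8 (var 58) (.add (var 59) (var 60)) (.add (.read 8 (var 58) (var 60)) (lit 1)))) <|
      setNat 6 (lit 0) (var 58) (.add (var 59) (var 59)))
    .skip

/-- Real arrays `5` and `6` become the values of the table entries. -/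
def valueProg : Program :=
  forTo 61 (var 0) <| forTo 62 (vec 6 (var 61)) <|
    .seq (setVar 40 (.read 7 (var 61) (var 62))) <| .seq (decodeProg 9) <| .seq buildProg <|
    .seq solveProg <|
    .seq (setReal 5 (var 61) (var 62)
      (.sub (.read 2 (var 0) (var 20)) (.mul (.var 0) (.read 1 (var 20) (lit 0)))))
    (setReal 6 (var 61) (var 62) (.read 2 (.add (var 0) (lit 1)) (var 20)))

/-- The value that has to be exceeded, for vertex `20`, additional vertex `21` and `23` edges. -/
def thresholdProg : Program :=
  .seq (setRVar 12 (.read 3 (lit 0) (var 20))) <|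
  .ite (.natEq (var 21) (var 20)) .skip <|
  .seq (setRVar 13 (.div (.mul (.ofNat (var 23))
      (.sub (.read 3 (lit 0) (var 21)) (.read 2 (var 0) (var 21))))
      (.read 2 (.add (var 0) (lit 1)) (var 21)))) <|
  .ite (.realLt (.var 12) (.var 13)) (setRVar 12 (.var 13)) .skip

/-- The first layer of the table of optimal choices. -/
def baseProg : Program :=
  forTo 25 (.add (var 23) (lit 1)) <| .ite (.natEq (var 25) (var 27))
    (.seq (setNat 11 (lit 0) (var 25) (.add (var 28) (lit 1))) <|
      setReal 4 (lit 0) (var 25) (.add (.mul (.ofNat (var 23))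
        (.add (.sub (.mul (.var 0) (.read 1 (var 20) (lit 0))) (.var 12)) (.var 14)))
        (.mul (.var 12) (.var 15))))
    (setNat 11 (lit 0) (var 25) (lit 0))

/-- One cell of the table of optimal choices: layer `24`, `25` edges, `29` options. -/
def cellProg : Program :=
  .seq (setNat 11 (.add (var 24) (lit 1)) (var 25) (lit 0)) <|
  forTo 26 (var 29) <|
    .ite (.natLt (var 25) (.read 8 (var 24) (var 26))) .skip <|
    .seq (setVar 30 (.read 11 (var 24) (.sub (var 25) (.read 8 (var 24) (var 26))))) <|
    .ite (.natEq (var 30) (lit 0)) .skip <|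
    .seq (setRVar 11 (.add (.read 4 (var 24) (.sub (var 25) (.read 8 (var 24) (var 26))))
      (.add (.mul (.ofNat (var 23)) (.read 5 (var 24) (var 26)))
        (.mul (.var 12) (.read 6 (var 24) (var 26)))))) <|
    .ite (.and (.not (.natEq (.read 11 (.add (var 24) (lit 1)) (var 25)) (lit 0)))
        (.not (.realLt (.read 4 (.add (var 24) (lit 1)) (var 25)) (.var 11))))
      .skip <|
    .seq (setNat 11 (.add (var 24) (lit 1)) (var 25)
      (.add (var 30) (.read 7 (var 24) (var 26))))
    (setReal 4 (.add (var 24) (lit 1)) (var 25) (.var 11))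

/-- The table of optimal choices: real array `4` the optimal values, array `11` the sets. -/
def choiceProg : Program :=
  .seq baseProg <| forTo 24 (var 0) <|
    .seq (.ite (.natEq (var 24) (var 31)) (setVar 29 (lit 1)) (setVar 29 (vec 6 (var 24)))) <|
    forTo 25 (.add (var 23) (lit 1)) cellProg

/-- Report an improving strategy if the table contains one. -/
def reportProg : Program :=
  .ite (.and (.not (.natEq (.read 11 (var 0) (var 23)) (lit 0)))
      (.realLt (.ofNat (lit 0)) (.read 4 (var 0) (var 23))))
    (.seq (setNat 2 (lit 0) (lit 0) (lit 0)) <|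
      .seq (setNat 2 (lit 0) (lit 1) (var 20)) <|
      .seq (.ite (.natEq (var 21) (var 20)) (setNat 2 (lit 0) (lit 2) (lit 0))
        (setNat 2 (lit 0) (lit 2) (.add (var 21) (lit 1)))) <|
      .seq (setVar 40 (.sub (.read 11 (var 0) (var 23)) (lit 1))) (decodeProg 3))
    .skip

/-- Search for improving strategies of vertex `20` with additional vertex `21` and the entry `22`
of the table as part in the component of that vertex. -/
def entryProg : Program :=
  .seq (setVar 28 (.read 7 (var 31) (var 22))) <|
  .seq (setVar 40 (var 28)) <|
  .seq (decodeProg 9) <|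
  .seq (setVar 27 (.read 8 (var 31) (var 22))) <|
  .seq (.ite (.natEq (var 21) (var 20)) .skip <|
    .seq (setNat 9 (lit 0) (var 21) (lit 1)) (setVar 27 (.add (var 27) (lit 1)))) <|
  .seq buildProg <| .seq solveProg <|
  .seq (setRVar 14 (.sub (.read 2 (var 0) (var 20)) (.mul (.var 0) (.read 1 (var 20) (lit 0))))) <|
  .seq (setRVar 15 (.read 2 (.add (var 0) (lit 1)) (var 20))) <|
  forTo 32 (var 0) <| .seq (setVar 23 (.add (var 32) (lit 1))) <|
    .seq thresholdProg <| .seq choiceProg reportProg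

/-- Search for improving strategies of vertex `20`. -/
def playerProg : Program :=
  .seq compProg <| .seq tableProg <| .seq valueProg <| forTo 21 (var 0) <|
    .ite (.natEq (.read 1 (var 20) (var 21)) (lit 0))
      (.seq (setVar 31 (vec 5 (var 21))) <| forTo 22 (vec 6 (var 31)) entryProg) .skip

/-- The PageRank of the input graph is stored in real array `3`. -/
def rankProg : Program :=
  .seq (setVar 20 (var 0)) <| .seq buildProg <| .seq solveProg <|
    forTo 33 (var 0) <| setReal 3 (lit 0) (var 33) (.read 2 (var 0) (var 33))

/-- The algorithm. -/
def nashProg : Program :=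
  .seq powProg <| .seq rankProg <| .seq (setNat 2 (lit 0) (lit 0) (lit 1)) <|
    forTo 20 (var 0) playerProg

attribute [local simp] Program.exec NatExpr.eval RealExpr.eval Test.Holds Memory.setNat
  Memory.setReal

/-! ### Specifications -/

/-! ### Input, powers of two and binary codes of vertex sets -/

section Specifications

variable {n : ℕ} {G : SimpleGraph (Fin n)} {α : ℝ} {q : Fin n → ℝ} {m : Memory}

open Classical in
/-- The memory holds the input. -/
structure HasInput (G : SimpleGraph (Fin n)) (α : ℝ) (q : Fin n → ℝ) (m : Memory) : Prop where
  size : m.nat 0 0 0 = n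
  adj : ∀ i j : Fin n, m.nat 1 i j = if G.Adj i j then 1 else 0
  damp : m.real 0 0 0 = α
  jump : ∀ i : Fin n, m.real 1 i 0 = q i

theorem hasInput_input (G : SimpleGraph (Fin n)) (α : ℝ) (q : Fin n → ℝ) :
    HasInput G α q (input G α q) where
  size := by simp [input]
  adj i j := by
    by_cases h : G.Adj i j <;> simp [input, h]
  damp := by simp [input]
  jump i := by simp [input]

theorem HasInput.same {m' : Memory} {p : Program} (h : HasInput G α q m) (hs : Same p m m')
    (h0 : p.writesNat 0 = false := by rfl) (h1 : p.writesNat 1 = false := by rfl)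
    (h2 : p.writesReal 0 = false := by rfl) (h3 : p.writesReal 1 = false := by rfl) :
    HasInput G α q m' where
  size := by rw [hs.nat 0 h0]; exact h.size
  adj := by rw [hs.nat 1 h1]; exact h.adj
  damp := by rw [hs.real 0 h2]; exact h.damp
  jump := by rw [hs.real 1 h3]; exact h.jump

/-- Array `4` holds the powers of two. -/
def HasPow (n : ℕ) (m : Memory) : Prop := ∀ i ≤ n, m.nat 4 0 i = 2 ^ i

theorem pow_ends (hn : m.nat 0 0 0 = n) (hn1 : 1 ≤ n) :
    Ends powProg m (100 * n) (HasPow n) := by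
  refine Ends.seq_mul (c := 4) (c' := 90) (by simp) (Q := fun m' => m'.nat 4 0 0 = 1)
    (Ends.of_flat_mul rfl (by decide) hn1 (by simp)) fun m1 s1 h1 => ?_
  refine Ends.forTo_mul (c := 20) (fun i m => ∀ j ≤ i, m.nat 4 0 j = 2 ^ j) (by decide) le_rfl hn1
    le_rfl (mul_one n) (fun m2 s2 => ?_) rfl (fun i m2 k h => by simpa using h) (by simpa using h1)
    fun i hi m2 s2 hx h => Ends.of_flat_mul rfl (by decide) le_rfl fun j hj => ?_
  · simp [s2.nat 0 rfl, s1.nat 0 rfl, hn]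
  · by_cases hji : j = i + 1
    · subst hji
      simp [hx, h i le_rfl, pow_succ]
      ring
    · simpa [hx, hji] using h j (by omega)

/-- The code of a set of vertices. -/
def code (S : Finset (Fin n)) : ℕ := ∑ w ∈ S, 2 ^ (w : ℕ)

/-- The vertices of `S` with number less than `p`. -/
def below (S : Finset (Fin n)) (p : ℕ) : Finset (Fin n) := S.filter fun w : Fin n => (w : ℕ) < p

/-- This lets a comparison with `2 ^ p` reveal bit `p` once the higher bits have been subtracted;
the machine has no division of natural numbers. -/
theorem code_below_lt (S : Finset (Fin n)) (p : ℕ) : code (below S p) < 2 ^ p := by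
  have h := Finset.sum_image (s := below S p) (f := fun i => 2 ^ i) (Fin.val_injective.injOn)
  rw [code, ← h]
  exact Nat.geomSum_lt le_rfl fun k hk => by
    simp only [below, Finset.mem_image, Finset.mem_filter] at hk
    obtain ⟨x, hx, rfl⟩ := hk
    exact hx.2

theorem below_succ (S : Finset (Fin n)) {p : ℕ} (hp : p < n) :
    below S (p + 1) = if ⟨p, hp⟩ ∈ S then insert ⟨p, hp⟩ (below S p) else below S p := by
  ext w
  have : (w : ℕ) < p + 1 ↔ w = ⟨p, hp⟩ ∨ (w : ℕ) < p := by
    rw [Fin.ext_iff]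
    simp only
    omega
  split_ifs with h <;> simp only [below, Finset.mem_filter, Finset.mem_insert, this]
  · constructor
    · tauto
    · rintro (rfl | h')
      · exact ⟨h, Or.inl rfl⟩
      · tauto
  · constructor
    · rintro ⟨h1, rfl | h2⟩
      · exact absurd h1 h
      · exact ⟨h1, h2⟩
    · tauto

theorem code_insert {S : Finset (Fin n)} {w : Fin n} (h : w ∉ S) :
    code (insert w S) = 2 ^ (w : ℕ) + code S := Finset.sum_insert h

theorem code_below_succ (S : Finset (Fin n)) {p : ℕ} (hp : p < n) :
    code (below S (p + 1)) = (if ⟨p, hp⟩ ∈ S then 2 ^ p else 0) + code (below S p) := by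
  rw [below_succ S hp]
  split_ifs
  · rw [code_insert (by simp [below])]
  · simp

theorem below_zero (S : Finset (Fin n)) : below S 0 = ∅ := by simp [below]

theorem below_self (S : Finset (Fin n)) : below S n = S := by simp [below]

/-- Array `X` holds in row `0` the indicator of `S`. -/
def HasSet (X : ℕ) (S : Finset (Fin n)) (m : Memory) : Prop :=
  ∀ w : Fin n, m.nat X 0 w = if w ∈ S then 1 else 0

/-- Bits are extracted greedily from the highest down. The array is restricted to the two that are
used, so that after a case split the syntactic frame conditions evaluate. -/
theorem decode_ends {X : ℕ} (hX : X = 3 ∨ X = 9) (hn : m.nat 0 0 0 = n) (hn1 : 1 ≤ n)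
    (hp : HasPow n m) {S : Finset (Fin n)} (hS : m.nat 40 0 0 = code S) :
    Ends (decodeProg X) m (200 * n) (HasSet X S) := by
  refine Ends.mono (Ends.forTo_mul (C := 200) (F := n) (c := 60) (fun i m =>
      m.nat 40 0 0 = code (below S (n - i)) ∧
        ∀ w : Fin n, n - i ≤ w → m.nat X 0 w = if w ∈ S then 1 else 0)
    (by decide) le_rfl hn1 le_rfl (mul_one n) (fun m2 s2 => ?_) ?_ (fun i m2 k h => ?_) ?_
    fun i hi m2 s2 hx h => Ends.of_flat_mul ?_ ?_ le_rfl ?_) le_rfl fun m' _ h => ?_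
  · rcases hX with rfl | rfl <;> simp [s2.nat 0 rfl, hn]
  · rcases hX with rfl | rfl <;> rfl
  · rcases hX with rfl | rfl <;> simpa using h
  · simp [hS, below_self]
  · rcases hX with rfl | rfl <;> rfl
  · rcases hX with rfl | rfl <;> decide
  · obtain ⟨h1, h2⟩ := h
    have e0 : m2.nat 0 0 0 = n := by rcases hX with rfl | rfl <;> simp [s2.nat 0 rfl, hn]
    have e4 : HasPow n m2 := by
      rcases hX with rfl | rfl <;> simpa [HasPow, s2.nat 4 rfl] using hp
    have hp' : n - (i + 1) < n := by omega
    -- Round `i` treats bit `n - (i + 1)`.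
    rw [show n - i = n - (i + 1) + 1 by omega] at h1 h2
    rw [code_below_succ S hp'] at h1
    have hlt := code_below_lt S (n - (i + 1))
    have hpw := e4 _ hp'.le
    obtain ⟨p, hpe⟩ : ∃ p, n - (i + 1) = p := ⟨_, rfl⟩
    simp only [hpe] at h1 h2 hp' hlt hpw ⊢
    have key : ∀ w : Fin n, p ≤ w → ¬ p + 1 ≤ (w : ℕ) → w = ⟨p, hp'⟩ := fun w hw hw' => by
      rw [Fin.ext_iff]
      simp only
      omega
    by_cases hmem : (⟨p, hp'⟩ : Fin n) ∈ S
    · rw [if_pos hmem] at h1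
      rcases hX with rfl | rfl
      all_goals
        simp [e0, hx, hpe, hpw, h1]
        intro w hw
        by_cases hw' : p + 1 ≤ (w : ℕ)
        · rw [if_neg (by omega), h2 w hw']
        · rw [key w hw hw']
          simp [hmem]
    · rw [if_neg hmem, zero_add] at h1
      rcases hX with rfl | rfl
      all_goals
        simp [e0, hx, hpe, hpw, h1, hlt]
        intro w hw
        by_cases hw' : p + 1 ≤ (w : ℕ)
        · rw [if_neg (by omega), h2 w hw']
        · rw [key w hw hw']
          simp [hmem]
  · exact fun w => h.2 w (by omega)

end Specifications

/-! ### Setting up the linear system -/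

section Specifications

variable {n : ℕ} {G : SimpleGraph (Fin n)} {α : ℝ} {q : Fin n → ℝ} {m : Memory}

/-- Real array `2` holds the matrix of the walk killed at `v`, and the two right-hand sides. -/
structure HasSystem (G : SimpleGraph (Fin n)) (α : ℝ) (q : Fin n → ℝ) (v : ℕ)
    (R : Finset (Fin n)) (m : Memory) : Prop where
  row : ∀ i j : Fin n, m.real 2 i j = killed (graft G v R) v α i j
  jump : ∀ j : Fin n, m.real 2 n j = α * q j
  start : ∀ j : Fin n, m.real 2 (n + 1) j = (1 - α) * if j ∈ R then 1 else 0

theorem HasSet.same {X : ℕ} {S : Finset (Fin n)} {m' : Memory} {p : Program} (h : HasSet X S m)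
    (hs : Same p m m') (hX : p.writesNat X = false := by rfl) : HasSet X S m' := fun w => by
  rw [hs.nat X hX]; exact h w

theorem HasPow.same {m' : Memory} {p : Program} (h : HasPow n m)
    (hs : Same p m m') (hX : p.writesNat 4 = false := by rfl) : HasPow n m' := fun w => by
  rw [hs.nat 4 hX]; exact h w

open Classical in
/-- The indicator of the neighbours of `i`. -/
noncomputable def nbr (H : SimpleGraph (Fin n)) (i : Fin n) (j : ℕ) : ℕ :=
  if h : j < n then (if H.Adj i ⟨j, h⟩ then 1 else 0) else 0

open Classical in
theorem nbr_apply (H : SimpleGraph (Fin n)) (i j : Fin n) :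
    nbr H i j = if H.Adj i j then 1 else 0 := by
  simp [nbr]

open Classical in
theorem sum_nbr (H : SimpleGraph (Fin n)) (i : Fin n) :
    ∑ j ∈ Finset.range n, nbr H i j = H.degree i := by
  rw [Finset.sum_range]
  simp only [nbr_apply]
  rw [Finset.sum_boole, ← SimpleGraph.card_neighborFinset_eq_degree,
    SimpleGraph.neighborFinset_eq_filter, Nat.cast_id]

/-- Here `v` is a natural number rather than a vertex, so that `v = n` covers the original graph. -/
theorem build_ends (hn1 : 1 ≤ n) (hm : HasInput G α q m) {v : ℕ} (hv : m.nat 20 0 0 = v)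
    {R : Finset (Fin n)} (hR : HasSet 9 R m) (hvR : ∀ w ∈ R, (w : ℕ) ≠ v) :
    Ends buildProg m (1000 * (n * n)) (HasSystem G α q v R) := by
  classical
  set H := graft G v R with hH
  refine Ends.mono (Ends.forTo_mul (B := n) (f := n) (c := 470) (C := 1000) (F := n * n)
    (fun i m =>
      (∀ i' j : Fin n, (i' : ℕ) < i → m.real 2 i' j = killed H v α i' j) ∧
      ∀ j : Fin n, (j : ℕ) < i → m.real 2 n j = α * q j ∧
        m.real 2 (n + 1) j = (1 - α) * if j ∈ R then 1 else 0)
    (by decide) le_rfl hn1 hn1 rfl (fun m2 s2 => ?_) rfl (fun i m2 k h => by simpa using h)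
    (by simp) fun i hi m2 s2 hx h => ?_) le_rfl fun m' _ h => ?_
  · simp [(hm.same s2).size]
  · have hm2 := hm.same s2
    have hv2 : m2.nat 20 0 0 = v := by rw [s2.nat 20 rfl, hv]
    have hR2 := hR.same s2
    refine Ends.seq_mul (c := 10) (c' := 460) (by decide) (Q := fun m => m.nat 44 0 0 = 0)
      (Ends.of_flat_mul rfl (by decide) hn1 (by simp)) fun m3 s3 h3 => ?_
    refine Ends.seq_mul (c := 200) (c' := 250) (by decide)
      (Ends.forTo_mul (N := n) (B := n) (f := 1) (c := 80) (fun jj m =>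
        m.nat 44 0 0 = ∑ j ∈ Finset.range jj, nbr H ⟨i, hi⟩ j ∧
        ∀ j < jj, m.nat 10 i j = nbr H ⟨i, hi⟩ j) (by decide) le_rfl hn1 le_rfl (mul_one n)
        (fun m4 s4 => ?_) rfl (fun i m k h => by simpa using h) (by simpa using h3)
        fun jj hjj m4 s4 hjx h4 => ?_) fun m4 s4 h4 => ?_
    · simp [((hm2.same s3).same s4).size]
    · have hm4 := (hm2.same s3).same s4
      have hR4 := (hR2.same s3).same s4
      have hi4 : m4.nat 43 0 0 = i := by rw [s4.nat 43 rfl, s3.nat 43 rfl, hx]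
      have hv4 : m4.nat 20 0 0 = v := by rw [s4.nat 20 rfl, s3.nat 20 rfl, hv2]
      have z : (if i = v then m4.nat 9 0 jj else if jj = v then m4.nat 9 0 i
          else m4.nat 1 i jj) = nbr H ⟨i, hi⟩ jj := by
        have e1 := hR4 ⟨jj, hjj⟩
        have e2 := hR4 ⟨i, hi⟩
        have e3 := hm4.adj ⟨i, hi⟩ ⟨jj, hjj⟩
        simp only at e1 e2 e3
        rw [e1, e2, e3, nbr, dif_pos hjj]
        simp only [hH, graft, ne_eq, Fin.mk.injEq]
        by_cases hij : i = jj
        · subst hij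
          -- On the diagonal at `v` the code reads the indicator of `R`, which must vanish there;
          -- elsewhere on the diagonal it reads the adjacency matrix of `G`.
          have : i = v → (⟨i, hi⟩ : Fin n) ∉ R := fun h h' => hvR _ h' h
          by_cases hiv : i = v <;> simp [hiv]
          subst hiv
          simpa using this rfl
        · simp only [hij, not_false_eq_true, true_and]
          split_ifs <;> rfl
      refine Ends.of_flat_mul rfl (by decide) le_rfl ?_
      rw [← hv4] at z
      have z' : ((((Program.ite (.natEq (var 43) (var 20)) (setVar 46 (vec 9 (var 45)))
          (.ite (.natEq (var 45) (var 20)) (setVar 46 (vec 9 (var 43)))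
            (setVar 46 (.read 1 (var 43) (var 45)))))).exec m4).nat =
          (m4.setNat 46 0 0 (nbr H ⟨i, hi⟩ jj)).nat) := by
        rw [← z]
        by_cases c1 : i = m4.nat 20 0 0 <;> by_cases c2 : jj = m4.nat 20 0 0 <;>
          simp [hi4, hjx, c1, c2]
      rw [Program.exec]
      generalize Program.exec _ m4 = m5 at z'
      simp [z', hi4, hjx, h4.1, Finset.sum_range_succ]
      intro j hj
      by_cases hjj' : j = jj
      · simp [hjj']
      · simp [hjj', h4.2 j (by omega)]
    · have hm4 := (hm2.same s3).same s4
      have hR4 := (hR2.same s3).same s4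
      have hi4 : m4.nat 43 0 0 = i := by rw [s4.nat 43 rfl, s3.nat 43 rfl, hx]
      have hv4 : m4.nat 20 0 0 = v := by rw [s4.nat 20 rfl, s3.nat 20 rfl, hv2]
      have hr4 : m4.real 2 = m2.real 2 := by rw [s4.real 2 rfl, s3.real 2 rfl]
      obtain ⟨hd4, h4⟩ := h4
      rw [sum_nbr] at hd4
      refine Ends.seq_mul (c := 200) (c' := 50) (by decide)
        (Ends.forTo_mul (N := n) (B := n) (f := 1) (c := 80) (fun jj m =>
          (∀ i' j : Fin n, (i' : ℕ) < i → m.real 2 i' j = killed H v α i' j) ∧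
          (∀ j : Fin n, (j : ℕ) < i → m.real 2 n j = α * q j ∧
            m.real 2 (n + 1) j = (1 - α) * if j ∈ R then 1 else 0) ∧
          ∀ j : Fin n, (j : ℕ) < jj → m.real 2 i j = killed H v α ⟨i, hi⟩ j)
          (by decide) le_rfl hn1 le_rfl (mul_one n) (fun m5 s5 => ?_) rfl
          (fun i m k h => by simpa using h) (by simpa [hr4] using h)
          fun jj hjj m5 s5 hjx h5 => ?_) fun m5 s5 h5 => ?_
      · simp [(hm4.same s5).size]
      · have hm5 := hm4.same s5
        have hi5 : m5.nat 43 0 0 = i := by rw [s5.nat 43 rfl, hi4]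
        have hv5 : m5.nat 20 0 0 = v := by rw [s5.nat 20 rfl, hv4]
        have hd5 : m5.nat 44 0 0 = H.degree ⟨i, hi⟩ := by rw [s5.nat 44 rfl, hd4]
        have hz5 : m5.nat 10 i jj = nbr H ⟨i, hi⟩ jj := by rw [s5.nat 10 rfl, h4 jj hjj]
        refine Ends.of_flat_mul rfl (by decide) le_rfl ?_
        have hex : (Program.ite (.natEq (var 43) (var 20))
              (setReal 2 (var 43) (var 45) (.ofNat (lit 0)))
            (.ite (.natEq (var 44) (lit 0))
              (.ite (.natEq (var 43) (var 45))
                (setReal 2 (var 43) (var 45) (.sub (.ofNat (lit 1)) (.var 0)))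
                (setReal 2 (var 43) (var 45) (.ofNat (lit 0))))
              (setReal 2 (var 43) (var 45) (.mul (.sub (.ofNat (lit 1)) (.var 0))
                (.div (.ofNat (.read 10 (var 43) (var 45))) (.ofNat (var 44))))))).exec m5 =
            m5.setReal 2 i jj (killed H v α ⟨i, hi⟩ ⟨jj, hjj⟩) := by
          have e : nbr H ⟨i, hi⟩ jj = if H.Adj ⟨i, hi⟩ ⟨jj, hjj⟩ then 1 else 0 := by
            simp [nbr, hjj]
          simp only [killed, walk]
          by_cases c1 : i = v
          · simp [hi5, hv5, hjx, c1]
          by_cases c2 : H.degree ⟨i, hi⟩ = 0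
          · by_cases c3 : i = jj
            · have c4 : jj ≠ v := c3 ▸ c1
              simp [hi5, hv5, hjx, hd5, c2, c3, c4, hm5.damp]
            · simp [hi5, hv5, hjx, c1, hd5, c2, c3]
          · by_cases c3 : H.Adj ⟨i, hi⟩ ⟨jj, hjj⟩ <;>
              simp [hi5, hv5, hjx, c1, hd5, c2, c3, hm5.damp, hz5, e]
        rw [hex]
        refine ⟨fun i' j hi' => ?_, fun j hj => ?_, fun j hj => ?_⟩
        · have := h5.1 i' j hi'
          simpa [hi'.ne] using this
        · have := h5.2.1 j hj
          simpa [hi.ne', show n + 1 ≠ i by omega] using this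
        · by_cases hj' : (j : ℕ) = jj
          · obtain rfl : j = ⟨jj, hjj⟩ := Fin.ext hj'
            simp
          · simpa [hj'] using h5.2.2 j (by omega)
      · have hm5 := hm4.same s5
        have hi5 : m5.nat 43 0 0 = i := by rw [s5.nat 43 rfl, hi4]
        have hR5 : m5.nat 9 0 i = if (⟨i, hi⟩ : Fin n) ∈ R then 1 else 0 := (hR4.same s5) ⟨i, hi⟩
        have hq5 : m5.real 1 i 0 = q ⟨i, hi⟩ := hm5.jump ⟨i, hi⟩
        refine Ends.of_flat_mul rfl (by decide) hn1 ?_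
        refine ⟨fun i' j hi' => ?_, fun j hj => ?_⟩
        · have h1 : (i' : ℕ) ≠ n + 1 := by omega
          have h2 : (i' : ℕ) ≠ n := by omega
          simp [hm5.size, h1, h2]
          by_cases hi'' : (i' : ℕ) = i
          · obtain rfl : i' = ⟨i, hi⟩ := Fin.ext hi''
            exact h5.2.2 j j.2
          · exact h5.1 i' j (by omega)
        · simp [hm5.size, hi5, hm5.damp, hR5, hq5]
          by_cases hj' : (j : ℕ) = i
          · obtain rfl : j = ⟨i, hi⟩ := Fin.ext hj'
            simp
          · simpa [hj'] using h5.2.1 j (by omega)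
  · exact ⟨fun i j => h.1 i j i.2, fun j => (h.2 j j.2).1, fun j => (h.2 j j.2).2⟩

end Specifications

/-- Programs are nested to the right; rebracketing allows a specification of the first two pieces
jointly to be applied. -/
theorem Ends.assoc {p r s : Program} {m : Memory} {T : ℕ} {Q : Memory → Prop}
    (h : Ends (.seq (.seq p r) s) m T Q) : Ends (.seq p (.seq r s)) m T Q := by
  obtain ⟨m', t, h1, h2, h3⟩ := h
  cases h1 with
  | seq h4 h5 =>
    cases h4 with
    | seq h6 h7 => exact ⟨m', _, .seq h6 (.seq h7 h5), by omega, h3⟩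

/-! ### Solving the system, and the PageRank of the input graph -/

section Specifications

variable {n : ℕ} {G : SimpleGraph (Fin n)} {α : ℝ} {q : Fin n → ℝ} {m : Memory}

theorem solve_ends (hn1 : 1 ≤ n) (hn : m.nat 0 0 0 = n) :
    Ends solveProg m (3000 * (n * (n * n))) fun m' =>
      ∀ i < n + 2, ∀ j < n, m'.real 2 i j = elims (m.real 2) n i j := by
  set M := m.real 2 with hM
  refine (Ends.forTo_mul (B := n) (f := 3 * n * n) (c := 400) (C := 1000) (F := n * (3 * n * n))
    (fun p m' => ∀ i < n + 2, ∀ j < n, m'.real 2 i j = elims M p i j)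
    (by decide) le_rfl hn1 (by nlinarith) rfl (fun m2 s2 => ?_) rfl
    (fun i m2 k h => by simpa using h)
    (by simp [elims, hM]) fun p hp m2 s2 hx h => ?_).le (by nlinarith)
  · simp [s2.nat 0 rfl, hn]
  have hn2 : m2.nat 0 0 0 = n := by rw [s2.nat 0 rfl, hn]
  -- The rows are the `n` rows of the matrix and two right-hand sides; `n + 2 ≤ 3 * n` as `n` is
  -- positive.
  refine Ends.mono (Ends.forTo_mul (N := n + 2) (B := 3 * n) (f := n) (c := 160)
    (fun i' m' => ∀ i < n + 2, ∀ j < n,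
      m'.real 2 i j = if i < i' then elims M (p + 1) i j else elims M p i j)
    (by decide) (by omega) (by omega) hn1 rfl (fun m3 s3 => ?_) rfl
    (fun i m2 k h => by simpa using h)
    (by simpa using h) fun i hi m3 s3 hy h3 => ?_) le_rfl fun m' _ h' i hi j hj => ?_
  · simp [s3.nat 0 rfl, hn2]
  · have hp3 : m3.nat 47 0 0 = p := by rw [s3.nat 47 rfl, hx]
    have hn3 : m3.nat 0 0 0 = n := by rw [s3.nat 0 rfl, hn2]
    have hdec : ∀ i' : ℕ, i' < i + 1 ↔ i' < i ∨ i' = i := fun i' => by omega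
    refine Ends.ite_mul (c := 130) (by decide) hn1 (fun hlt => ?_) fun hlt => ?_
    · simp only [Test.Holds, NatExpr.eval, hp3, hy] at hlt
      -- The entry in column `p` is saved first, since the inner loop overwrites it when it reaches
      -- that column.
      refine Ends.seq_mul (c := 10) (c' := 120) (by decide)
        (Q := fun m => m.real 10 0 0 = elims M p i p ∧ ∀ i' < n + 2, ∀ j < n,
          m.real 2 i' j = if i' < i then elims M (p + 1) i' j else elims M p i' j)
        (Ends.of_flat_mul rfl (by decide) hn1 ?_) fun m4 s4 h4 => ?_
      · have := h3 i hi p hp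
        rw [if_neg (lt_irrefl i)] at this
        simpa [hp3, hy, this] using h3
      · have hp4 : m4.nat 47 0 0 = p := by rw [s4.nat 47 rfl, hp3]
        have hy4 : m4.nat 48 0 0 = i := by rw [s4.nat 48 rfl, hy]
        refine Ends.mono (Ends.forTo_mul (N := n) (B := n) (f := 1) (c := 40)
          (fun jj m' => m'.real 10 0 0 = elims M p i p ∧ ∀ i' < n + 2, ∀ j < n,
            m'.real 2 i' j = if i' < i ∨ i' = i ∧ j < jj then elims M (p + 1) i' j
              else elims M p i' j)
          (by decide) le_rfl hn1 le_rfl (mul_one n) (fun m5 s5 => ?_) rfl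
          (fun i m2 k h => by simpa using h) (by simpa using h4)
          fun jj hjj m5 s5 hz h5 => Ends.of_flat_mul rfl (by decide) le_rfl ?_) le_rfl
          fun m' _ h' i' hi' j hj => ?_
        · simp [s5.nat 0 rfl, s4.nat 0 rfl, hn3]
        · have hp5 : m5.nat 47 0 0 = p := by rw [s5.nat 47 rfl, hp4]
          have hy5 : m5.nat 48 0 0 = i := by rw [s5.nat 48 rfl, hy4]
          have e1 := h5.2 i hi jj hjj
          rw [if_neg (by omega)] at e1
          -- The pivot row has already been passed, but eliminating `p` leaves row `p` unchanged, so
          -- working in place is sound.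
          have e2 : ∀ j < n, m5.real 2 p j = elims M p p j := fun j hj => by
            have := h5.2 p (by omega) j hj
            rw [if_pos (Or.inl hlt)] at this
            rw [this, elims, elim, if_neg (lt_irrefl p)]
          have e3 : elims M (p + 1) i jj = elims M p i jj +
              elims M p i p * elims M p p jj / (1 - elims M p p p) := by
            rw [elims, elim, if_pos hlt]
          refine ⟨by simpa using h5.1, fun i' hi' j hj => ?_⟩
          by_cases c : i' = i ∧ j = jj
          · obtain ⟨rfl, rfl⟩ := c
            simp [hp5, hy5, hz, e1, e2 j hj, e2 p hp, h5.1, e3]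
          · have c' : (i' < i ∨ i' = i ∧ j < jj + 1) ↔ (i' < i ∨ i' = i ∧ j < jj) := by omega
            simp only [c']
            rw [← h5.2 i' hi' j hj]
            simp [hy5, hz]
            intro h1 h2
            exact absurd ⟨h1, h2⟩ c
        · rw [h'.2 i' hi' j hj]
          simp only [hdec, hj, and_true]
    · simp only [Test.Holds, NatExpr.eval, hp3, hy] at hlt
      refine Ends.skip_mul (by decide) hn1 fun i' hi' j hj => ?_
      rw [h3 i' hi' j hj]
      by_cases c : i' = i
      · subst c
        simp [elims, elim, hlt]
      · simp only [hdec, c, or_false]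
  · rw [h' i hi j hj, if_pos hi]

/-- Rows `n` and `n + 1` of real array `2` hold the solutions. -/
def HasValues (G : SimpleGraph (Fin n)) (α : ℝ) (q : Fin n → ℝ) (v : ℕ)
    (R : Finset (Fin n)) (m : Memory) : Prop :=
  ∀ j : Fin n, m.real 2 n j = fromJump G α q v R j ∧ m.real 2 (n + 1) j = fromStart G α v R j

theorem HasValues.same {v : ℕ} {R : Finset (Fin n)} {m' : Memory} {p : Program}
    (h : HasValues G α q v R m) (hs : Same p m m') (hX : p.writesReal 2 = false := by rfl) :
    HasValues G α q v R m' := fun w => by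
  rw [hs.real 2 hX]; exact h w

theorem build_solve_ends (hn1 : 1 ≤ n) (h0 : 0 < α) (h1 : α < 1) (hm : HasInput G α q m) {v : ℕ}
    (hv : m.nat 20 0 0 = v) {R : Finset (Fin n)} (hR : HasSet 9 R m)
    (hvR : ∀ w ∈ R, (w : ℕ) ≠ v) :
    Ends (.seq buildProg solveProg) m (4000 * (n * (n * n))) (HasValues G α q v R) := by
  refine Ends.seq_mul (c := 1000) (c' := 3000) (by decide)
    ((build_ends hn1 hm hv hR hvR).le (by nlinarith [Nat.mul_le_mul hn1 (le_refl (n * n))]))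
    fun m2 s2 h2 => ?_
  refine (solve_ends hn1 (hm.same s2).size).mono le_rfl fun m3 _ h3 j => ⟨?_, ?_⟩
  · rw [h3 n (by omega) j j.2]
    exact elims_eq_sol (isSub_killed _ _ h1) (by linarith) h2.row le_rfl h2.jump j
  · rw [h3 (n + 1) (by omega) j j.2]
    exact elims_eq_sol (isSub_killed _ _ h1) (by linarith) h2.row (by omega) h2.start j

/-- Real array `3` holds the PageRank. -/
def HasRank (G : SimpleGraph (Fin n)) (α : ℝ) (q : Fin n → ℝ) (m : Memory) : Prop :=
  ∀ j : Fin n, m.real 3 0 j = pageRank G α q j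

theorem HasRank.same {m' : Memory} {p : Program} (h : HasRank G α q m) (hs : Same p m m')
    (hX : p.writesReal 3 = false := by rfl) : HasRank G α q m' := fun w => by
  rw [hs.real 3 hX]; exact h w

theorem rank_ends (hn1 : 1 ≤ n) (h0 : 0 < α) (h1 : α < 1) (hq : IsDistribution q)
    (hm : HasInput G α q m) (h9 : HasSet 9 (∅ : Finset (Fin n)) m) :
    Ends rankProg m (5000 * (n * (n * n))) (HasRank G α q) := by
  have hf : 1 ≤ n * (n * n) := Nat.mul_pos hn1 (Nat.mul_pos hn1 hn1)
  refine Ends.seq_mul (c := 10) (c' := 4500) (by decide) (Q := fun m' => m'.nat 20 0 0 = n)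
    (Ends.of_flat_mul rfl (by decide) hf (by simp [hm.size])) fun m1 s1 e1 => ?_
  refine Ends.assoc (Ends.seq_mul (c := 4000) (c' := 200) (by decide)
    (build_solve_ends hn1 h0 h1 (hm.same s1) e1 (h9.same s1) (by simp)) fun m2 s2 e2 => ?_)
  have hm2 := (hm.same s1).same s2
  refine (Ends.forTo_mul (N := n) (B := n) (f := 1) (c := 60) (C := 200)
    (fun i m => HasValues G α q n ∅ m ∧ ∀ j : Fin n, (j : ℕ) < i → m.real 3 0 j = pageRank G α q j)
    (by decide) le_rfl hn1 le_rfl rfl (fun m3 s3 => ?_) rfl (fun i m k h => by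
      simpa [HasValues] using h) (by simpa using e2) fun i hi m3 s3 hx h =>
      Ends.of_flat_mul rfl (by decide) le_rfl ?_).mono ?_ fun m' _ h j => h.2 j j.2
  · simp [(hm2.same s3).size]
  · have hm3 := hm2.same s3
    refine ⟨by simpa [HasValues] using h.1, fun j hj => ?_⟩
    have := (h.1 ⟨i, hi⟩).1
    simp only at this
    by_cases hji : (j : ℕ) = i
    · obtain rfl : j = ⟨i, hi⟩ := Fin.ext hji
      simp [hx, hm3.size, this, fromJump, graft_self, pageRank_eq_sol G h0 h1 hq]
    · simpa [hx, hji] using h.2 j (by omega)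
  · nlinarith [Nat.mul_le_mul (le_refl n) (Nat.mul_le_mul hn1 hn1)]

end Specifications

/-! ### Labelling the components of `G - v` -/

section Specifications

variable {n : ℕ} {G : SimpleGraph (Fin n)} {α : ℝ} {q : Fin n → ℝ} {m : Memory} {v : Fin n}

/-- `x` and `y` are connected in `G - v`, or equal. -/
def Linked (G : SimpleGraph (Fin n)) (v x y : Fin n) : Prop := x = y ∨ Joined G {v}ᶜ x y

theorem Linked.symm {x y : Fin n} (h : Linked G v x y) : Linked G v y x :=
  h.imp Eq.symm Joined.symm

theorem Linked.trans {x y z : Fin n} (h : Linked G v x y) (h' : Linked G v y z) :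
    Linked G v x z := by
  rcases h with rfl | h
  · exact h'
  · rcases h' with rfl | h'
    · exact Or.inr h
    · exact Or.inr (h.trans h')

/-- `comp` labels the components of `G - v`. -/
structure IsLabel (G : SimpleGraph (Fin n)) (v : Fin n) (comp : Fin n → ℕ) : Prop where
  lt : ∀ w, comp w < n
  edge : ∀ x y, G.Adj x y → x ≠ v → y ≠ v → comp x = comp y
  linked : ∀ x y, comp x = comp y → Linked G v x y

/-- `f` labels the components of `G - v`, where only the edges in `P` have been considered. -/
structure IsPartialLabel (G : SimpleGraph (Fin n)) (v : Fin n) (P : Fin n → Fin n → Prop)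
    (f : ℕ → ℕ) : Prop where
  lt : ∀ w : Fin n, f w < n
  edge : ∀ x y : Fin n, P x y → G.Adj x y → x ≠ v → y ≠ v → f x = f y
  linked : ∀ x y : Fin n, f x = f y → Linked G v x y

theorem IsPartialLabel.mono {P P' : Fin n → Fin n → Prop} {f : ℕ → ℕ}
    (h : IsPartialLabel G v P f)
    (hP : ∀ x y : Fin n, P' x y → G.Adj x y → x ≠ v → y ≠ v → P x y) :
    IsPartialLabel G v P' f :=
  ⟨h.lt, fun x y h1 h2 h3 h4 => h.edge x y (hP x y h1 h2 h3 h4) h2 h3 h4, h.linked⟩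

/-- The new label is a function of the old one, so pairs with equal labels stay equal; pairs that
become equal are linked through the edge from `x` to `y`. -/
theorem IsPartialLabel.merge {P : Fin n → Fin n → Prop} {f g : ℕ → ℕ}
    (h : IsPartialLabel G v P f) {x y : Fin n} (hxy : G.Adj x y) (hx : x ≠ v) (hy : y ≠ v)
    (hg : ∀ w : Fin n, g w = if f w = f x then f y else f w) :
    IsPartialLabel G v (fun x' y' => P x' y' ∨ x' = x ∧ y' = y) g := by
  have hl : Linked G v x y := Or.inr (Joined.of_adj hxy hx hy)
  refine ⟨fun w => ?_, fun a b hab h1 h2 h3 => ?_, fun a b hab => ?_⟩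
  · rw [hg]
    split_ifs
    · exact h.lt y
    · exact h.lt w
  · rcases hab with hab | ⟨rfl, rfl⟩
    · rw [hg, hg, h.edge a b hab h1 h2 h3]
    · rw [hg, hg]
      simp
  · rw [hg, hg] at hab
    split_ifs at hab with c1 c2 c2
    · exact (h.linked a x c1).trans (h.linked b x c2).symm
    · exact ((h.linked a x c1).trans hl).trans (h.linked y b hab)
    · exact ((h.linked a y hab).trans hl.symm).trans (h.linked b x c2).symm
    · exact h.linked a b hab

/-- Row `0` of array `5` holds the labels of the components. -/
def HasComp (comp : Fin n → ℕ) (m : Memory) : Prop := ∀ w : Fin n, m.nat 5 0 w = comp w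

theorem HasComp.same {comp : Fin n → ℕ} {m' : Memory} {p : Program} (h : HasComp comp m)
    (hs : Same p m m') (hX : p.writesNat 5 = false := by rfl) : HasComp comp m' := fun w => by
  rw [hs.nat 5 hX]; exact h w

/-- Each ordered pair of vertices is processed once, in lexicographic order, merging two classes by
a full pass over the labels. Edges at `v` are skipped, so `v` remains alone with its label; hence `u
= v` can stand for no added edge, with an empty set of neighbours in its class. -/
theorem comp_ends (hn1 : 1 ≤ n) (hm : HasInput G α q m) (hv : m.nat 20 0 0 = v) :
    Ends compProg m (1000 * (n * (n * n))) fun m' =>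
      ∃ comp : Fin n → ℕ, IsLabel G v comp ∧ HasComp comp m' := by
  have hnn : n ≤ n * (n * n) := Nat.le_mul_of_pos_right n (Nat.mul_pos hn1 hn1)
  refine Ends.seq_mul (c := 60) (c' := 900) (by decide)
    (Q := fun m' => IsPartialLabel G v (fun _ _ => False) (m'.nat 5 0))
    (((Ends.forTo_mul (N := n) (B := n) (f := 1) (c := 10) (C := 60)
    (fun i m => ∀ w < i, m.nat 5 0 w = w)
    (by decide) le_rfl hn1 le_rfl rfl (fun m1 s1 => ?_) rfl (fun i m k h => by
      simpa using h) (by simp) fun i hi m1 s1 hx h =>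
      Ends.of_flat_mul rfl (by decide) le_rfl fun w hw => ?_).mono (by omega)
      fun m' _ h => ⟨fun w => ?_, fun x y h => h.elim, fun x y h1 => ?_⟩)) fun m1 s1 h1 => ?_
  · simp [(hm.same s1).size]
  · by_cases hwi : w = i
    · simp [hwi, hx]
    · simpa [hx, hwi] using h w (by omega)
  · rw [h w w.2]; exact w.2
  · rw [h x x.2, h y y.2] at h1
    exact Or.inl (Fin.ext h1)
  have hm1 := hm.same s1
  have hv1 : m1.nat 20 0 0 = v := by rw [s1.nat 20 rfl, hv]
  refine (Ends.forTo_mul (N := n) (B := n) (f := n * n) (c := 400)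
    (fun i m => IsPartialLabel G v (fun x _ => (x : ℕ) < i) (m.nat 5 0))
    (by decide) le_rfl hn1 (Nat.mul_pos hn1 hn1) rfl (fun m2 s2 => ?_) rfl
    (fun i m k h => by simpa using h) (h1.mono (by simp))
    fun i hi m2 s2 hx h2 => ?_).mono le_rfl fun m' _ h =>
      ⟨fun w => m'.nat 5 0 w, ⟨h.lt, fun x y => h.edge x y x.2, h.linked⟩, fun w => rfl⟩
  · simp [(hm1.same s2).size]
  have hm2 := hm1.same s2
  have hv2 : m2.nat 20 0 0 = v := by rw [s2.nat 20 rfl, hv1]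
  refine (Ends.forTo_mul (N := n) (B := n) (f := n) (c := 180)
    (fun j m => IsPartialLabel G v (fun x y => (x : ℕ) < i ∨ (x : ℕ) = i ∧ (y : ℕ) < j)
      (m.nat 5 0))
    (by decide) le_rfl hn1 hn1 rfl (fun m3 s3 => ?_) rfl
    (fun i m k h => by simpa using h) (h2.mono (by simp +contextual))
    fun j hj m3 s3 hy h3 => ?_).mono le_rfl fun m' _ h => h.mono ?_
  · simp [(hm2.same s3).size]
  · have hm3 := hm2.same s3
    have hv3 : m3.nat 20 0 0 = v := by rw [s3.nat 20 rfl, hv2]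
    have hx3 : m3.nat 51 0 0 = i := by rw [s3.nat 51 rfl, hx]
    have hadj := hm3.adj ⟨i, hi⟩ ⟨j, hj⟩
    simp only at hadj
    refine Ends.ite_mul (c := 150) (by decide) hn1 (fun hc => ?_) fun hc => ?_
    · simp only [Test.Holds, NatExpr.eval, hx3, hy, hv3, hadj] at hc
      obtain ⟨c1, c2, c3⟩ := hc
      have c1' : G.Adj ⟨i, hi⟩ ⟨j, hj⟩ := by
        by_contra hne
        simp [hne] at c1
      -- Both labels are copied before the pass, because the label of `i` changes during it.
      refine Ends.seq_mul (c := 10) (c' := 140) (by decide)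
        (Q := fun m => m.nat 53 0 0 = m3.nat 5 0 i)
        (Ends.of_flat_mul rfl (by decide) hn1 (by simp [hx3])) fun m4 s4 h4 => ?_
      refine Ends.seq_mul (c := 10) (c' := 130) (by decide)
        (Q := fun m => m.nat 54 0 0 = m3.nat 5 0 j)
        (Ends.of_flat_mul rfl (by decide) hn1 (by simp [s4.nat 52 rfl, s4.nat 5 rfl, hy]))
        fun m5 s5 h5 => ?_
      have e53 : m5.nat 53 0 0 = m3.nat 5 0 i := by rw [s5.nat 53 rfl, h4]
      have e5 : m5.nat 5 = m3.nat 5 := by rw [s5.nat 5 rfl, s4.nat 5 rfl]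
      refine (Ends.forTo_mul (N := n) (B := n) (f := 1) (c := 40)
        (fun k m => ∀ w : ℕ, m.nat 5 0 w =
          if w < k ∧ m3.nat 5 0 w = m3.nat 5 0 i then m3.nat 5 0 j else m3.nat 5 0 w)
        (by decide) le_rfl hn1 le_rfl (mul_one n) (fun m6 s6 => ?_) rfl
        (fun i m k h => by simpa using h) (by simp [e5])
        fun k hk m6 s6 hz h6 => Ends.of_flat_mul rfl (by decide) le_rfl ?_).mono le_rfl
          fun m' _ h => ?_
      · simp [(((hm3.same s4).same s5).same s6).size]
      · have e53' : m6.nat 53 0 0 = m3.nat 5 0 i := by rw [s6.nat 53 rfl, e53]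
        have e54' : m6.nat 54 0 0 = m3.nat 5 0 j := by rw [s6.nat 54 rfl, h5]
        have ek := h6 k
        simp only [lt_irrefl, false_and, if_false] at ek
        intro w
        by_cases hw : w = k
        · subst hw
          by_cases c : m3.nat 5 0 w = m3.nat 5 0 i <;> simp [hz, ek, e53', e54', c]
        · have c' : w < k + 1 ↔ w < k := by omega
          simp only [c']
          rw [← h6 w]
          by_cases c : m3.nat 5 0 k = m3.nat 5 0 i <;> simp [hz, ek, e53', e54', c, hw]
      · refine (h3.merge (g := m'.nat 5 0) c1' (fun h => c2 (Fin.ext_iff.1 h))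
          (fun h => c3 (Fin.ext_iff.1 h)) fun w => ?_).mono fun x y hxy _ _ _ => ?_
        · rw [h w]; simp
        · simp only [Fin.ext_iff]
          omega
    · refine Ends.skip_mul (by decide) hn1 (h3.mono fun x y hxy h4 h5 h6 => ?_)
      by_contra hno
      have hxi : x = ⟨i, hi⟩ := Fin.ext (by simp only; omega)
      have hyj : y = ⟨j, hj⟩ := Fin.ext (by simp only; omega)
      subst hxi hyj
      refine hc ?_
      simp only [Test.Holds, NatExpr.eval, hx3, hy, hv3, hadj, if_pos h4, true_and]
      exact ⟨fun h => h5 (Fin.ext h), fun h => h6 (Fin.ext h)⟩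
  · intro x y hxy _ _ _
    omega

end Specifications

/-! ### Tables of the sets of neighbours in each component -/

section Specifications

variable {n : ℕ} {G : SimpleGraph (Fin n)} {α : ℝ} {q : Fin n → ℝ} {m : Memory} {v : Fin n}

open Classical in
/-- The neighbours of `v` with label `c`. -/
noncomputable def nbrs (G : SimpleGraph (Fin n)) (v : Fin n) (comp : Fin n → ℕ) (c : ℕ) :
    Finset (Fin n) := Finset.univ.filter fun w => G.Adj v w ∧ comp w = c

theorem mem_nbrs {comp : Fin n → ℕ} {c : ℕ} {w : Fin n} :
    w ∈ nbrs G v comp c ↔ G.Adj v w ∧ comp w = c := by simp [nbrs]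

/-- The source of the bound `2 ^ param G` for the number of options in a component. -/
theorem IsLabel.card_nbrs_le {comp : Fin n → ℕ} (h : IsLabel G v comp) (c : ℕ) :
    (nbrs G v comp c).card ≤ param G := by
  refine card_le_param (v := v) (fun w hw => (mem_nbrs.1 hw).1) fun w hw w' hw' => ?_
  rw [mem_nbrs] at hw hw'
  rcases h.linked w w' (hw.2.trans hw'.2.symm) with rfl | h
  · exact Joined.refl hw.1.ne'
  · exact h

/-- Arrays `6`, `7` and `8` list all subsets of `N c`, for `c < n`. -/
structure HasTable (N : ℕ → Finset (Fin n)) (opt : ℕ → ℕ → Finset (Fin n)) (m : Memory) :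
    Prop where
  cnt : ∀ c < n, m.nat 6 0 c = 2 ^ (N c).card
  zero : ∀ c < n, opt c 0 = ∅
  sub : ∀ c < n, ∀ j < 2 ^ (N c).card, opt c j ⊆ N c
  surj : ∀ c < n, ∀ S ⊆ N c, ∃ j < 2 ^ (N c).card, opt c j = S
  code : ∀ c < n, ∀ j < 2 ^ (N c).card, m.nat 7 c j = code (opt c j)
  size : ∀ c < n, ∀ j < 2 ^ (N c).card, m.nat 8 c j = (opt c j).card

theorem HasTable.same {N : ℕ → Finset (Fin n)} {opt : ℕ → ℕ → Finset (Fin n)} {m' : Memory}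
    {p : Program} (h : HasTable N opt m) (hs : Same p m m')
    (h6 : p.writesNat 6 = false := by rfl) (h7 : p.writesNat 7 = false := by rfl)
    (h8 : p.writesNat 8 = false := by rfl) : HasTable N opt m' where
  cnt := by rw [hs.nat 6 h6]; exact h.cnt
  zero := h.zero
  sub := h.sub
  surj := h.surj
  code := by rw [hs.nat 7 h7]; exact h.code
  size := by rw [hs.nat 8 h8]; exact h.size

/-- A new neighbour `w` doubles the list of its component: the second half repeats the first with
`w` added. Entry `0` stays the empty set. -/
theorem HasTable.insert {N N' : ℕ → Finset (Fin n)} {opt : ℕ → ℕ → Finset (Fin n)}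
    {m m' : Memory} (h : HasTable N opt m) {w : Fin n} {c₀ : ℕ} (hw : w ∉ N c₀)
    (hN : ∀ c, N' c = if c = c₀ then insert w (N c) else N c)
    (h6 : ∀ c < n, m'.nat 6 0 c =
      if c = c₀ then 2 ^ (N c₀).card + 2 ^ (N c₀).card else m.nat 6 0 c)
    (h7 : ∀ c j, m'.nat 7 c j =
      if c = c₀ ∧ 2 ^ (N c₀).card ≤ j ∧ j < 2 ^ (N c₀).card + 2 ^ (N c₀).card then
        m.nat 7 c₀ (j - 2 ^ (N c₀).card) + 2 ^ (w : ℕ) else m.nat 7 c j)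
    (h8 : ∀ c j, m'.nat 8 c j =
      if c = c₀ ∧ 2 ^ (N c₀).card ≤ j ∧ j < 2 ^ (N c₀).card + 2 ^ (N c₀).card then
        m.nat 8 c₀ (j - 2 ^ (N c₀).card) + 1 else m.nat 8 c j) :
    HasTable N' (fun c j => if c = c₀ ∧ 2 ^ (N c₀).card ≤ j then
      insert w (opt c₀ (j - 2 ^ (N c₀).card)) else opt c j) m' := by
  set H := 2 ^ (N c₀).card with hH
  have hH1 : 1 ≤ H := Nat.one_le_two_pow
  have hcard : ∀ c, 2 ^ (N' c).card = if c = c₀ then H + H else 2 ^ (N c).card := fun c => by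
    rw [hN]
    split_ifs with h
    · subst h
      rw [Finset.card_insert_of_notMem hw, pow_succ, hH]
      ring
    · rfl
  have entry : ∀ c < n, ∀ j < 2 ^ (N' c).card,
      (c = c₀ ∧ H ≤ j ∧ j < H + H ∧ j - H < H) ∨ (¬ (c = c₀ ∧ H ≤ j) ∧ j < 2 ^ (N c).card) := by
    intro c hc j hj
    rw [hcard] at hj
    by_cases h1 : c = c₀
    · subst h1
      rw [if_pos rfl] at hj
      by_cases h2 : H ≤ j
      · exact Or.inl ⟨rfl, h2, hj, by omega⟩
      · exact Or.inr ⟨fun h => h2 h.2, by omega⟩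
    · rw [if_neg h1] at hj
      exact Or.inr ⟨fun h => h1 h.1, hj⟩
  refine ⟨fun c hc => ?_, fun c hc => ?_, fun c hc j hj => ?_, fun c hc S hS => ?_,
    fun c hc j hj => ?_, fun c hc j hj => ?_⟩
  · rw [h6 c hc, hcard]
    split_ifs
    · rfl
    · exact h.cnt c hc
  · rw [if_neg (by omega)]
    exact h.zero c hc
  · rcases entry c hc j hj with ⟨rfl, h1, h2, h3⟩ | ⟨h1, h2⟩
    · rw [if_pos ⟨rfl, h1⟩, hN, if_pos rfl]
      exact Finset.insert_subset_insert w (h.sub c hc _ h3)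
    · rw [if_neg h1, hN]
      have := h.sub c hc j h2
      split_ifs
      · exact this.trans (Finset.subset_insert _ _)
      · exact this
  · rw [hN] at hS
    rw [hcard]
    by_cases h1 : c = c₀
    · subst h1
      rw [if_pos rfl] at hS ⊢
      by_cases hwS : w ∈ S
      · obtain ⟨j, hj, hopt⟩ := h.surj c hc (S.erase w) (Finset.subset_insert_iff.1 hS)
        refine ⟨H + j, by omega, ?_⟩
        rw [if_pos ⟨rfl, by omega⟩, Nat.add_sub_cancel_left, hopt, Finset.insert_erase hwS]
      · obtain ⟨j, hj, hopt⟩ := h.surj c hc S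
          ((Finset.subset_insert_iff_of_notMem hwS).1 hS)
        exact ⟨j, by omega, by rw [if_neg (by omega), hopt]⟩
    · rw [if_neg h1] at hS ⊢
      obtain ⟨j, hj, hopt⟩ := h.surj c hc S hS
      exact ⟨j, hj, by rw [if_neg (fun h => h1 h.1), hopt]⟩
  · rcases entry c hc j hj with ⟨rfl, h1, h2, h3⟩ | ⟨h1, h2⟩
    · rw [h7, if_pos ⟨rfl, h1, h2⟩, if_pos ⟨rfl, h1⟩, h.code c hc _ h3, code_insert, add_comm]
      exact fun hmem => hw (h.sub c hc _ h3 hmem)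
    · rw [h7, if_neg (fun h => h1 ⟨h.1, h.2.1⟩), if_neg h1, h.code c hc j h2]
  · rcases entry c hc j hj with ⟨rfl, h1, h2, h3⟩ | ⟨h1, h2⟩
    · rw [h8, if_pos ⟨rfl, h1, h2⟩, if_pos ⟨rfl, h1⟩, h.size c hc _ h3,
        Finset.card_insert_of_notMem]
      exact fun hmem => hw (h.sub c hc _ h3 hmem)
    · rw [h8, if_neg (fun h => h1 ⟨h.1, h.2.1⟩), if_neg h1, h.size c hc j h2]

theorem table_ends (hn1 : 1 ≤ n) (hm : HasInput G α q m) (hv : m.nat 20 0 0 = v)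
    (hp : HasPow n m) {comp : Fin n → ℕ} (hl : IsLabel G v comp) (hc : HasComp comp m) {E : ℕ}
    (hE : ∀ c, 2 ^ (nbrs G v comp c).card ≤ E) :
    Ends tableProg m (1000 * (n * E)) fun m' => ∃ opt, HasTable (nbrs G v comp) opt m' := by
  have hE1 : 1 ≤ E := Nat.one_le_two_pow.trans (hE 0)
  refine Ends.seq_mul (c := 100) (c' := 900) (by decide)
    (Q := HasTable (fun _ => (∅ : Finset (Fin n))) fun _ _ => ∅)
    ((Ends.forTo_mul (N := n) (B := n) (f := 1) (c := 20) (C := 100) (F := n)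
      (fun i m => ∀ c < i, m.nat 6 0 c = 1 ∧ m.nat 7 c 0 = 0 ∧ m.nat 8 c 0 = 0)
      (by decide) le_rfl hn1 le_rfl (mul_one n) (fun m1 s1 => ?_) rfl (fun i m k h => by
      simpa using h) (by simp) fun i hi m1 s1 hx h =>
      Ends.of_flat_mul rfl (by decide) le_rfl fun c hc => ?_).mono
      (Nat.mul_le_mul_left _ (Nat.le_mul_of_pos_right n hE1)) fun m' _ h => ?_) fun m1 s1 h1 => ?_
  · simp [(hm.same s1).size]
  · by_cases hci : c = i
    · simp [hci, hx]
    · simpa [hx, hci] using h c (by omega)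
  · refine ⟨fun c hc => (h c hc).1, fun c _ => rfl, fun c _ j _ => le_rfl, fun c _ S hS => ?_,
      fun c hc j hj => ?_, fun c hc j hj => ?_⟩
    · exact ⟨0, by simp, (Finset.subset_empty.1 hS).symm⟩
    · obtain rfl : j = 0 := by simpa using hj
      simp [(h c hc).2.1, code]
    · obtain rfl : j = 0 := by simpa using hj
      simp [(h c hc).2.2]
  have hm1 := hm.same s1
  refine (Ends.forTo_mul (N := n) (B := n) (f := E) (c := 300)
    (fun i m => ∃ opt, HasTable (fun c => below (nbrs G v comp c) i) opt m)
    (by decide) le_rfl hn1 hE1 rfl (fun m2 s2 => ?_) rfl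
    (fun i m k h => ?_) ⟨_, by simpa only [below_zero] using h1⟩
    fun i hi m2 s2 hx h2 => ?_).mono le_rfl fun m' _ h => by simpa only [below_self] using h
  · simp [(hm1.same s2).size]
  · obtain ⟨opt, h⟩ := h
    exact ⟨opt, ⟨by simpa using h.cnt, h.zero, h.sub, h.surj, by simpa using h.code,
      by simpa using h.size⟩⟩
  obtain ⟨opt, h2⟩ := h2
  have hm2 := hm1.same s2
  have hv2 : m2.nat 20 0 0 = v := by rw [s2.nat 20 rfl, s1.nat 20 rfl, hv]
  have hc2 := (hc.same s1).same s2
  have hp2 := (hp.same s1).same s2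
  have hadj := hm2.adj v ⟨i, hi⟩
  simp only at hadj
  have hsucc : ∀ c, below (nbrs G v comp c) (i + 1) = if (⟨i, hi⟩ : Fin n) ∈ nbrs G v comp c then
      insert ⟨i, hi⟩ (below (nbrs G v comp c) i) else below (nbrs G v comp c) i :=
    fun c => below_succ _ hi
  refine Ends.ite_mul (c := 280) (by decide) hE1 (fun hcond => ?_) fun hcond => ?_
  · simp only [Test.Holds, NatExpr.eval, hv2, hx, hadj] at hcond
    have hvi : G.Adj v ⟨i, hi⟩ := by
      by_contra hne
      simp [hne] at hcond
    set c₀ := comp ⟨i, hi⟩ with hc₀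
    have hc₀n : c₀ < n := hl.lt _
    set H := 2 ^ (below (nbrs G v comp c₀) i).card with hH
    have hHE : H ≤ E := (Nat.pow_le_pow_right (by decide)
      (Finset.card_le_card (Finset.filter_subset _ _))).trans (hE c₀)
    have hci := hc2 ⟨i, hi⟩
    simp only [← hc₀] at hci
    refine Ends.seq_mul (c := 10) (c' := 270) (by decide)
      (Q := fun m => m.nat 58 0 0 = c₀)
      (Ends.of_flat_mul rfl (by decide) hE1 (by simp [hx, hci])) fun m3 s3 h3 => ?_
    refine Ends.seq_mul (c := 10) (c' := 260) (by decide)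
      (Q := fun m => m.nat 59 0 0 = H)
      (Ends.of_flat_mul rfl (by decide) hE1 (by simp [h3, (h2.same s3).cnt c₀ hc₀n, hH]))
      fun m4 s4 h4 => ?_
    have h58 : m4.nat 58 0 0 = c₀ := by rw [s4.nat 58 rfl, h3]
    have h57 : m4.nat 57 0 0 = i := by rw [s4.nat 57 rfl, s3.nat 57 rfl, hx]
    have hp4 := (hp2.same s3).same s4
    refine Ends.seq_mul (c := 230) (c' := 30) (by decide)
      (Q := fun m =>
        (∀ c j, m.nat 7 c j = if c = c₀ ∧ H ≤ j ∧ j < H + H then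
          m2.nat 7 c₀ (j - H) + 2 ^ i else m2.nat 7 c j) ∧
        ∀ c j, m.nat 8 c j = if c = c₀ ∧ H ≤ j ∧ j < H + H then
          m2.nat 8 c₀ (j - H) + 1 else m2.nat 8 c j)
      ((Ends.forTo_mul (N := H) (B := E) (f := 1) (c := 60) (fun k m =>
        (∀ c j, m.nat 7 c j = if c = c₀ ∧ H ≤ j ∧ j < H + k then
          m2.nat 7 c₀ (j - H) + 2 ^ i else m2.nat 7 c j) ∧
        ∀ c j, m.nat 8 c j = if c = c₀ ∧ H ≤ j ∧ j < H + k then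
          m2.nat 8 c₀ (j - H) + 1 else m2.nat 8 c j) (by decide) hHE hE1 le_rfl (mul_one E)
        (fun m5 s5 => ?_) rfl (fun i m k h => by simpa using h) ?_
        fun k hk m5 s5 hy h5 => Ends.of_flat_mul rfl (by decide) le_rfl ?_).mono le_rfl
          fun m' _ h => h) fun m5 s5 h5 => ?_
    · simp [s5.nat 59 rfl, h4]
    · have : ∀ c j, ¬ (c = c₀ ∧ H ≤ j ∧ j < H + 0) := by omega
      simp only [this, if_false]
      rw [s4.nat 7 rfl, s3.nat 7 rfl, s4.nat 8 rfl, s3.nat 8 rfl]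
      exact ⟨fun _ _ => rfl, fun _ _ => rfl⟩
    · have h58' : m5.nat 58 0 0 = c₀ := by rw [s5.nat 58 rfl, h58]
      have h59' : m5.nat 59 0 0 = H := by rw [s5.nat 59 rfl, h4]
      have h57' : m5.nat 57 0 0 = i := by rw [s5.nat 57 rfl, h57]
      have h4' : m5.nat 4 0 i = 2 ^ i := (hp4.same s5) i hi.le
      -- The entry read has index `k < H`, in the first half, which the loop does not modify.
      have e7 := h5.1 c₀ k
      have e8 := h5.2 c₀ k
      rw [if_neg (by omega)] at e7 e8
      constructor
      all_goals
        intro c j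
        by_cases hcj : c = c₀ ∧ j = H + k
        · obtain ⟨rfl, rfl⟩ := hcj
          simp [h58', h59', h57', hy, h4', e7, e8]
        · have e : (c = c₀ ∧ H ≤ j ∧ j < H + (k + 1)) ↔ (c = c₀ ∧ H ≤ j ∧ j < H + k) := by omega
          simp only [e]
          first | rw [← h5.1 c j] | rw [← h5.2 c j]
          simp [h58', h59', hy, hcj]
    · have h58' : m5.nat 58 0 0 = c₀ := by rw [s5.nat 58 rfl, h58]
      have h59' : m5.nat 59 0 0 = H := by rw [s5.nat 59 rfl, h4]
      have h6' : m5.nat 6 = m2.nat 6 := by rw [s5.nat 6 rfl, s4.nat 6 rfl, s3.nat 6 rfl]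
      refine Ends.of_flat_mul rfl (by decide) hE1 ⟨_, h2.insert (w := ⟨i, hi⟩) (c₀ := c₀) ?_ ?_ ?_ ?_ ?_⟩
      · simp [below]
      · intro c
        rw [hsucc]
        simp only [mem_nbrs, hvi, true_and, ← hc₀, eq_comm]
      · intro c hc
        simp [h58', h59', h6', hH]
      · simpa using h5.1
      · simpa using h5.2
  · simp only [Test.Holds, NatExpr.eval, hv2, hx, hadj] at hcond
    have hvi : ¬ G.Adj v ⟨i, hi⟩ := fun h => hcond (by simp [h])
    refine Ends.skip_mul (by decide) hE1 ⟨opt, ?_⟩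
    have : ∀ c, below (nbrs G v comp c) (i + 1) = below (nbrs G v comp c) i := fun c => by
      rw [hsucc, if_neg fun h => hvi (mem_nbrs.1 h).1]
    simpa only [this] using h2

/-- Real arrays `5` and `6` hold the values of the table entries. -/
def HasTableValues (G : SimpleGraph (Fin n)) (α : ℝ) (q : Fin n → ℝ) (v : Fin n)
    (N : ℕ → Finset (Fin n)) (opt : ℕ → ℕ → Finset (Fin n)) (m : Memory) : Prop :=
  ∀ c < n, ∀ j < 2 ^ (N c).card,
    m.real 5 c j = fromJump G α q v (opt c j) v - α * q v ∧
    m.real 6 c j = fromStart G α v (opt c j) v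

theorem HasTableValues.same {N : ℕ → Finset (Fin n)} {opt : ℕ → ℕ → Finset (Fin n)} {m' : Memory}
    {p : Program} (h : HasTableValues G α q v N opt m) (hs : Same p m m')
    (h5 : p.writesReal 5 = false := by rfl) (h6 : p.writesReal 6 = false := by rfl) :
    HasTableValues G α q v N opt m' := by
  unfold HasTableValues
  rw [hs.real 5 h5, hs.real 6 h6]
  exact h

theorem value_ends (hn1 : 1 ≤ n) (h0 : 0 < α) (h1 : α < 1) (hm : HasInput G α q m)
    (hv : m.nat 20 0 0 = v) (hp : HasPow n m) {N : ℕ → Finset (Fin n)}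
    {opt : ℕ → ℕ → Finset (Fin n)} (ht : HasTable N opt m) (hvN : ∀ c, v ∉ N c) {E : ℕ}
    (hE : ∀ c, 2 ^ (N c).card ≤ E) :
    Ends valueProg m (20000 * (n * (E * (n * (n * n))))) (HasTableValues G α q v N opt) := by
  have hE1 : 1 ≤ E := Nat.one_le_two_pow.trans (hE 0)
  set s := n * (n * n) with hs
  have hns : n ≤ s := Nat.le_mul_of_pos_right n (Nat.mul_pos hn1 hn1)
  have hs1 : 1 ≤ s := hn1.trans hns
  refine (Ends.forTo_mul (N := n) (B := n) (f := E * s) (c := 9900)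
    (fun i m => ∀ c < i, ∀ j < 2 ^ (N c).card,
      m.real 5 c j = fromJump G α q v (opt c j) v - α * q v ∧
      m.real 6 c j = fromStart G α v (opt c j) v)
    (by decide) le_rfl hn1 (Nat.mul_pos hE1 hs1) rfl (fun m2 s2 => ?_) rfl
    (fun i m k h => by simpa using h) (by simp) fun i hi m2 s2 hx h2 => ?_).mono le_rfl
      fun m' _ h => h
  · simp [(hm.same s2).size]
  have ht2 := ht.same s2
  refine (Ends.forTo_mul (N := 2 ^ (N i).card) (B := E) (f := s) (c := 4900)
    (fun k m => ∀ c < i + 1, ∀ j < 2 ^ (N c).card, c < i ∨ j < k →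
      m.real 5 c j = fromJump G α q v (opt c j) v - α * q v ∧
      m.real 6 c j = fromStart G α v (opt c j) v)
    (by decide) (hE i) hE1 hs1 rfl (fun m3 s3 => ?_) rfl
    (fun i m k h => by simpa using h) ?_ fun k hk m3 s3 hy h3 => ?_).mono le_rfl
      fun m' _ h c hc j hj => h c hc j hj ?_
  · simp [s3.nat 61 rfl, hx, (ht2.same s3).cnt i hi]
  · intro c _ j hj hci
    exact h2 c (by omega) j hj
  · have hm3 := (hm.same s2).same s3
    have ht3 := ht2.same s3
    have hv3 : m3.nat 20 0 0 = v := by rw [s3.nat 20 rfl, s2.nat 20 rfl, hv]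
    have hx3 : m3.nat 61 0 0 = i := by rw [s3.nat 61 rfl, hx]
    refine Ends.seq_mul (c := 10) (c' := 4800) (by decide)
      (Q := fun m => m.nat 40 0 0 = code (opt i k))
      (Ends.of_flat_mul rfl (by decide) hs1 (by simp [hx3, hy, ht3.code i hi k hk]))
      fun m4 s4 h4 => ?_
    have hm4 := hm3.same s4
    refine Ends.seq_mul (c := 200) (c' := 4500) (by decide)
      ((decode_ends (Or.inr rfl) hm4.size hn1 (((hp.same s2).same s3).same s4) h4).le
        (Nat.mul_le_mul_left _ hns)) fun m5 s5 h5 => ?_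
    have hm5 := hm4.same s5
    have hv5 : m5.nat 20 0 0 = v := by rw [s5.nat 20 rfl, s4.nat 20 rfl, hv3]
    -- One linear system per table entry; its two right-hand sides give both values at once.
    refine Ends.assoc (Ends.seq_mul (c := 4000) (c' := 200) (by decide)
      (build_solve_ends hn1 h0 h1 hm5 hv5 h5 fun w hw hwv => ?_) fun m6 s6 h6 => ?_)
    · rw [Fin.val_inj] at hwv
      exact hvN i (hwv ▸ ht3.sub i hi k hk hw)
    · have hm6 := hm5.same s6
      have hv6 : m6.nat 20 0 0 = v := by rw [s6.nat 20 rfl, hv5]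
      have hx6 : m6.nat 61 0 0 = i := by
        rw [s6.nat 61 rfl, s5.nat 61 rfl, s4.nat 61 rfl, hx3]
      have hy6 : m6.nat 62 0 0 = k := by
        rw [s6.nat 62 rfl, s5.nat 62 rfl, s4.nat 62 rfl, hy]
      have e5 : m6.real 5 = m3.real 5 := by
        rw [s6.real 5 rfl, s5.real 5 rfl, s4.real 5 rfl]
      have e6 : m6.real 6 = m3.real 6 := by
        rw [s6.real 6 rfl, s5.real 6 rfl, s4.real 6 rfl]
      refine Ends.of_flat_mul rfl (by decide) hs1 fun c hc j hj hcj => ?_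
      by_cases hck : c = i ∧ j = k
      · obtain ⟨rfl, rfl⟩ := hck
        simp [hm6.size, hv6, hx6, hy6, (h6 v).1, (h6 v).2, hm6.damp, hm6.jump v]
      · simp [hm6.size, hv6, hx6, hy6, hck, e5, e6]
        exact h3 c hc j hj (by omega)
  · by_cases hci : c = i
    · exact Or.inr (hci ▸ hj)
    · exact Or.inl (by omega)

end Specifications

/-! ### Optimal choices from groups of options -/

/-- Groups `0, 1, …` of options, option `j < len c` of group `c` having a size, a code and a value;
and the size, code and value to start with. -/
structure Options where
  size : ℕ → ℕ → ℕ
  code : ℕ → ℕ → ℕ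
  value : ℕ → ℕ → ℝ
  len : ℕ → ℕ
  size₀ : ℕ
  code₀ : ℕ
  value₀ : ℝ

namespace Options

variable (O : Options)

/-- The total value of a choice from the first `c` groups. -/
noncomputable def total (c : ℕ) (f : ℕ → ℕ) : ℝ :=
  O.value₀ + ∑ i ∈ Finset.range c, O.value i (f i)

/-- The total size of a choice from the first `c` groups. -/
def totalSize (c : ℕ) (f : ℕ → ℕ) : ℕ := O.size₀ + ∑ i ∈ Finset.range c, O.size i (f i)

/-- The total code of a choice from the first `c` groups. -/
def totalCode (c : ℕ) (f : ℕ → ℕ) : ℕ := O.code₀ + ∑ i ∈ Finset.range c, O.code i (f i)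

/-- `f` chooses from the first `c` groups. -/
def IsChoice (c : ℕ) (f : ℕ → ℕ) : Prop := ∀ i < c, f i < O.len i

/-- `x` is the maximal value of a choice in `P`, and `k` the code of an optimal choice plus `1`;
`k = 0` if there is no choice. -/
def Best (c : ℕ) (P : (ℕ → ℕ) → Prop) (k : ℕ) (x : ℝ) : Prop :=
  (k ≠ 0 → ∃ f, P f ∧ x = O.total c f ∧ k = O.totalCode c f + 1) ∧
    ∀ f, P f → k ≠ 0 ∧ O.total c f ≤ x

/-- The choices of total size `r` from the first `c` groups. -/
def Layer (c r : ℕ) (f : ℕ → ℕ) : Prop := O.IsChoice c f ∧ O.totalSize c f = r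

/-- The choices of total size `r` from the first `c + 1` groups, using in the last group only the
first `J` options. -/
def Cell (c r J : ℕ) (f : ℕ → ℕ) : Prop :=
  O.IsChoice c f ∧ f c < J ∧ O.totalSize (c + 1) f = r

variable {O} {c r J k k' : ℕ} {x x' : ℝ}

theorem Best.congr {P P' : (ℕ → ℕ) → Prop} (h : O.Best c P k x) (hP : ∀ f, P f ↔ P' f) :
    O.Best c P' k x := by
  rwa [show P' = P from funext fun f => propext (hP f).symm]

theorem cell_len (f : ℕ → ℕ) : O.Cell c r (O.len c) f ↔ O.Layer (c + 1) r f := by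
  unfold Cell Layer IsChoice
  constructor
  · rintro ⟨h1, h2, h3⟩
    refine ⟨fun i hi => ?_, h3⟩
    rcases Nat.lt_succ_iff_lt_or_eq.1 hi with h | rfl
    · exact h1 i h
    · exact h2
  · rintro ⟨h1, h3⟩
    exact ⟨fun i hi => h1 i (by omega), h1 c (by omega), h3⟩

/-- With code `0` the value is arbitrary, so a cell is initialised by resetting its code only; a
real number left from an earlier table does no harm. -/
theorem best_cell_zero : O.Best (c + 1) (O.Cell c r 0) 0 x :=
  ⟨fun h => absurd rfl h, fun _ h => absurd h.2.1 (Nat.not_lt_zero _)⟩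

theorem total_succ (f : ℕ → ℕ) : O.total (c + 1) f = O.total c f + O.value c (f c) := by
  simp [total, Finset.sum_range_succ, add_assoc]

theorem totalSize_succ (f : ℕ → ℕ) :
    O.totalSize (c + 1) f = O.totalSize c f + O.size c (f c) := by
  simp [totalSize, Finset.sum_range_succ, add_assoc]

theorem totalCode_succ (f : ℕ → ℕ) :
    O.totalCode (c + 1) f = O.totalCode c f + O.code c (f c) := by
  simp [totalCode, Finset.sum_range_succ, add_assoc]

theorem sum_update (g : ℕ → ℕ → ℕ) (f : ℕ → ℕ) :
    ∑ i ∈ Finset.range c, g i (Function.update f c J i) = ∑ i ∈ Finset.range c, g i (f i) :=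
  Finset.sum_congr rfl fun i hi => by
    rw [Function.update_of_ne (Finset.mem_range.1 hi).ne]

/-- Choices whose last option is number `J` come from choices from the preceding groups. -/
theorem cell_last {f : ℕ → ℕ} (h : O.Cell c r (J + 1) f) :
    O.Cell c r J f ∨ f c = J ∧ O.size c J ≤ r ∧ O.Layer c (r - O.size c J) f := by
  obtain ⟨h1, h2, h3⟩ := h
  by_cases hf : f c = J
  · refine Or.inr ⟨hf, ?_⟩
    rw [totalSize_succ, hf] at h3
    exact ⟨by omega, h1, by omega⟩
  · exact Or.inl ⟨h1, by omega, h3⟩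

/-- This and the next two lemmas are the Bellman recursion for option `J`: it cannot complete any
choice, it does not beat the current optimum, or it replaces it. -/
theorem best_cell_skip (h : O.Best (c + 1) (O.Cell c r J) k x)
    (hno : ∀ f, O.size c J ≤ r → ¬ O.Layer c (r - O.size c J) f) :
    O.Best (c + 1) (O.Cell c r (J + 1)) k x := by
  refine h.congr fun f => ⟨fun h => ⟨h.1, by have := h.2.1; omega, h.2.2⟩, fun h => ?_⟩
  rcases cell_last h with h | ⟨-, h1, h2⟩
  · exact h
  · exact absurd h2 (hno f h1)

theorem best_cell_keep (h : O.Best (c + 1) (O.Cell c r J) k x)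
    (h' : O.Best c (O.Layer c (r - O.size c J)) k' x') (hk : k ≠ 0)
    (hx : x' + O.value c J ≤ x) : O.Best (c + 1) (O.Cell c r (J + 1)) k x := by
  refine ⟨fun hk => ?_, fun f hf => ⟨hk, ?_⟩⟩
  · obtain ⟨f, h1, h2⟩ := h.1 hk
    exact ⟨f, ⟨h1.1, by have := h1.2.1; omega, h1.2.2⟩, h2⟩
  · rcases cell_last hf with hf | ⟨h1, -, h2⟩
    · exact (h.2 f hf).2
    · rw [total_succ, h1]
      have := (h'.2 f h2).2
      linarith

theorem best_cell_replace (h : O.Best (c + 1) (O.Cell c r J) k x) (hs : O.size c J ≤ r)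
    (h' : O.Best c (O.Layer c (r - O.size c J)) k' x') (hk' : k' ≠ 0)
    (hx : k ≠ 0 → x ≤ x' + O.value c J) :
    O.Best (c + 1) (O.Cell c r (J + 1)) (k' + O.code c J) (x' + O.value c J) := by
  refine ⟨fun _ => ?_, fun f hf => ⟨by omega, ?_⟩⟩
  · obtain ⟨f, ⟨h1, h2⟩, h3, h4⟩ := h'.1 hk'
    have e1 : O.totalSize c (Function.update f c J) = O.totalSize c f := by
      simp only [totalSize, sum_update]
    have e2 : O.totalCode c (Function.update f c J) = O.totalCode c f := by
      simp only [totalCode, sum_update]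
    have e3 : O.total c (Function.update f c J) = O.total c f := by
      simp only [total]
      congr 1
      exact Finset.sum_congr rfl fun i hi => by
        rw [Function.update_of_ne (Finset.mem_range.1 hi).ne]
    -- An optimal choice for the earlier groups is extended by option `J` in group `c`. Sums over
    -- the earlier groups do not see the update.
    refine ⟨Function.update f c J, ⟨fun i hi => ?_, by simp, ?_⟩, ?_, ?_⟩
    · rw [Function.update_of_ne hi.ne]
      exact h1 i hi
    · rw [totalSize_succ, e1, h2, Function.update_self]
      omega
    · rw [total_succ, e3, h3, Function.update_self]
    · rw [totalCode_succ, e2, h4, Function.update_self]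
      omega
  · rcases cell_last hf with hf | ⟨h1, -, h2⟩
    · obtain ⟨h3, h4⟩ := h.2 f hf
      exact h4.trans (hx h3)
    · rw [total_succ, h1]
      have := (h'.2 f h2).2
      linarith

theorem best_layer_zero (r : ℕ) : O.Best 0 (O.Layer 0 r)
    (if r = O.size₀ then O.code₀ + 1 else 0) O.value₀ := by
  refine ⟨fun hk => ?_, fun f hf => ⟨?_, by simp [total]⟩⟩
  · have hr : r = O.size₀ := by
      by_contra hne
      simp [hne] at hk
    exact ⟨fun _ => 0, ⟨fun i hi => absurd hi (Nat.not_lt_zero _), by simp [totalSize, hr]⟩,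
      by simp [total], by simp [totalCode, hr]⟩
  · have : r = O.size₀ := by simpa [totalSize] using hf.2.symm
    simp [this]

end Options

/-! ### The dynamic program -/

section Specifications

variable {n : ℕ} {G : SimpleGraph (Fin n)} {α : ℝ} {q : Fin n → ℝ} {m : Memory} {O : Options}

/-- The memory describes the options, for a strategy with `d` edges and the threshold `T`. -/
structure HasOptions (O : Options) (d : ℕ) (T : ℝ) (m : Memory) : Prop where
  size : ∀ c < n, ∀ j < O.len c, m.nat 8 c j = O.size c j
  code : ∀ c < n, ∀ j < O.len c, m.nat 7 c j = O.code c j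
  value : ∀ c < n, ∀ j < O.len c, d * m.real 5 c j + T * m.real 6 c j = O.value c j
  edges : m.nat 23 0 0 = d
  threshold : m.real 12 0 0 = T

theorem HasOptions.same {d : ℕ} {T : ℝ} {m' : Memory} {p : Program}
    (h : HasOptions (n := n) O d T m)
    (hs : Same p m m') (h7 : p.writesNat 7 = false := by rfl)
    (h8 : p.writesNat 8 = false := by rfl) (h23 : p.writesNat 23 = false := by rfl)
    (h5 : p.writesReal 5 = false := by rfl) (h6 : p.writesReal 6 = false := by rfl)
    (h12 : p.writesReal 12 = false := by rfl) : HasOptions (n := n) O d T m' where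
  size := by rw [hs.nat 8 h8]; exact h.size
  code := by rw [hs.nat 7 h7]; exact h.code
  value := by rw [hs.real 5 h5, hs.real 6 h6]; exact h.value
  edges := by rw [hs.nat 23 h23]; exact h.edges
  threshold := by rw [hs.real 12 h12]; exact h.threshold

/-- The first conjunct of the conclusion is a frame condition finer than `Same`: within the two
table arrays only the cell `(c + 1, r)` changes, so the cells of layer `c` can still be read. -/
theorem cell_ends {d : ℕ} {T : ℝ} (ho : HasOptions (n := n) O d T m) {c r E : ℕ} (hcn : c < n)
    (hc : m.nat 24 0 0 = c) (hr : m.nat 25 0 0 = r) (hlen : m.nat 29 0 0 = O.len c)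
    (hE : O.len c ≤ E) (hE1 : 1 ≤ E)
    (hb : ∀ r' ≤ r, O.Best c (O.Layer c r') (m.nat 11 c r') (m.real 4 c r')) :
    Ends cellProg m (500 * E) fun m' =>
      (∀ a b, ¬ (a = c + 1 ∧ b = r) → m'.nat 11 a b = m.nat 11 a b ∧
        m'.real 4 a b = m.real 4 a b) ∧
      O.Best (c + 1) (O.Layer (c + 1) r) (m'.nat 11 (c + 1) r) (m'.real 4 (c + 1) r) := by
  refine Ends.seq_mul (c := 20) (c' := 450) (by decide) (Q := fun m' =>
      (∀ a b, ¬ (a = c + 1 ∧ b = r) → m'.nat 11 a b = m.nat 11 a b ∧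
        m'.real 4 a b = m.real 4 a b) ∧ m'.nat 11 (c + 1) r = 0)
    (Ends.of_flat_mul rfl (by decide) hE1 ?_) fun m1 s1 h1 => ?_
  · simp +contextual [hc, hr]
  have hc1 : m1.nat 24 0 0 = c := by rw [s1.nat 24 rfl, hc]
  have hr1 : m1.nat 25 0 0 = r := by rw [s1.nat 25 rfl, hr]
  refine (Ends.forTo_mul (N := O.len c) (B := E) (f := 1) (c := 200)
    (fun J m' => (∀ a b, ¬ (a = c + 1 ∧ b = r) → m'.nat 11 a b = m.nat 11 a b ∧
        m'.real 4 a b = m.real 4 a b) ∧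
      O.Best (c + 1) (O.Cell c r J) (m'.nat 11 (c + 1) r) (m'.real 4 (c + 1) r))
    (by decide) hE hE1 le_rfl (mul_one E) (fun m2 s2 => ?_) rfl
    (fun i m2 k h => by simpa using h)
    ⟨h1.1, by rw [h1.2]; exact Options.best_cell_zero⟩
    fun J hJ m2 s2 hx h2 => Ends.of_flat_mul rfl (by decide) le_rfl ?_).mono le_rfl
      fun m' _ h => ⟨h.1, h.2.congr Options.cell_len⟩
  · simp [s2.nat 29 rfl, s1.nat 29 rfl, hlen]
  · obtain ⟨h3, h4⟩ := h2
    have ho2 := (ho.same s1).same s2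
    have hc2 : m2.nat 24 0 0 = c := by rw [s2.nat 24 rfl, hc1]
    have hr2 : m2.nat 25 0 0 = r := by rw [s2.nat 25 rfl, hr1]
    have e8 := ho2.size c hcn J hJ
    have e7 := ho2.code c hcn J hJ
    have e5 := ho2.value c hcn J hJ
    by_cases hs : r < O.size c J
    · simp [hc2, hr2, hx, e8, hs]
      exact ⟨by simpa using h3, Options.best_cell_skip h4 fun f hf => absurd hf (by omega)⟩
    obtain ⟨e11, e4⟩ := h3 c (r - O.size c J) (by omega)
    have hb' := hb (r - O.size c J) (by omega)
    rw [← e11, ← e4] at hb'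
    by_cases hk : m2.nat 11 c (r - O.size c J) = 0
    · simp [hc2, hr2, hx, e8, hs, hk]
      exact ⟨by simpa using h3, Options.best_cell_skip h4 fun f _ hf => (hb'.2 f hf).1 hk⟩
    by_cases hcond : m2.nat 11 (c + 1) r ≠ 0 ∧
        ¬ m2.real 4 (c + 1) r < m2.real 4 c (r - O.size c J) + O.value c J
    · have := Options.best_cell_keep h4 hb' hcond.1 (not_lt.1 hcond.2)
      have h5 := not_lt.1 hcond.2
      simp [hc2, hr2, hx, e8, hs, hk, hcond.1, ho2.edges, ho2.threshold, e5, h5]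
      exact ⟨by simpa using h3, this⟩
    · have := Options.best_cell_replace h4 (not_lt.1 hs) hb' hk fun h => by
        rw [not_and_not_right] at hcond
        exact (hcond h).le
      have h5 : ¬ (¬ m2.nat 11 (c + 1) r = 0 ∧
        m2.real 4 c (r - O.size c J) + O.value c J ≤ m2.real 4 (c + 1) r) := by
        simpa using hcond
      simp [hc2, hr2, hx, e8, hs, hk, h5, ho2.edges, ho2.threshold, e5, e7]
      refine ⟨fun a b hab => ?_, this⟩
      have := h3 a b (by tauto)
      have hab' : ¬ (a = c + 1 ∧ b = r) := by tauto
      simpa [hab'] using this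

/-- The initial size, code and value already account for the component `cu`, which is therefore left
with a single option. The bound is `n` layers, at most `n + 1` sizes and `E` options per cell. -/
theorem choice_ends (hn1 : 1 ≤ n) {v : Fin n} (hm : HasInput G α q m) (hv : m.nat 20 0 0 = v)
    {d : ℕ} {T : ℝ} (hd : d ≤ n) (ho : HasOptions (n := n) O d T m)
    {cu E : ℕ} (hcu : m.nat 31 0 0 = cu)
    (hlen : ∀ c < n, O.len c = if c = cu then 1 else m.nat 6 0 c) (hE : ∀ c < n, O.len c ≤ E)
    (hE1 : 1 ≤ E) (hs : m.nat 27 0 0 = O.size₀) (hk : m.nat 28 0 0 = O.code₀)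
    (hx : d * (α * q v - T + m.real 14 0 0) + T * m.real 15 0 0 = O.value₀) :
    Ends choiceProg m (8000 * (n * (n * E))) fun m' =>
      O.Best n (O.Layer n d) (m'.nat 11 n d) (m'.real 4 n d) := by
  have hnE : n ≤ n * (n * E) := Nat.le_mul_of_pos_right n (Nat.mul_pos hn1 hE1)
  refine Ends.seq_mul (c := 600) (c' := 7000) (by decide)
    (Q := fun m' => ∀ r ≤ d, O.Best 0 (O.Layer 0 r) (m'.nat 11 0 r) (m'.real 4 0 r))
    ((Ends.forTo_mul (N := d + 1) (B := 2 * n) (f := 1) (c := 110) (C := 300) (F := 2 * n)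
      (fun i m => ∀ r < i, O.Best 0 (O.Layer 0 r) (m.nat 11 0 r) (m.real 4 0 r))
      (by decide) (by omega) (by omega) le_rfl (mul_one _) (fun m1 s1 => ?_) rfl (fun i m k h => by
      simpa using h) (by simp) fun i hi m1 s1 hi' h =>
      Ends.of_flat_mul rfl (by decide) le_rfl fun r hr => ?_).mono (by omega)
      fun m' _ h r hr => h r (by omega)) fun m1 s1 h1 => ?_
  · simp [s1.nat 23 rfl, ho.edges]
  · have hm1 := hm.same s1
    have ho1 := ho.same s1
    have hv1 : m1.nat 20 0 0 = v := by rw [s1.nat 20 rfl, hv]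
    have e27 : m1.nat 27 0 0 = O.size₀ := by rw [s1.nat 27 rfl, hs]
    have e28 : m1.nat 28 0 0 = O.code₀ := by rw [s1.nat 28 rfl, hk]
    have ex : d * (α * q v - T + m1.real 14 0 0) + T * m1.real 15 0 0 = O.value₀ := by
      rw [s1.real 14 rfl, s1.real 15 rfl, hx]
    by_cases hri : r = i
    · subst hri
      have := Options.best_layer_zero (O := O) r
      by_cases hrs : r = O.size₀
      · rw [if_pos hrs] at this
        simpa [hi', e27, e28, hrs, ho1.edges, ho1.threshold, hm1.damp, hv1, hm1.jump v, ex]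
          using this
      · rw [if_neg hrs] at this
        simp [hi', e27, hrs]
        exact ⟨fun h => absurd rfl h, fun f hf => absurd rfl (this.2 f hf).1⟩
    · have := h r (by omega)
      by_cases his : i = O.size₀
      · simpa [hi', e27, his, hri, show r ≠ O.size₀ from his ▸ hri] using this
      · simpa [hi', e27, his, hri] using this
  have hm1 := hm.same s1
  refine (Ends.forTo_mul (N := n) (B := n) (f := 2 * n * E) (c := 1200) (C := 3000)
    (F := n * (2 * n * E))
    (fun c m => ∀ r ≤ d, O.Best c (O.Layer c r) (m.nat 11 c r) (m.real 4 c r))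
    (by decide) le_rfl hn1 (Nat.mul_pos (by omega) hE1) rfl (fun m2 s2 => ?_) rfl
    (fun i m k h => by simpa using h) h1 fun c hc m2 s2 hcx h2 => ?_).mono ?_
      fun m' _ h => h d le_rfl
  · simp [(hm1.same s2).size]
  · have ho2 := (ho.same s1).same s2
    have e31 : m2.nat 31 0 0 = cu := by rw [s2.nat 31 rfl, s1.nat 31 rfl, hcu]
    have e6 : m2.nat 6 = m.nat 6 := by rw [s2.nat 6 rfl, s1.nat 6 rfl]
    have hf1 : 1 ≤ 2 * n * E := Nat.mul_pos (by omega) hE1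
    refine Ends.seq_mul (c := 50) (c' := 1100) (by decide) (Q := fun m => m.nat 29 0 0 = O.len c)
      (Ends.of_flat_mul rfl (by decide) hf1 ?_) fun m3 s3 h3 => ?_
    · rw [hlen c hc, ← e6]
      by_cases h : c = cu <;> simp [hcx, e31, h]
    · have ho3 := ho2.same s3
      have h2' : ∀ r ≤ d, O.Best c (O.Layer c r) (m3.nat 11 c r) (m3.real 4 c r) := by
        rw [s3.nat 11 rfl, s3.real 4 rfl]
        exact h2
      have hc3 : m3.nat 24 0 0 = c := by rw [s3.nat 24 rfl, hcx]
      refine (Ends.forTo_mul (N := d + 1) (B := 2 * n) (f := E) (c := 500)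
        (fun i m => (∀ r ≤ d, O.Best c (O.Layer c r) (m.nat 11 c r) (m.real 4 c r)) ∧
          ∀ r < i, O.Best (c + 1) (O.Layer (c + 1) r) (m.nat 11 (c + 1) r) (m.real 4 (c + 1) r))
        (by decide) (by omega) (by omega) hE1 rfl (fun m4 s4 => ?_) rfl (fun i m k h => by
        simpa using h) ⟨h2', by simp⟩ fun i hi m4 s4 hi' h => ?_).mono le_rfl
        fun m' _ h r hr => h.2 r (by omega)
      · simp [s4.nat 23 rfl, ho3.edges]
      · refine (cell_ends (ho3.same s4) hc (by rw [s4.nat 24 rfl, hc3]) hi'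
          (by rw [s4.nat 29 rfl, h3]) (hE c hc) hE1 fun r' hr' => h.1 r' (by omega)).mono le_rfl
          fun m5 _ h5 => ⟨fun r hr => ?_, fun r hr => ?_⟩
        · rw [(h5.1 c r (by omega)).1, (h5.1 c r (by omega)).2]
          exact h.1 r hr
        · by_cases hri : r = i
          · subst hri
            exact h5.2
          · rw [(h5.1 (c + 1) r (by omega)).1, (h5.1 (c + 1) r (by omega)).2]
            exact h.2 r (by omega)
  · nlinarith

end Specifications

/-! ### Choices of options correspond to strategies -/

section Choices

variable {n : ℕ} {G : SimpleGraph (Fin n)} {α : ℝ} {q : Fin n → ℝ} {v u : Fin n}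
  {comp : Fin n → ℕ} {opt : ℕ → ℕ → Finset (Fin n)} {S : Finset (Fin n)} {d : ℕ}

/-- The options for strategies of `v` with `d` edges, with additional vertex `u` and retained
neighbours `S` in the component of `u`. In that component only the option `0`, the empty set, is
left. -/
noncomputable def strategyOptions (G : SimpleGraph (Fin n)) (α : ℝ) (q : Fin n → ℝ)
    (v u : Fin n) (comp : Fin n → ℕ) (opt : ℕ → ℕ → Finset (Fin n)) (S : Finset (Fin n)) (d : ℕ) :
    Options where
  size c j := (opt c j).card
  code c j := code (opt c j)
  value c j := d * (fromJump G α q v (opt c j) v - α * q v) +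
    threshold G α q v u (ends v u S) d * fromStart G α v (opt c j) v
  len c := if c = comp u then 1 else 2 ^ (nbrs G v comp c).card
  size₀ := (ends v u S).card
  code₀ := code S
  value₀ := d * (α * q v - threshold G α q v u (ends v u S) d +
      (fromJump G α q v (ends v u S) v - α * q v)) +
    threshold G α q v u (ends v u S) d * fromStart G α v (ends v u S) v

/-- The retained neighbours in component `c`. -/
def part (u : Fin n) (comp : Fin n → ℕ) (opt : ℕ → ℕ → Finset (Fin n)) (S : Finset (Fin n))
    (f : ℕ → ℕ) (c : ℕ) : Finset (Fin n) := if c = comp u then S else opt c (f c)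

/-- The neighbours retained by a choice. -/
def kept (u : Fin n) (comp : Fin n → ℕ) (opt : ℕ → ℕ → Finset (Fin n)) (S : Finset (Fin n))
    (f : ℕ → ℕ) : Finset (Fin n) := (Finset.range n).biUnion (part u comp opt S f)

/-- `opt c` lists the sets of neighbours of `v` with label `c`. -/
structure IsListing (G : SimpleGraph (Fin n)) (v : Fin n) (comp : Fin n → ℕ)
    (opt : ℕ → ℕ → Finset (Fin n)) : Prop where
  zero : ∀ c < n, opt c 0 = ∅
  sub : ∀ c < n, ∀ j < 2 ^ (nbrs G v comp c).card, opt c j ⊆ nbrs G v comp c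
  surj : ∀ c < n, ∀ S ⊆ nbrs G v comp c, ∃ j < 2 ^ (nbrs G v comp c).card, opt c j = S

theorem part_subset (hopt : IsListing G v comp opt) (hS : S ⊆ nbrs G v comp (comp u)) {f : ℕ → ℕ}
    (hf : (strategyOptions G α q v u comp opt S d).IsChoice n f) {c : ℕ} (hc : c < n) :
    part u comp opt S f c ⊆ nbrs G v comp c := by
  unfold part
  split_ifs with h
  · rw [h]; exact hS
  · have := hf c hc
    simp only [strategyOptions, if_neg h] at this
    exact hopt.sub c hc _ this

theorem kept_filter {f : ℕ → ℕ}
    (hp : ∀ c < n, part u comp opt S f c ⊆ nbrs G v comp c) {c : ℕ} (hc : c < n) :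
    ((kept u comp opt S f).filter fun x => comp x = c) = part u comp opt S f c := by
  ext x
  simp only [kept, Finset.mem_filter, Finset.mem_biUnion, Finset.mem_range]
  constructor
  · rintro ⟨⟨c', hc', hx⟩, rfl⟩
    have := (mem_nbrs.1 (hp c' hc' hx)).2
    rwa [this]
  · exact fun hx => ⟨⟨c, hc, hx⟩, (mem_nbrs.1 (hp c hc hx)).2⟩

theorem ends_filter {K : Finset (Fin n)} (c : ℕ) :
    ((ends v u K).filter fun x => comp x = c) =
      if c = comp u then ends v u (K.filter fun x => comp x = c)
      else K.filter fun x => comp x = c := by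
  unfold ends
  split_ifs with h1 h2 h2
  · rfl
  · rfl
  · rw [Finset.filter_insert, if_pos h2.symm]
  · rw [Finset.filter_insert, if_neg (Ne.symm h2)]

/-- The choice proper has the empty set in the component of `u`, and the fixed part `A` enters
through the initial terms. This is used for sizes, codes and values alike. -/
theorem sum_part {M : Type*} [AddCommMonoid M] {h : Finset (Fin n) → M} (h0 : h ∅ = 0) {c₀ : ℕ}
    (hc₀ : c₀ < n) (A : Finset (Fin n)) {B : ℕ → Finset (Fin n)} (hB : B c₀ = ∅) :
    ∑ c ∈ Finset.range n, h (if c = c₀ then A else B c) =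
      h A + ∑ c ∈ Finset.range n, h (B c) := by
  rw [← Finset.add_sum_erase _ _ (Finset.mem_range.2 hc₀),
    ← Finset.add_sum_erase _ (fun c => h (B c)) (Finset.mem_range.2 hc₀), if_pos rfl, hB, h0,
    zero_add]
  congr 1
  exact Finset.sum_congr rfl fun c hc => by rw [if_neg (Finset.mem_erase.1 hc).1]

/-- The strategy with the neighbours `K` retained and an edge to `u`, where `u = v` stands for no
additional edge. -/
def strategy (v u : Fin n) (K : Finset (Fin n)) : Strategy (Fin n) :=
  ⟨K, if u = v then none else some u⟩

/-- Size counts the added edge, whereas the code describes only the retained neighbours. The totals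
are the componentwise sums in `isImproving_iff`, provided that the size equals the `d` built into
the values. -/
theorem choice_strategy (h0 : 0 < α) (h1 : α < 1) (hq : IsDistribution q) (hl : IsLabel G v comp)
    (hopt : IsListing G v comp opt) (hu : ¬ G.Adj v u) (hS : S ⊆ nbrs G v comp (comp u))
    {f : ℕ → ℕ} (hf : (strategyOptions G α q v u comp opt S d).IsChoice n f) :
    (strategyOptions G α q v u comp opt S d).totalSize n f =
      (ends v u (kept u comp opt S f)).card ∧
    (strategyOptions G α q v u comp opt S d).totalCode n f = code (kept u comp opt S f) ∧
    ((strategyOptions G α q v u comp opt S d).totalSize n f = d →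
      (IsImproving G α q v (strategy v u (kept u comp opt S f)) ↔
        0 < d ∧ 0 < (strategyOptions G α q v u comp opt S d).total n f)) := by
  set K := kept u comp opt S f with hK
  set R := ends v u K with hR
  have hp : ∀ c < n, part u comp opt S f c ⊆ nbrs G v comp c := fun c hc =>
    part_subset hopt hS hf hc
  have hcu := hl.lt u
  have hempty : opt (comp u) (f (comp u)) = ∅ := by
    have := hf (comp u) hcu
    simp only [strategyOptions, if_true, Nat.lt_one_iff] at this
    rw [this]
    exact hopt.zero _ hcu
  have hKc : ∀ c < n, (K.filter fun x => comp x = c) = part u comp opt S f c := fun c hc =>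
    kept_filter hp hc
  have hRc : ∀ c < n, (R.filter fun x => comp x = c) =
      if c = comp u then ends v u S else opt c (f c) := fun c hc => by
    rw [hR, ends_filter, hKc c hc]
    unfold part
    split_ifs <;> rfl
  have maps : ∀ A : Finset (Fin n), ∀ x ∈ A, comp x ∈ Finset.range n := fun A x _ =>
    Finset.mem_range.2 (hl.lt x)
  have hcard : (strategyOptions G α q v u comp opt S d).totalSize n f = R.card := by
    rw [Finset.card_eq_sum_card_fiberwise (maps R),
      Finset.sum_congr rfl fun c hc => by rw [hRc c (Finset.mem_range.1 hc)],
      sum_part Finset.card_empty hcu _ hempty]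
    rfl
  have hcode : (strategyOptions G α q v u comp opt S d).totalCode n f = code K := by
    rw [code, ← Finset.sum_fiberwise_of_maps_to (maps K)]
    have : ∀ c ∈ Finset.range n, ∑ w ∈ K.filter (fun x => comp x = c), 2 ^ (w : ℕ) =
        code (if c = comp u then S else opt c (f c)) := fun c hc => by
      rw [hKc c (Finset.mem_range.1 hc)]
      rfl
    rw [Finset.sum_congr rfl this, sum_part (by simp [code]) hcu _ hempty]
    rfl
  refine ⟨hcard, hcode, fun hd => ?_⟩
  rw [hcard] at hd
  have hkN : ∀ w ∈ K, G.Adj v w := fun w hw => by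
    obtain ⟨c, hc, hw⟩ := Finset.mem_biUnion.1 hw
    exact (mem_nbrs.1 (hp c (Finset.mem_range.1 hc) hw)).1
  set T := threshold G α q v u (ends v u S) d with hT
  rw [isImproving_iff (R := R) (u := u) (T := T) h0 h1 hq hl.edge hl.lt hkN rfl hu hR
    (by rw [hRc _ hcu, if_pos rfl, hd]), hd, ← Finset.card_pos, hd]
  refine and_congr_right fun _ => ?_
  rw [Finset.sum_congr rfl fun c hc => by rw [hRc c (Finset.mem_range.1 hc)],
    sum_part (h := fun A => d * (fromJump G α q v A v - α * q v) + T * fromStart G α v A v)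
      (by simp [fromJump_empty h0 h1, fromStart_empty h0 h1]) hcu _ hempty]
  have : (strategyOptions G α q v u comp opt S d).total n f = d * (α * q v - T) +
      (d * (fromJump G α q v (ends v u S) v - α * q v) + T * fromStart G α v (ends v u S) v +
        ∑ c ∈ Finset.range n, (d * (fromJump G α q v (opt c (f c)) v - α * q v) +
          T * fromStart G α v (opt c (f c)) v)) := by
    simp only [Options.total, strategyOptions, ← hT]
    ring
  rw [this]

/-- Completeness: every set of neighbours is assembled from its traces on the components, each of
which is listed. -/
theorem exists_choice (hl : IsLabel G v comp) (hopt : IsListing G v comp opt)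
    {K : Finset (Fin n)} (hK : ∀ w ∈ K, G.Adj v w)
    (hS : (K.filter fun x => comp x = comp u) = S) :
    ∃ f, (strategyOptions G α q v u comp opt S d).IsChoice n f ∧ kept u comp opt S f = K := by
  have hsub : ∀ c, (K.filter fun x => comp x = c) ⊆ nbrs G v comp c := fun c x hx => by
    rw [Finset.mem_filter] at hx
    exact mem_nbrs.2 ⟨hK x hx.1, hx.2⟩
  have hex : ∀ c, ∃ j, c < n → (if c = comp u then j = 0 else
      j < 2 ^ (nbrs G v comp c).card ∧ opt c j = K.filter fun x => comp x = c) := fun c => by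
    by_cases hc : c < n
    · split_ifs
      · exact ⟨0, fun _ => rfl⟩
      · obtain ⟨j, h⟩ := hopt.surj c hc _ (hsub c)
        exact ⟨j, fun _ => h⟩
    · exact ⟨0, fun h => absurd h hc⟩
  choose f hf using hex
  refine ⟨f, fun c hc => ?_, ?_⟩
  · have := hf c hc
    simp only [strategyOptions]
    split_ifs at this ⊢ with h
    · omega
    · exact this.1
  · have hpart : ∀ c < n, part u comp opt S f c = K.filter fun x => comp x = c := fun c hc => by
      have := hf c hc
      unfold part
      split_ifs at this ⊢ with h
      · rw [← hS, h]
      · exact this.2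
    ext x
    simp only [kept, Finset.mem_biUnion, Finset.mem_range]
    constructor
    · rintro ⟨c, hc, hx⟩
      rw [hpart c hc] at hx
      exact (Finset.mem_filter.1 hx).1
    · exact fun hx => ⟨comp x, hl.lt x, by rw [hpart _ (hl.lt x)]; simp [hx]⟩

end Choices

/-! ### The search for an improving strategy -/

section Specifications

variable {n : ℕ} {G : SimpleGraph (Fin n)} {α : ℝ} {q : Fin n → ℝ} {m : Memory} {v u : Fin n}
  {comp : Fin n → ℕ} {opt : ℕ → ℕ → Finset (Fin n)} {S : Finset (Fin n)} {d : ℕ}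

/-- The memory claims an equilibrium or reports an improving strategy, and it reports an improving
strategy if `P` holds. -/
structure Progress (G : SimpleGraph (Fin n)) (α : ℝ) (q : Fin n → ℝ) (P : Prop) (m : Memory) :
    Prop where
  sound : m.nat 2 0 0 = 1 ∨ m.nat 2 0 0 = 0 ∧ ∃ v s, m.Reports v s ∧ IsImproving G α q v s
  complete : P → m.nat 2 0 0 = 0

theorem Progress.congr {P : Prop} {m' : Memory} (h : Progress G α q P m)
    (h2 : m'.nat 2 = m.nat 2) (h3 : m'.nat 3 = m.nat 3) : Progress G α q P m' := by
  refine ⟨?_, by rw [h2]; exact h.complete⟩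
  simp only [Memory.Reports, h2, h3]
  exact h.sound

theorem Progress.same {P : Prop} {m' : Memory} {p : Program} (h : Progress G α q P m)
    (hs : Same p m m') (h2 : p.writesNat 2 = false := by rfl)
    (h3 : p.writesNat 3 = false := by rfl) : Progress G α q P m' :=
  h.congr (hs.nat 2 h2) (hs.nat 3 h3)

theorem Progress.mono {P P' : Prop} (h : Progress G α q P m) (hP : P' → P) :
    Progress G α q P' m := ⟨h.sound, fun h' => h.complete (hP h')⟩

/-- The rule for search loops. -/
theorem Ends.search {x : ℕ} {e : NatExpr} {body : Program} {m₀ : Memory} {N B C F c f : ℕ}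
    {P₀ : Prop} {P : ℕ → Prop}
    (hC : 2 * (c + (e.cost + 13)) ≤ C) (hB : N ≤ B) (hB1 : 1 ≤ B) (hf : 1 ≤ f) (hF : B * f = F)
    (he : ∀ m, Same (.forTo x e body) m₀ m → e.eval m = N)
    (hx : body.writesNat x = false) (hx2 : x ≠ 2) (hx3 : x ≠ 3)
    (h0 : Progress G α q P₀ m₀)
    (hs : ∀ i < N, ∀ m, Same (.forTo x e body) m₀ m → m.nat x 0 0 = i → ∀ P₀,
      Progress G α q P₀ m → Ends body m (c * f) (Progress G α q (P₀ ∨ P i))) :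
    Ends (.forTo x e body) m₀ (C * F) (Progress G α q (P₀ ∨ ∃ i < N, P i)) := by
  refine Ends.forTo_mul (fun i => Progress G α q (P₀ ∨ ∃ j < i, P j)) hC hB hB1 hf hF he hx
    (fun i m k h => h.congr ?_ ?_) (h0.mono (by simp)) fun i hi m hm hxi h =>
      (hs i hi m hm hxi _ h).mono le_rfl fun m' _ h' => h'.mono ?_
  · funext a b
    simp [hx2.symm]
  · funext a b
    simp [hx3.symm]
  · rintro (h | ⟨j, hj, hP⟩)
    · exact Or.inl (Or.inl h)
    · rcases Nat.lt_succ_iff_lt_or_eq.1 hj with h | rfl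
      · exact Or.inl (Or.inr ⟨j, h, hP⟩)
      · exact Or.inr hP

/-- An optimum decides whether any choice has positive total. An earlier report may be overwritten,
but only by another improving strategy. -/
theorem report_ends (hn1 : 1 ≤ n) (hn : m.nat 0 0 0 = n) (hp : HasPow n m)
    (hv : m.nat 20 0 0 = v) (hu : m.nat 21 0 0 = u) (hd : m.nat 23 0 0 = d) {O : Options}
    (hb : O.Best n (O.Layer n d) (m.nat 11 n d) (m.real 4 n d))
    (hO : ∀ f, O.Layer n d f → 0 < O.total n f →
      ∃ K, O.totalCode n f = code K ∧ IsImproving G α q v (strategy v u K))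
    {P₀ : Prop} (h : Progress G α q P₀ m) :
    Ends reportProg m (400 * n)
      (Progress G α q (P₀ ∨ ∃ f, O.Layer n d f ∧ 0 < O.total n f)) := by
  refine Ends.ite_mul (c := 300) (by decide) hn1 (fun hc => ?_) fun hc => ?_
  · simp only [Test.Holds, NatExpr.eval, RealExpr.eval, hn, hd, Nat.cast_zero] at hc
    obtain ⟨f, hf, hx, hk⟩ := hb.1 hc.1
    obtain ⟨K, hK, himp⟩ := hO f hf (hx ▸ hc.2)
    refine Ends.seq_mul (c := 10) (c' := 290) (by decide) (Q := fun m => m.nat 2 0 0 = 0)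
      (Ends.of_flat_mul rfl (by decide) hn1 (by simp)) fun m1 s1 h1 => ?_
    refine Ends.seq_mul (c := 10) (c' := 280) (by decide)
      (Q := fun m => m.nat 2 0 0 = 0 ∧ m.nat 2 0 1 = v)
      (Ends.of_flat_mul rfl (by decide) hn1 (by simp [h1, s1.nat 20 rfl, hv])) fun m2 s2 h2 => ?_
    have hu2 : m2.nat 21 0 0 = u := by rw [s2.nat 21 rfl, s1.nat 21 rfl, hu]
    have hv2 : m2.nat 20 0 0 = v := by rw [s2.nat 20 rfl, s1.nat 20 rfl, hv]
    refine Ends.seq_mul (c := 40) (c' := 240) (by decide)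
      (Q := fun m => m.nat 2 0 0 = 0 ∧ m.nat 2 0 1 = v ∧ m.nat 2 0 2 =
        (strategy v u K).add.elim 0 fun u => (u : ℕ) + 1)
      (Ends.of_flat_mul rfl (by decide) hn1 ?_) fun m3 s3 h3 => ?_
    · by_cases huv : u = v
      · simp [huv, hu2, hv2, h2, strategy]
      · simp [huv, Fin.val_inj, hu2, hv2, h2, strategy]
    have s3' : ∀ a, a ≠ 2 → m3.nat a = m.nat a := fun a ha => by
      have hw : (2 == a) = false := by simpa using ha.symm
      rw [s3.nat a (by simpa [Program.writesNat] using ha.symm),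
        s2.nat a (by simpa [Program.writesNat] using ha.symm),
        s1.nat a (by simpa [Program.writesNat] using ha.symm)]
    -- Table codes are shifted by one, `0` marking an empty cell; the shift is undone here.
    refine Ends.seq_mul (c := 20) (c' := 200) (by decide) (Q := fun m => m.nat 40 0 0 = code K)
      (Ends.of_flat_mul rfl (by decide) hn1 ?_) fun m4 s4 h4 => ?_
    · simp [s3' 0, s3' 11, s3' 23, hn, hd, hk, hK]
    refine (decode_ends (Or.inl rfl) (by rw [s4.nat 0 rfl, s3' 0 (by decide), hn]) hn1
      (fun i hi => by rw [s4.nat 4 rfl, s3' 4 (by decide)]; exact hp i hi) h4).mono le_rfl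
      fun m5 s5 h5 => ?_
    have e2 : m5.nat 2 = m3.nat 2 := by rw [s5.nat 2 rfl, s4.nat 2 rfl]
    refine ⟨Or.inr ⟨by rw [e2]; exact h3.1, v, strategy v u K, ⟨?_, ?_, h5⟩, himp⟩,
      fun _ => by rw [e2]; exact h3.1⟩
    · rw [e2]; exact h3.2.1
    · rw [e2]; exact h3.2.2
  · refine Ends.skip_mul (by decide) hn1 (h.mono ?_)
    rintro (h | ⟨f, hf, hpos⟩)
    · exact h
    · refine absurd ?_ hc
      simp only [Test.Holds, NatExpr.eval, RealExpr.eval, hn, hd, Nat.cast_zero]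
      exact ⟨(hb.2 f hf).1, hpos.trans_le (hb.2 f hf).2⟩

theorem threshold_ends (hm : HasInput G α q m) (hr : HasRank G α q m)
    (hv : m.nat 20 0 0 = v) (hu : m.nat 21 0 0 = u) (hd : m.nat 23 0 0 = d)
    {R : Finset (Fin n)} (hval : HasValues G α q v R m) :
    Ends thresholdProg m 200 fun m' => m'.real 12 0 0 = threshold G α q v u R d := by
  refine (Ends.of_flat rfl ?_).le (by decide)
  unfold threshold
  by_cases huv : u = v
  · simp [thresholdProg, huv, hu, hv, hr v]
  · by_cases hlt : pageRank G α q v <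
      d * (pageRank G α q u - fromJump G α q v R u) / fromStart G α v R u
    · simp [thresholdProg, huv, Fin.val_inj, hu, hv, hr v, hr u, hd, hm.size, (hval u).1, (hval u).2, hlt, hlt.le]
    · simp [thresholdProg, huv, Fin.val_inj, hu, hv, hr v, hr u, hd, hm.size, (hval u).1, (hval u).2, hlt,
        not_lt.1 hlt]

/-- The strategy `s` of `v` is improving, adds the edge to `u`, and retains the set `S` of
neighbours in the component of `u`. -/
def ImprovesBy (G : SimpleGraph (Fin n)) (α : ℝ) (q : Fin n → ℝ) (v u : Fin n)
    (comp : Fin n → ℕ) (S : Finset (Fin n)) (s : Strategy (Fin n)) : Prop :=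
  IsImproving G α q v s ∧ s.add = (if u = v then none else some u) ∧
    (s.keep.filter fun x => comp x = comp u) = S

theorem notMem_ends (hS : S ⊆ nbrs G v comp (comp u)) : v ∉ ends v u S := by
  unfold ends
  split_ifs with h
  · exact fun h => (mem_nbrs.1 (hS h)).1.ne rfl
  · simp only [Finset.mem_insert, not_or]
    exact ⟨Ne.symm h, fun h => (mem_nbrs.1 (hS h)).1.ne rfl⟩

theorem degree_ends (hn1 : 1 ≤ n) (h0 : 0 < α) (h1 : α < 1) (hq : IsDistribution q)
    (hm : HasInput G α q m) (hp : HasPow n m) (hr : HasRank G α q m)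
    (hl : IsLabel G v comp) (ht : HasTable (nbrs G v comp) opt m)
    (htv : HasTableValues G α q v (nbrs G v comp) opt m)
    {E : ℕ} (hE : ∀ c, 2 ^ (nbrs G v comp c).card ≤ E)
    (hv : m.nat 20 0 0 = v) (hu : m.nat 21 0 0 = u) (huv : ¬ G.Adj v u)
    (hS : S ⊆ nbrs G v comp (comp u)) (hval : HasValues G α q v (ends v u S) m)
    (h31 : m.nat 31 0 0 = comp u) (h27 : m.nat 27 0 0 = (ends v u S).card)
    (h28 : m.nat 28 0 0 = code S)
    (h14 : m.real 14 0 0 = fromJump G α q v (ends v u S) v - α * q v)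
    (h15 : m.real 15 0 0 = fromStart G α v (ends v u S) v)
    (h32 : m.nat 32 0 0 = d) (hd : d < n) {P₀ : Prop} (h : Progress G α q P₀ m) :
    Ends (.seq (setVar 23 (.add (var 32) (lit 1))) (.seq thresholdProg (.seq choiceProg reportProg)))
      m (9000 * (n * (n * E)))
      (Progress G α q (P₀ ∨ ∃ s, ImprovesBy G α q v u comp S s ∧
        (ends v u s.keep).card = d + 1)) := by
  have hE1 : 1 ≤ E := Nat.one_le_two_pow.trans (hE 0)
  have hf : n ≤ n * (n * E) := Nat.le_mul_of_pos_right n (Nat.mul_pos hn1 hE1)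
  have hf1 : 1 ≤ n * (n * E) := hn1.trans hf
  have hopt : IsListing G v comp opt := ⟨ht.zero, ht.sub, ht.surj⟩
  refine Ends.seq_mul (c := 10) (c' := 8800) (by decide) (Q := fun m => m.nat 23 0 0 = d + 1)
    (Ends.of_flat_mul rfl (by decide) hf1 (by simp [h32])) fun m1 s1 e1 => ?_
  have hm1 := hm.same s1
  have hv1 : m1.nat 20 0 0 = v := by rw [s1.nat 20 rfl, hv]
  have hu1 : m1.nat 21 0 0 = u := by rw [s1.nat 21 rfl, hu]
  set T := threshold G α q v u (ends v u S) (d + 1) with hT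
  refine Ends.seq_mul (c := 200) (c' := 8500) (by decide) (Q := fun m => m.real 12 0 0 = T)
    ((threshold_ends hm1 (hr.same s1) hv1 hu1 e1 (hval.same s1)).le
      (Nat.le_mul_of_pos_right _ hf1)) fun m2 s2 e2 => ?_
  have hm2 := hm1.same s2
  have hv2 : m2.nat 20 0 0 = v := by rw [s2.nat 20 rfl, hv1]
  have hu2 : m2.nat 21 0 0 = u := by rw [s2.nat 21 rfl, hu1]
  have e23 : m2.nat 23 0 0 = d + 1 := by rw [s2.nat 23 rfl, e1]
  have ht2 := (ht.same s1).same s2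
  have htv2 := (htv.same s1).same s2
  set O := strategyOptions G α q v u comp opt S (d + 1) with hO
  have hlenO : ∀ c, O.len c = if c = comp u then 1 else 2 ^ (nbrs G v comp c).card := fun c => rfl
  have hlt : ∀ {c j}, j < O.len c → j < 2 ^ (nbrs G v comp c).card := fun {c j} hj => by
    rw [hlenO] at hj
    split_ifs at hj
    · exact hj.trans_le Nat.one_le_two_pow
    · exact hj
  have ho : HasOptions (n := n) O (d + 1) T m2 :=
    ⟨fun c hc j hj => ht2.size c hc j (hlt hj), fun c hc j hj => ht2.code c hc j (hlt hj),
      fun c hc j hj => by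
        rw [(htv2 c hc j (hlt hj)).1, (htv2 c hc j (hlt hj)).2]
        rfl, e23, e2⟩
  -- The loop counter `d` stands for `d + 1` edges, so every size considered is positive and the
  -- resulting strategy leaves `v` with an edge.
  have hbest := choice_ends hn1 hm2 hv2 hd ho (cu := comp u) (E := E)
    (by rw [s2.nat 31 rfl, s1.nat 31 rfl, h31])
    (fun c hc => by rw [hlenO, ht2.cnt c hc])
    (fun c hc => by
      rw [hlenO]
      split_ifs
      · exact hE1
      · exact hE c) hE1
    (by rw [s2.nat 27 rfl, s1.nat 27 rfl, h27]; rfl)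
    (by rw [s2.nat 28 rfl, s1.nat 28 rfl, h28]; rfl)
    (by rw [s2.real 14 rfl, s1.real 14 rfl, h14, s2.real 15 rfl, s1.real 15 rfl, h15]; rfl)
  refine Ends.seq_mul (c := 8000) (c' := 400) (by decide) hbest fun m3 s3 e3 => ?_
  refine ((report_ends hn1 (hm2.same s3).size (((hp.same s1).same s2).same s3)
    (by rw [s3.nat 20 rfl, hv2]) (by rw [s3.nat 21 rfl, hu2]) (by rw [s3.nat 23 rfl, e23]) e3
    (fun f hf hpos => ?_) (((h.same s1).same s2).same s3)).le (Nat.mul_le_mul_left _ hf)).mono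
    le_rfl fun m4 _ h4 => h4.mono (Or.imp_right ?_)
  · obtain ⟨-, hcode, himp⟩ := choice_strategy h0 h1 hq hl hopt huv hS hf.1
    exact ⟨_, hcode, (himp hf.2).2 ⟨by omega, hpos⟩⟩
  · rintro ⟨⟨K, a⟩, ⟨himp, hadd, hK⟩, hcard⟩
    simp only at hadd hK hcard
    subst hadd
    obtain ⟨f, hf, rfl⟩ := exists_choice (α := α) (q := q) (d := d + 1) hl hopt himp.1.1 hK
    obtain ⟨hsize, -, hiff⟩ := choice_strategy h0 h1 hq hl hopt huv hS hf
    rw [hcard] at hsize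
    exact ⟨f, ⟨hf, hsize⟩, ((hiff hsize).1 himp).2⟩

theorem entry_ends (hn1 : 1 ≤ n) (h0 : 0 < α) (h1 : α < 1) (hq : IsDistribution q)
    (hm : HasInput G α q m) (hp : HasPow n m) (hr : HasRank G α q m)
    (hl : IsLabel G v comp) (ht : HasTable (nbrs G v comp) opt m)
    (htv : HasTableValues G α q v (nbrs G v comp) opt m)
    {E : ℕ} (hE : ∀ c, 2 ^ (nbrs G v comp c).card ≤ E)
    (hv : m.nat 20 0 0 = v) (hu : m.nat 21 0 0 = u) (huv : ¬ G.Adj v u)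
    (h31 : m.nat 31 0 0 = comp u) {j : ℕ} (hj : j < 2 ^ (nbrs G v comp (comp u)).card)
    (h22 : m.nat 22 0 0 = j) {P₀ : Prop} (h : Progress G α q P₀ m) :
    Ends entryProg m (30000 * (n * (n * (n * E))))
      (Progress G α q (P₀ ∨ ∃ s, ImprovesBy G α q v u comp (opt (comp u) j) s)) := by
  have hE1 : 1 ≤ E := Nat.one_le_two_pow.trans (hE 0)
  set F := n * (n * (n * E)) with hF
  have hF3 : n * (n * n) ≤ F := by
    rw [hF]
    gcongr
    exact Nat.le_mul_of_pos_right n hE1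
  have hFn : n ≤ F := (Nat.le_mul_of_pos_right n (Nat.mul_pos hn1 hn1)).trans hF3
  have hF1 : 1 ≤ F := hn1.trans hFn
  have hcu := hl.lt u
  set S := opt (comp u) j with hSdef
  have hS : S ⊆ nbrs G v comp (comp u) := ht.sub _ hcu j hj
  refine Ends.seq_mul (c := 10) (c' := 29000) (by decide) (Q := fun m => m.nat 28 0 0 = code S)
    (Ends.of_flat_mul rfl (by decide) hF1 (by simp [h31, h22, ht.code _ hcu j hj, hSdef]))
    fun m1 s1 e1 => ?_
  refine Ends.seq_mul (c := 10) (c' := 28000) (by decide) (Q := fun m => m.nat 40 0 0 = code S)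
    (Ends.of_flat_mul rfl (by decide) hF1 (by simp [e1])) fun m2 s2 e2 => ?_
  have hm2 := (hm.same s1).same s2
  refine Ends.seq_mul (c := 200) (c' := 27000) (by decide)
    ((decode_ends (Or.inr rfl) hm2.size hn1 ((hp.same s1).same s2) e2).le
      (Nat.mul_le_mul_left _ hFn)) fun m3 s3 e3 => ?_
  have hm3 := hm2.same s3
  have ht3 := ((ht.same s1).same s2).same s3
  have e22 : m3.nat 22 0 0 = j := by rw [s3.nat 22 rfl, s2.nat 22 rfl, s1.nat 22 rfl, h22]
  have e31 : m3.nat 31 0 0 = comp u := by rw [s3.nat 31 rfl, s2.nat 31 rfl, s1.nat 31 rfl, h31]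
  refine Ends.seq_mul (c := 10) (c' := 26000) (by decide) (Q := fun m => m.nat 27 0 0 = S.card)
    (Ends.of_flat_mul rfl (by decide) hF1 (by simp [e22, e31, ht3.size _ hcu j hj, hSdef]))
    fun m4 s4 e4 => ?_
  have hv4 : m4.nat 20 0 0 = v := by
    rw [s4.nat 20 rfl, s3.nat 20 rfl, s2.nat 20 rfl, s1.nat 20 rfl, hv]
  have hu4 : m4.nat 21 0 0 = u := by
    rw [s4.nat 21 rfl, s3.nat 21 rfl, s2.nat 21 rfl, s1.nat 21 rfl, hu]
  have h9 : HasSet 9 S m4 := e3.same s4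
  refine Ends.seq_mul (c := 50) (c' := 25000) (by decide)
    (Q := fun m => m.nat 27 0 0 = (ends v u S).card ∧ HasSet 9 (ends v u S) m)
    (Ends.of_flat_mul rfl (by decide) hF1 ?_) fun m5 s5 e5 => ?_
  · by_cases h' : u = v
    · simpa [h', hv4, hu4, ends, e4] using h9
    -- The size grows by exactly one because `u` is no neighbour of `v`.
    · have huS : u ∉ S := fun hmem => huv (mem_nbrs.1 (hS hmem)).1
      simp [h', hv4, hu4, ends, e4, Fin.val_inj, Finset.card_insert_of_notMem huS]
      intro w
      by_cases hw : w = u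
      · simp [hw]
      · simpa [Fin.val_inj, hw] using h9 w
  have hm5 := (hm3.same s4).same s5
  have hv5 : m5.nat 20 0 0 = v := by rw [s5.nat 20 rfl, hv4]
  refine Ends.assoc (Ends.seq_mul (c := 4000) (c' := 20000) (by decide)
    ((build_solve_ends hn1 h0 h1 hm5 hv5 e5.2 fun w hw hwv => notMem_ends hS
      (Fin.val_inj.1 hwv ▸ hw)).le (Nat.mul_le_mul_left _ hF3)) fun m6 s6 e6 => ?_)
  have hm6 := hm5.same s6
  have hv6 : m6.nat 20 0 0 = v := by rw [s6.nat 20 rfl, hv5]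
  refine Ends.seq_mul (c := 50) (c' := 19900) (by decide)
    (Q := fun m => m.real 14 0 0 = fromJump G α q v (ends v u S) v - α * q v)
    (Ends.of_flat_mul rfl (by decide) hF1
      (by simp [hm6.size, hv6, (e6 v).1, hm6.damp, hm6.jump v])) fun m7 s7 e7 => ?_
  have hm7 := hm6.same s7
  have hv7 : m7.nat 20 0 0 = v := by rw [s7.nat 20 rfl, hv6]
  refine Ends.seq_mul (c := 50) (c' := 19800) (by decide)
    (Q := fun m => m.real 15 0 0 = fromStart G α v (ends v u S) v)
    (Ends.of_flat_mul rfl (by decide) hF1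
      (by simp [hm7.size, hv7, ((e6.same s7 :) v).2])) fun m8 s8 e8 => ?_
  have hm8 := hm7.same s8
  refine (Ends.search (P₀ := P₀) (N := n) (B := n) (f := n * (n * E)) (c := 9000)
    (P := fun d => ∃ s, ImprovesBy G α q v u comp S s ∧ (ends v u s.keep).card = d + 1)
    (by decide) le_rfl hn1 (Nat.mul_pos hn1 (Nat.mul_pos hn1 hE1)) rfl (fun m9 s9 => ?_) rfl
    (by decide) (by decide)
    ((((((((h.same s1).same s2).same s3).same s4).same s5).same s6).same s7).same s8)
    fun d hd m9 s9 e9 P₁ h9' => ?_).mono le_rfl fun m9 _ h9' => h9'.mono (Or.imp_right ?_)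
  · simp [(hm8.same s9).size]
  · have nat9 : ∀ a, m8.nat a 0 0 = m6.nat a 0 0 := fun a => by
      rw [s8.nat a rfl, s7.nat a rfl]
    refine degree_ends (opt := opt) (E := E) hn1 h0 h1 hq (hm8.same s9)
      (((((((((hp.same s1).same s2).same s3).same s4).same s5).same s6).same s7).same s8).same s9)
      (((((((((hr.same s1).same s2).same s3).same s4).same s5).same s6).same s7).same s8).same s9)
      hl
      ((((((ht3.same s4).same s5).same s6).same s7).same s8).same s9)
      (((((((((htv.same s1).same s2).same s3).same s4).same s5).same s6).same s7).same s8).same s9)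
      hE ?_ ?_ huv hS (((e6.same s7).same s8).same s9) ?_ ?_ ?_ ?_ ?_ e9 hd h9'
    · rw [s9.nat 20 rfl, nat9, hv6]
    · rw [s9.nat 21 rfl, nat9, s6.nat 21 rfl, s5.nat 21 rfl, hu4]
    · rw [s9.nat 31 rfl, nat9, s6.nat 31 rfl, s5.nat 31 rfl, s4.nat 31 rfl, e31]
    · rw [s9.nat 27 rfl, nat9, s6.nat 27 rfl, e5.1]
    · rw [s9.nat 28 rfl, nat9, s6.nat 28 rfl, s5.nat 28 rfl, s4.nat 28 rfl, s3.nat 28 rfl,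
        s2.nat 28 rfl, e1]
    · rw [s9.real 14 rfl, s8.real 14 rfl, e7]
    · rw [s9.real 15 rfl, e8]
  · rintro ⟨s, hs⟩
    have hvends : v ∉ ends v u s.keep := by
      unfold ends
      split_ifs with h
      · exact fun h => (hs.1.1.1 v h).ne rfl
      · simp only [Finset.mem_insert, not_or]
        exact ⟨Ne.symm h, fun h => (hs.1.1.1 v h).ne rfl⟩
    have hpos : 0 < (ends v u s.keep).card := by
      rw [Finset.card_pos]
      rcases hs.1.1.2.1 with h | h
      · unfold ends
        split_ifs
        · exact h
        · exact Finset.insert_nonempty _ _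
      · rw [hs.2.1] at h
        by_cases huv' : u = v
        · simp [huv'] at h
        · rw [ends, if_neg huv']
          exact Finset.insert_nonempty _ _
    have hle : (ends v u s.keep).card ≤ n := by
      simpa using Finset.card_le_univ (ends v u s.keep)
    -- An available strategy has between `1` and `n` edges, so its size is reached by the loop.
    exact ⟨(ends v u s.keep).card - 1, by omega, s, hs, by omega⟩

/-- The preprocessing, dominated by `n · 2 ^ k` linear systems, stays below the cost of the search
since `2 ^ k ≥ 1`. -/
theorem player_ends (hn1 : 1 ≤ n) (h0 : 0 < α) (h1 : α < 1) (hq : IsDistribution q)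
    (hm : HasInput G α q m) (hp : HasPow n m) (hr : HasRank G α q m)
    (hv : m.nat 20 0 0 = v) {P₀ : Prop} (h : Progress G α q P₀ m) :
    Ends playerProg m (200000 * (n * (2 ^ param G * (n * (n * (n * 2 ^ param G))))))
      (Progress G α q (P₀ ∨ ∃ s, IsImproving G α q v s)) := by
  set E := 2 ^ param G with hEdef
  have hE1 : 1 ≤ E := Nat.one_le_two_pow
  set F := n * (E * (n * (n * (n * E)))) with hF
  have hnn := Nat.mul_pos hn1 hn1
  have hF1 : n * (E * (n * (n * n))) ≤ F := by
    rw [hF]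
    gcongr
    exact Nat.le_mul_of_pos_right n hE1
  have hF2 : n * E ≤ F := le_trans (by
    gcongr
    exact Nat.le_mul_of_pos_right E (Nat.mul_pos hn1 hnn)) hF1
  have hF3 : n * (n * n) ≤ F := le_trans (Nat.mul_le_mul_left n
    ((Nat.le_mul_of_pos_left _ hn1).trans (Nat.le_mul_of_pos_left _ hE1))) hF1
  refine Ends.seq_mul (c := 1000) (c' := 190000) (by decide)
    ((comp_ends hn1 hm hv).le (Nat.mul_le_mul_left _ hF3)) fun m1 s1 e1 => ?_
  obtain ⟨comp, hl, hc1⟩ := e1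
  have hE : ∀ c, 2 ^ (nbrs G v comp c).card ≤ E := fun c =>
    Nat.pow_le_pow_right (by decide) (hl.card_nbrs_le c)
  have hm1 := hm.same s1
  have hv1 : m1.nat 20 0 0 = v := by rw [s1.nat 20 rfl, hv]
  have hp1 := hp.same s1
  refine Ends.seq_mul (c := 1000) (c' := 180000) (by decide)
    ((table_ends hn1 hm1 hv1 hp1 hl hc1 hE).le (Nat.mul_le_mul_left _ hF2)) fun m2 s2 e2 => ?_
  obtain ⟨opt, ht2⟩ := e2
  have hm2 := hm1.same s2
  have hv2 : m2.nat 20 0 0 = v := by rw [s2.nat 20 rfl, hv1]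
  have hp2 := hp1.same s2
  refine Ends.seq_mul (c := 20000) (c' := 150000) (by decide)
    ((value_ends hn1 h0 h1 hm2 hv2 hp2 ht2 (fun c hvc => (mem_nbrs.1 hvc).1.ne rfl) hE).le
      (Nat.mul_le_mul_left _ hF1)) fun m3 s3 htv3 => ?_
  have hm3 := hm2.same s3
  have hv3 : m3.nat 20 0 0 = v := by rw [s3.nat 20 rfl, hv2]
  have hp3 := hp2.same s3
  have ht3 := ht2.same s3
  have hc3 := (hc1.same s2).same s3
  have hr3 := ((hr.same s1).same s2).same s3
  have hf1 : 1 ≤ n * (n * (n * E)) := Nat.mul_pos hn1 (Nat.mul_pos hn1 (Nat.mul_pos hn1 hE1))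
  refine (Ends.search (P₀ := P₀) (N := n) (B := n) (f := E * (n * (n * (n * E)))) (c := 70000)
    (P := fun i => ∃ (hi : i < n), ∃ s, IsImproving G α q v s ∧
      s.add = if (⟨i, hi⟩ : Fin n) = v then none else some ⟨i, hi⟩)
    (by decide) le_rfl hn1 (Nat.mul_pos hE1 hf1) rfl (fun m4 s4 => ?_) rfl
    (by decide) (by decide) (((h.same s1).same s2).same s3)
    fun i hi m4 s4 e4 P₁ h4 => ?_).mono le_rfl fun m4 _ h4 => h4.mono (Or.imp_right ?_)
  · simp [(hm3.same s4).size]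
  · have hm4 := hm3.same s4
    have hv4 : m4.nat 20 0 0 = v := by rw [s4.nat 20 rfl, hv3]
    have hadj := hm4.adj v ⟨i, hi⟩
    simp only at hadj
    refine Ends.ite_mul (c := 65000) (by decide) (Nat.mul_pos hE1 hf1) (fun hcond => ?_)
      fun hcond => ?_
    · simp only [Test.Holds, NatExpr.eval, hv4, e4, hadj] at hcond
      have huv : ¬ G.Adj v ⟨i, hi⟩ := fun h => by simp [h] at hcond
      have hci := (hc3.same s4 :) ⟨i, hi⟩
      refine Ends.seq_mul (c := 10) (c' := 64000) (by decide)
        (Q := fun m => m.nat 31 0 0 = comp ⟨i, hi⟩)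
        (Ends.of_flat_mul rfl (by decide) (Nat.mul_pos hE1 hf1) (by simpa [e4] using hci))
        fun m5 s5 e5 => ?_
      have hm5 := hm4.same s5
      have ht5 := (ht3.same s4).same s5
      refine (Ends.search (P₀ := P₁) (N := 2 ^ (nbrs G v comp (comp ⟨i, hi⟩)).card) (B := E)
        (f := n * (n * (n * E))) (c := 30000)
        (P := fun j => ∃ s, ImprovesBy G α q v ⟨i, hi⟩ comp (opt (comp ⟨i, hi⟩) j) s)
        (by decide) (hE _) hE1 hf1 rfl (fun m6 s6 => ?_) rfl
        (by decide) (by decide) (h4.same s5)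
        fun j hj m6 s6 e6 P₂ h6 => ?_).mono le_rfl fun m6 _ h6 => h6.mono (Or.imp_right ?_)
      · simp [s6.nat 31 rfl, e5, (ht5.same s6).cnt _ (hl.lt _)]
      · exact entry_ends hn1 h0 h1 hq (hm5.same s6) (((hp3.same s4).same s5).same s6)
          (((hr3.same s4).same s5).same s6) hl (ht5.same s6)
          (((htv3.same s4).same s5).same s6) hE (by rw [s6.nat 20 rfl, s5.nat 20 rfl, hv4])
          (by rw [s6.nat 21 rfl, s5.nat 21 rfl, e4]) huv (by rw [s6.nat 31 rfl, e5]) hj e6 h6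
      · rintro ⟨_, s, hs, hadd⟩
        -- The trace of the strategy on the component of the additional vertex is some table entry,
        -- and the search visits that entry.
        obtain ⟨j, hj, hopt⟩ := ht5.surj (comp ⟨i, hi⟩) (hl.lt _)
          (s.keep.filter fun x => comp x = comp ⟨i, hi⟩) fun x hx => by
            rw [Finset.mem_filter] at hx
            exact mem_nbrs.2 ⟨hs.1.1 x hx.1, hx.2⟩
        exact ⟨j, hj, s, hs, hadd, hopt.symm⟩
    · refine Ends.skip_mul (by decide) (Nat.mul_pos hE1 hf1) (h4.mono ?_)
      rintro (h | ⟨_, s, hs, hadd⟩)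
      · exact h
      · refine absurd ?_ hcond
        simp only [Test.Holds, NatExpr.eval, hv4, e4, hadj]
        rw [if_neg]
        intro hvi
        have hne : (⟨i, hi⟩ : Fin n) ≠ v := hvi.ne'
        rw [if_neg hne] at hadd
        exact (hs.1.2.2 _ hadd).2.1 hvi
  · rintro ⟨s, hs⟩
    -- A strategy without an added edge is found in the round `u = v`.
    rcases hadd : s.add with _ | u
    · exact ⟨v, v.2, v.2, s, hs, by simp [hadd]⟩
    · refine ⟨u, u.2, u.2, s, hs, ?_⟩
      have := (hs.1.2.2 u hadd).1
      simp [hadd, this]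

theorem isNash_iff : IsNash G α q ↔ ¬ ∃ v s, IsImproving G α q v s := by
  simp only [IsNash, IsImproving, not_exists, not_and, not_lt]

theorem nash_ends (hn1 : 1 ≤ n) (h0 : 0 < α) (h1 : α < 1) (hq : IsDistribution q) :
    Ends nashProg (input G α q) (1000000 * (2 ^ (2 * param G) * n ^ 5))
      (Progress G α q (∃ v s, IsImproving G α q v s)) := by
  have hm := hasInput_input G α q
  set E := 2 ^ param G with hEdef
  have hE1 : 1 ≤ E := Nat.one_le_two_pow
  -- The factors follow the nesting of the loops: players, additional vertices, parts in the
  -- component of that vertex, numbers of edges, components, sizes, options.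
  have hF : 2 ^ (2 * param G) * n ^ 5 = n * (n * (E * (n * (n * (n * E))))) := by
    rw [hEdef]; ring
  rw [hF]
  set F := n * (n * (E * (n * (n * (n * E))))) with hF
  have hnn := Nat.mul_pos hn1 hn1
  have hg : 1 ≤ n * (E * (n * (n * (n * E)))) :=
    Nat.mul_pos hn1 (Nat.mul_pos hE1 (Nat.mul_pos hn1 (Nat.mul_pos hn1 (Nat.mul_pos hn1 hE1))))
  have hF3 : n * (n * n) ≤ F := by
    rw [hF]
    gcongr
    calc n ≤ n * (n * (n * E)) := Nat.le_mul_of_pos_right n (Nat.mul_pos hn1 (Nat.mul_pos hn1 hE1))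
      _ ≤ _ := Nat.le_mul_of_pos_left _ hE1
  have hFn : n ≤ F := Nat.le_mul_of_pos_right n hg
  refine Ends.seq_mul (c := 100) (c' := 900000) (by decide)
    ((pow_ends hm.size hn1).le (Nat.mul_le_mul_left _ hFn)) fun m1 s1 hp1 => ?_
  have hm1 := hm.same s1
  -- Unused memory is zero, so the array for the changed neighbourhood initially holds the empty
  -- set.
  have h9 : HasSet 9 (∅ : Finset (Fin n)) m1 := fun w => by
    rw [s1.nat 9 rfl]
    simp [input]
  refine Ends.seq_mul (c := 5000) (c' := 800000) (by decide)
    ((rank_ends hn1 h0 h1 hq hm1 h9).le (Nat.mul_le_mul_left _ hF3)) fun m2 s2 hr2 => ?_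
  refine Ends.seq_mul (c := 10) (c' := 700000) (by decide) (Q := fun m => m.nat 2 0 0 = 1)
    (Ends.of_flat_mul rfl (by decide) (hn1.trans hFn) (by simp)) fun m3 s3 e3 => ?_
  have hm3 := (hm1.same s2).same s3
  refine (Ends.search (P₀ := False) (N := n) (B := n) (f := n * (E * (n * (n * (n * E)))))
    (c := 200000) (P := fun i => ∃ (hi : i < n), ∃ s, IsImproving G α q ⟨i, hi⟩ s)
    (by decide) le_rfl hn1 hg rfl (fun m4 s4 => ?_) rfl (by decide) (by decide)
    ⟨Or.inl e3, False.elim⟩ fun i hi m4 s4 e4 P₁ h4 => ?_).mono le_rfl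
    fun m4 _ h4 => h4.mono ?_
  · simp [(hm3.same s4).size]
  · refine (player_ends (v := ⟨i, hi⟩) hn1 h0 h1 hq (hm3.same s4) (((hp1.same s2).same s3).same s4)
      ((hr2.same s3).same s4) e4 h4).mono le_rfl fun m5 _ h5 => h5.mono (Or.imp_right ?_)
    rintro ⟨_, h⟩
    exact h
  · rintro ⟨v, s, hs⟩
    exact Or.inr ⟨v, v.2, v.2, s, hs⟩

end Specifications
end PageRankGame

/-! ### The main theorem -/

theorem theorem5p1 :
    ∃ (p : PageRankGame.Program) (C : ℕ),
      ∀ (n : ℕ) (G : SimpleGraph (Fin n)) (α : ℝ) (q : Fin n → ℝ),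
        0 < α → α < 1 → PageRankGame.IsDistribution q →
        ∃ (m : PageRankGame.Memory) (t : ℕ),
          PageRankGame.Runs p (PageRankGame.input G α q) m t ∧
          t ≤ C * (2 ^ (2 * PageRankGame.param G) * n ^ 5) ∧
          (PageRankGame.IsNash G α q → m.verdict = 1) ∧
          (¬ PageRankGame.IsNash G α q →
            m.verdict = 0 ∧
            ∃ (v : Fin n) (s : PageRankGame.Strategy (Fin n)),
              m.Reports v s ∧ PageRankGame.IsImproving G α q v s) := by
  refine ⟨PageRankGame.nashProg, 1000000, fun n G α q h0 h1 hq => ?_⟩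
  -- On an empty vertex set no function has sum `1`.
  have hn : 1 ≤ n := by
    rcases Nat.eq_zero_or_pos n with rfl | h
    · simpa using hq.2
    · exact h
  obtain ⟨m, t, hrun, ht, hsound, hcomplete⟩ := PageRankGame.nash_ends (G := G) hn h0 h1 hq
  refine ⟨m, t, hrun, ht, fun hN => ?_, fun hN => ?_⟩
  · rcases hsound with h | ⟨-, h⟩
    · exact h
    · obtain ⟨v, s, -, hs⟩ := h
      exact absurd ⟨v, s, hs⟩ (PageRankGame.isNash_iff.1 hN)
  · rw [PageRankGame.isNash_iff, not_not] at hN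
    have h := hcomplete hN
    refine ⟨h, ?_⟩
    rcases hsound with h' | ⟨-, h'⟩
    · omega
    · exact h'
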